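/- Let $\mathbb{L}^{n+3}$ be $\mathbb{R}^{n+3}$ with the Lorentz product of signature $(-,+,\dots,+)$ and $\mathbb{S}^{n+2}_{1,1}=\{p\in\mathbb{L}^{n+3}:\langle p,p\rangle=1\}$. Let $L^2$ be a coordinate domain in the $(u,v)$-plane, $s\colon L^2\to\mathbb{S}^{n+2}_{1,1}$ a smooth immersion with nondegenerate (for example Riemannian) induced metric $\langle\,,\rangle$, $\nabla$ its Levi-Civita connection, $\alpha$ its second fundamental form, and $J$ a $(1,1)$-tensor on $L^2$ with $\alpha(X,JY)=\alpha(JX,Y)$ for all $X,Y$. The surface $s$ is hyperbolic if $J^2=I$, elliptic if $J^2=-I$. Consider triples $(D_1,D_2,\psi)$ of smooth $(1,1)$-tensors $D_1,D_2$ with values in $\mathrm{span}\{I,J\}$ and a smooth one-form $\psi$ such that, at every point of $L^2$ and for $\{i,j\}=\{1,2\}$, (a) $\det D_i=1/2$; (b) $(\nabla_XD_i)Y-(\nabla_YD_i)X=(-1)^j(\psi(X)D_jY-\psi(Y)D_jX)$; (c) $d\psi(X,Y)=\langle D_2X,D_1Y\rangle-\langle D_1X,D_2Y\rangle$; (d)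 $D_2^2\neq\pm D_1^2$; (e) $\mathrm{rank}(D_1^2+D_2^2-I)=2$. Triples are identified up to signs and permutation, that is, $(D_1,D_2,\psi)\sim(\varepsilon_1D_1,\varepsilon_2D_2,\varepsilon_1\varepsilon_2\psi)\sim(\varepsilon_1D_2,\varepsilon_2D_1,-\varepsilon_1\varepsilon_2\psi)$ for constants $\varepsilon_1,\varepsilon_2\in\{1,-1\}$. **Hyperbolic case.** Let $L^2=I\times K$ with $I,K$ open intervals containing $0$, and let $(u,v)$ be real-conjugate: $J\partial_u=\partial_u$, $J\partial_v=-\partial_v$. Put $\nabla_{\partial_u}\partial_v=\Gamma^1\partial_u+\Gamma^2\partial_v$, $F=\langle\partial_u,\partial_v\rangle$, $Q(\theta)=\theta_{uv}-\Gamma^1\theta_u-\Gamma^2\theta_v+F\theta$. For smooth $U$ on $I$ and $V$ on $K$ let $\varphi^U(u,v)=U(u)e^{2\int_0^v\Gamma^1(u,t)dt}$ and $\phi^V(u,v)=V(v)e^{2\int_0^u\Gamma^2(t,v)dt}$. Let $\mathcal{C}_s$ be the set of pairs $(U,V)$ such that one of the conditions $U,V>0$; $\;0<2\varphi^U<-(2\phi^V+1)$;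 $\;0<2\phi^V<-(2\varphi^U+1)$ holds on all of $L^2$, and $Q(\rho)=0$ for $\rho=\sqrt{|2(\varphi^U+\phi^V)+1|}$. **Elliptic case.** Let $L^2$ be the disc $|z|<r$, $z=u+iv$, and let $(u,v)$ be complex-conjugate: $J\partial_u=\partial_v$, $J\partial_v=-\partial_u$. Put $\partial_z=\frac12(\partial_u-i\partial_v)$, $\partial_{\bar z}=\frac12(\partial_u+i\partial_v)$, and, extending $\mathbb{C}$-bilinearly, $\nabla_{\partial_z}\partial_{\bar z}=\Gamma\partial_z+\bar\Gamma\partial_{\bar z}$, $F=\langle\partial_z,\partial_{\bar z}\rangle$, $Q(\theta)=\theta_{z\bar z}-\Gamma\theta_z-\bar\Gamma\theta_{\bar z}+F\theta$. Let $\varphi_0$ be a nowhere vanishing smooth solution of $\varphi_{\bar z}=2\Gamma\varphi$ on the disc, and for holomorphic $\zeta$ let $\varphi^\zeta=\zeta\varphi_0$. Let $\mathcal{C}_s$ be the set of holomorphic $\zeta$ on the disc such that $\varphi^\zeta\neq-\frac12$ and $4\,\mathrm{Re}\,\varphi^\zeta+1<0$ everywhere, and $Q(\rho)=0$ for $\rho=\sqrt{-(4\,\mathrm{Re}\,\varphi^\zeta+1)}$.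 **Claim.** In the elliptic case such $\varphi_0$ exist. If moreover $\Gamma(z,\bar z)$ extends to a holomorphic function of two independent variables $(z,w)$, $|z|,|w|<r$, then $\varphi_0$ can be chosen so that, for every holomorphic $\zeta$, $\varphi^\zeta$ is the unique solution of $\varphi_{\bar z}=2\Gamma\varphi$ that extends likewise and satisfies $\varphi(z,0)=\zeta(z)$. In both cases, and for every choice of $\varphi_0$ in the elliptic one, a triple satisfying (a)–(e) exists if and only if $\mathcal{C}_s$ is nonempty. Moreover, classes of triples up to signs and permutation correspond bijectively to the elements of $\mathcal{C}_s$: in the hyperbolic case $(D_1,D_2,\psi)$ corresponds to $(U,V)$ when $2(D_1^2+D_2^2)$ has eigenvalue $2+1/\varphi^U$ on $\partial_u$ and $2+1/\phi^V$ on $\partial_v$; in the elliptic case it corresponds to $\zeta$ when the $\mathbb{C}$-linear extension of $2(D_1^2+D_2^2)$ has eigenvalue $2+1/\varphi^\zeta$ on $\partial_z$. -/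

import Mathlib

open scoped ContDiff

namespace ConjugateSurface

noncomputable section

/-! ### Surfaces in de Sitter space, in coordinates `(u, v)` -/

/-- The Lorentz product of signature `(-, +, …, +)` on `𝕃^{n+3}`. -/
def lorentz {n : ℕ} (x y : Fin (n + 3) → ℝ) : ℝ :=
  -(x 0 * y 0) + ∑ i : Fin (n + 2), x i.succ * y i.succ

/-- The Lorentzian unit sphere `𝕊^{n+2}_{1,1} ⊆ 𝕃^{n+3}`. -/
def deSitter (n : ℕ) : Set (Fin (n + 3) → ℝ) := {x | lorentz x x = 1}

/-- The coordinate vector `∂_u`. -/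
def eu : ℝ × ℝ := (1, 0)

/-- The coordinate vector `∂_v`. -/
def ev : ℝ × ℝ := (0, 1)

/-- The partial derivative with respect to `u`. -/
def pu {E : Type*} [NormedAddCommGroup E] [NormedSpace ℝ E] (f : ℝ × ℝ → E) (p : ℝ × ℝ) : E :=
  fderiv ℝ f p eu

/-- The partial derivative with respect to `v`. -/
def pv {E : Type*} [NormedAddCommGroup E] [NormedSpace ℝ E] (f : ℝ × ℝ → E) (p : ℝ × ℝ) : E :=
  fderiv ℝ f p ev

variable {n : ℕ}

/-- The metric induced by `s`, at `p`. -/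
def metric (s : ℝ × ℝ → Fin (n + 3) → ℝ) (p x y : ℝ × ℝ) : ℝ :=
  lorentz (fderiv ℝ s p x) (fderiv ℝ s p y)

/-- The determinant `EG - F²` of the induced metric in the frame `∂_u, ∂_v`. -/
def gramDet (s : ℝ × ℝ → Fin (n + 3) → ℝ) (p : ℝ × ℝ) : ℝ :=
  metric s p eu eu * metric s p ev ev - metric s p eu ev ^ 2

/-- The second derivative `D²s(x, y)` in the ambient vector space `𝕃^{n+3}`. -/
def second (s : ℝ × ℝ → Fin (n + 3) → ℝ) (p x y : ℝ × ℝ) : Fin (n + 3) → ℝ :=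
  fderiv ℝ (fun q => fderiv ℝ s q y) p x

/-- A smooth map of `W` into de Sitter space with nondegenerate induced metric
(in particular an immersion). -/
structure IsSurface (s : ℝ × ℝ → Fin (n + 3) → ℝ) (W : Set (ℝ × ℝ)) : Prop where
  smooth : ContDiffOn ℝ ∞ s W
  mem : ∀ p ∈ W, s p ∈ deSitter n
  nondegenerate : ∀ p ∈ W, gramDet s p ≠ 0

/-- The Levi-Civita connection of the induced metric on constant (coordinate) fields,
`christoffel s p x y = ∇_x y`: the vector whose image under `s_*` is the tangential part of
`D²s(x, y)`, by Cramer's rule. See `metric_christoffel`. -/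
def christoffel (s : ℝ × ℝ → Fin (n + 3) → ℝ) (p x y : ℝ × ℝ) : ℝ × ℝ :=
  let a := lorentz (second s p x y) (fderiv ℝ s p eu)
  let b := lorentz (second s p x y) (fderiv ℝ s p ev)
  ((metric s p ev ev * a - metric s p eu ev * b) / gramDet s p,
   (metric s p eu eu * b - metric s p eu ev * a) / gramDet s p)

theorem lorentz_comm (x y : Fin (n + 3) → ℝ) : lorentz x y = lorentz y x := by
  simp only [lorentz, mul_comm]

theorem lorentz_add_smul (a b : ℝ) (x y z : Fin (n + 3) → ℝ) :
    lorentz (a • x + b • y) z = a * lorentz x z + b * lorentz y z := by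
  simp only [lorentz, Pi.add_apply, Pi.smul_apply, smul_eq_mul, add_mul, Finset.sum_add_distrib,
    mul_add, Finset.mul_sum, mul_assoc]
  ring

theorem eq_frame (x : ℝ × ℝ) : x = x.1 • eu + x.2 • ev := by
  ext <;> simp [eu, ev]

theorem metric_christoffel (s : ℝ × ℝ → Fin (n + 3) → ℝ) (p x y z : ℝ × ℝ)
    (h : gramDet s p ≠ 0) :
    metric s p (christoffel s p x y) z = lorentz (second s p x y) (fderiv ℝ s p z) := by
  have key : ∀ w v : ℝ × ℝ, metric s p w v = w.1 * metric s p eu v + w.2 * metric s p ev v := by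
    intro w v
    conv_lhs => rw [eq_frame w]
    simp only [metric, map_add, map_smul, lorentz_add_smul]
  have hz : lorentz (second s p x y) (fderiv ℝ s p z)
      = z.1 * lorentz (second s p x y) (fderiv ℝ s p eu)
        + z.2 * lorentz (second s p x y) (fderiv ℝ s p ev) := by
    conv_lhs => rw [eq_frame z]
    rw [lorentz_comm, map_add, map_smul, map_smul, lorentz_add_smul, lorentz_comm _ (second s p x y),
      lorentz_comm _ (second s p x y)]
  have hs : ∀ w v : ℝ × ℝ, metric s p w v = metric s p v w := fun w v => lorentz_comm _ _
  rw [hs, key, hs eu, hs ev, key _ eu, key _ ev, hz, hs ev eu]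
  have hd : gramDet s p = metric s p eu eu * metric s p ev ev - metric s p eu ev ^ 2 := rfl
  simp only [christoffel]
  generalize gramDet s p = d at h hd ⊢
  field_simp
  rw [hd]
  ring

/-- The covariant derivative `∇_x Y` of a vector field `Y`, at `p`. -/
def covDeriv (s : ℝ × ℝ → Fin (n + 3) → ℝ) (Y : ℝ × ℝ → ℝ × ℝ) (p x : ℝ × ℝ) : ℝ × ℝ :=
  fderiv ℝ Y p x + christoffel s p x (Y p)

/-- The covariant derivative `(∇_x D) y = ∇_x (D y) - D (∇_x y)` of a tensor `D` of type
`(1, 1)`; being tensorial in `y`, it is computed on the constant field `y`. -/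
def covDerivEnd (s : ℝ × ℝ → Fin (n + 3) → ℝ) (D : ℝ × ℝ → (ℝ × ℝ →L[ℝ] ℝ × ℝ))
    (p x y : ℝ × ℝ) : ℝ × ℝ :=
  covDeriv s (fun q => D q y) p x - D p (covDeriv s (fun _ => y) p x)

/-- The exterior derivative of a one-form. -/
def extD (ψ : ℝ × ℝ → (ℝ × ℝ →L[ℝ] ℝ)) (p x y : ℝ × ℝ) : ℝ :=
  fderiv ℝ ψ p x y - fderiv ℝ ψ p y x

/-- The second fundamental form of `s` as a surface in de Sitter space: the part of `D²s(x, y)`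
normal to the surface and to the position vector; the component of `D²s(x, y)` along the
position vector is `-⟨x, y⟩`. -/
def sff (s : ℝ × ℝ → Fin (n + 3) → ℝ) (p x y : ℝ × ℝ) : Fin (n + 3) → ℝ :=
  second s p x y - fderiv ℝ s p (christoffel s p x y) + metric s p x y • s p

/-- `s` is hyperbolic on `W` with respect to the tensor `J`. -/
structure IsHyperbolic (s : ℝ × ℝ → Fin (n + 3) → ℝ) (J : ℝ × ℝ → (ℝ × ℝ →L[ℝ] ℝ × ℝ))
    (W : Set (ℝ × ℝ)) : Prop where
  sq : ∀ p ∈ W, J p * J p = 1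
  symm : ∀ p ∈ W, ∀ x y, sff s p x (J p y) = sff s p (J p x) y

/-- `s` is elliptic on `W` with respect to the tensor `J`. -/
structure IsElliptic (s : ℝ × ℝ → Fin (n + 3) → ℝ) (J : ℝ × ℝ → (ℝ × ℝ →L[ℝ] ℝ × ℝ))
    (W : Set (ℝ × ℝ)) : Prop where
  sq : ∀ p ∈ W, J p * J p = -1
  symm : ∀ p ∈ W, ∀ x y, sff s p x (J p y) = sff s p (J p x) y

/-! ### Triples -/

/-- Two tensors of type `(1, 1)` and a one-form. -/
structure Triple where
  D₁ : ℝ × ℝ → (ℝ × ℝ →L[ℝ] ℝ × ℝ)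
  D₂ : ℝ × ℝ → (ℝ × ℝ →L[ℝ] ℝ × ℝ)
  ψ : ℝ × ℝ → (ℝ × ℝ →L[ℝ] ℝ)

/-- The conditions of the reduction lemma on a triple. -/
structure IsAdmissible (s : ℝ × ℝ → Fin (n + 3) → ℝ) (J : ℝ × ℝ → (ℝ × ℝ →L[ℝ] ℝ × ℝ))
    (W : Set (ℝ × ℝ)) (T : Triple) : Prop where
  smooth₁ : ContDiffOn ℝ ∞ T.D₁ W
  smooth₂ : ContDiffOn ℝ ∞ T.D₂ W
  smoothψ : ContDiffOn ℝ ∞ T.ψ W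
  span₁ : ∀ p ∈ W, T.D₁ p ∈ Submodule.span ℝ {1, J p}
  span₂ : ∀ p ∈ W, T.D₂ p ∈ Submodule.span ℝ {1, J p}
  det₁ : ∀ p ∈ W, (T.D₁ p).det = 1 / 2
  det₂ : ∀ p ∈ W, (T.D₂ p).det = 1 / 2
  codazzi₁ : ∀ p ∈ W, ∀ x y, covDerivEnd s T.D₁ p x y - covDerivEnd s T.D₁ p y x =
    T.ψ p x • T.D₂ p y - T.ψ p y • T.D₂ p x
  codazzi₂ : ∀ p ∈ W, ∀ x y, covDerivEnd s T.D₂ p x y - covDerivEnd s T.D₂ p y x =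
    -(T.ψ p x • T.D₁ p y - T.ψ p y • T.D₁ p x)
  ricci : ∀ p ∈ W, ∀ x y, extD T.ψ p x y =
    metric s p (T.D₂ p x) (T.D₁ p y) - metric s p (T.D₁ p x) (T.D₂ p y)
  sq_ne : ∀ p ∈ W, T.D₂ p ^ 2 ≠ T.D₁ p ^ 2
  sq_ne_neg : ∀ p ∈ W, T.D₂ p ^ 2 ≠ -T.D₁ p ^ 2
  rank_eq : ∀ p ∈ W, Module.finrank ℝ
    (LinearMap.range ((T.D₁ p ^ 2 + T.D₂ p ^ 2 - 1 : ℝ × ℝ →L[ℝ] ℝ × ℝ) : ℝ × ℝ →ₗ[ℝ] ℝ × ℝ)) = 2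

/-- Equality of triples on `W` up to signs and permutation of the tensors. The one-form changes
sign along with `D₁`, with `D₂`, and with the permutation. -/
def Triple.Equivalent (W : Set (ℝ × ℝ)) (T T' : Triple) : Prop :=
  ∃ ε₁ ε₂ : ℝ, (ε₁ = 1 ∨ ε₁ = -1) ∧ (ε₂ = 1 ∨ ε₂ = -1) ∧
    ((∀ p ∈ W, T'.D₁ p = ε₁ • T.D₁ p ∧ T'.D₂ p = ε₂ • T.D₂ p ∧
        T'.ψ p = (ε₁ * ε₂) • T.ψ p) ∨
     (∀ p ∈ W, T'.D₁ p = ε₁ • T.D₂ p ∧ T'.D₂ p = ε₂ • T.D₁ p ∧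
        T'.ψ p = -(ε₁ * ε₂) • T.ψ p))

/-- The relation `R` induces a bijection between the classes of elements of `A` modulo `ra` and
the classes of elements of `B` modulo `rb`. -/
def InducesBijection {α β : Type*} (A : Set α) (ra : α → α → Prop) (B : Set β)
    (rb : β → β → Prop) (R : α → β → Prop) : Prop :=
  (∀ a ∈ A, ∃ b ∈ B, R a b) ∧ (∀ b ∈ B, ∃ a ∈ A, R a b) ∧
    ∀ a ∈ A, ∀ a' ∈ A, ∀ b ∈ B, ∀ b' ∈ B, R a b → R a' b' → (ra a a' ↔ rb b b')

/-! ### The set `C_s` of a hyperbolic surface -/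

/-- `Γ¹`, where `∇_{∂_u} ∂_v = Γ¹ ∂_u + Γ² ∂_v`. -/
def Γ₁ (s : ℝ × ℝ → Fin (n + 3) → ℝ) (p : ℝ × ℝ) : ℝ := (christoffel s p eu ev).1

/-- `Γ²`, where `∇_{∂_u} ∂_v = Γ¹ ∂_u + Γ² ∂_v`. -/
def Γ₂ (s : ℝ × ℝ → Fin (n + 3) → ℝ) (p : ℝ × ℝ) : ℝ := (christoffel s p eu ev).2

/-- `Q(θ) = Hess θ(∂_u, ∂_v) + Fθ = θ_{uv} - Γ¹ θ_u - Γ² θ_v + Fθ`, with `F = ⟨∂_u, ∂_v⟩`. -/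
def hypQ (s : ℝ × ℝ → Fin (n + 3) → ℝ) (θ : ℝ × ℝ → ℝ) (p : ℝ × ℝ) : ℝ :=
  pu (pv θ) p - Γ₁ s p * pu θ p - Γ₂ s p * pv θ p + metric s p eu ev * θ p

/-- `φ^U(u, v) = U(u) exp(2 ∫₀^v Γ¹(u, t) dt)`. -/
def phiU (s : ℝ × ℝ → Fin (n + 3) → ℝ) (U : ℝ → ℝ) (p : ℝ × ℝ) : ℝ :=
  U p.1 * Real.exp (2 * ∫ t in (0 : ℝ)..p.2, Γ₁ s (p.1, t))

/-- `φ^V(u, v) = V(v) exp(2 ∫₀^u Γ²(t, v) dt)`. -/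
def phiV (s : ℝ × ℝ → Fin (n + 3) → ℝ) (V : ℝ → ℝ) (p : ℝ × ℝ) : ℝ :=
  V p.2 * Real.exp (2 * ∫ t in (0 : ℝ)..p.1, Γ₂ s (t, p.2))

/-- `ρ^{UV} = √|2(φ^U + φ^V) + 1|`. -/
def rhoUV (s : ℝ × ℝ → Fin (n + 3) → ℝ) (U V : ℝ → ℝ) (p : ℝ × ℝ) : ℝ :=
  Real.sqrt |2 * (phiU s U p + phiV s V p) + 1|

/-- The set `C_s` for a hyperbolic surface with real-conjugate coordinates on `I × K`. -/
def hypC (s : ℝ × ℝ → Fin (n + 3) → ℝ) (I K : Set ℝ) : Set ((ℝ → ℝ) × (ℝ → ℝ)) :=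
  {UV | ContDiffOn ℝ ∞ UV.1 I ∧ ContDiffOn ℝ ∞ UV.2 K ∧
    (((∀ u ∈ I, 0 < UV.1 u) ∧ (∀ v ∈ K, 0 < UV.2 v)) ∨
     (∀ p ∈ I ×ˢ K, 0 < 2 * phiU s UV.1 p ∧ 2 * phiU s UV.1 p < -(2 * phiV s UV.2 p + 1)) ∨
     (∀ p ∈ I ×ˢ K, 0 < 2 * phiV s UV.2 p ∧ 2 * phiV s UV.2 p < -(2 * phiU s UV.1 p + 1))) ∧
    ∀ p ∈ I ×ˢ K, hypQ s (rhoUV s UV.1 UV.2) p = 0}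

/-- The correspondence between triples and elements of `C_s`: the eigenvalues of
`2(D₁² + D₂²)` on `∂_u` and `∂_v` are `2 + 1/φ^U` and `2 + 1/φ^V`. -/
def hypCorr (s : ℝ × ℝ → Fin (n + 3) → ℝ) (W : Set (ℝ × ℝ)) (T : Triple)
    (UV : (ℝ → ℝ) × (ℝ → ℝ)) : Prop :=
  ∀ p ∈ W, (2 : ℝ) • (T.D₁ p ^ 2 + T.D₂ p ^ 2) eu = (2 + 1 / phiU s UV.1 p) • eu ∧
    (2 : ℝ) • (T.D₁ p ^ 2 + T.D₂ p ^ 2) ev = (2 + 1 / phiV s UV.2 p) • ev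

/-! ### The set `C_s` of an elliptic surface -/

/-- The complex coordinate `z = u + iv`. -/
def toC (p : ℝ × ℝ) : ℂ := ⟨p.1, p.2⟩

/-- The disc `|z| < r` in the coordinate plane. -/
def disc (r : ℝ) : Set (ℝ × ℝ) := {p | toC p ∈ Metric.ball (0 : ℂ) r}

/-- `f_z = (f_u - i f_v) / 2`. -/
def dz (f : ℝ × ℝ → ℂ) (p : ℝ × ℝ) : ℂ := (pu f p - Complex.I * pv f p) / 2

/-- `f_{z̄} = (f_u + i f_v) / 2`. -/
def dzbar (f : ℝ × ℝ → ℂ) (p : ℝ × ℝ) : ℂ := (pu f p + Complex.I * pv f p) / 2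

/-- The value of the `ℂ`-bilinear extension of `B` on the pair
`∂_z = (∂_u - i ∂_v) / 2`, `∂_{z̄} = (∂_u + i ∂_v) / 2`. -/
def onDzDzbar (B : ℝ × ℝ → ℝ × ℝ → ℝ) : ℂ :=
  (B eu eu + Complex.I * B eu ev - Complex.I * B ev eu + B ev ev) / 4

/-- The complex Christoffel symbol `Γ`, where
`∇_{∂_z} ∂_{z̄} = Γ ∂_z + conj Γ ∂_{z̄}`: the value of `dz = du + i dv` on `∇_{∂_z} ∂_{z̄}`. -/
def Γc (s : ℝ × ℝ → Fin (n + 3) → ℝ) (p : ℝ × ℝ) : ℂ :=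
  onDzDzbar (fun x y => (christoffel s p x y).1)
    + Complex.I * onDzDzbar (fun x y => (christoffel s p x y).2)

/-- `Q(θ) = Hess θ(∂_z, ∂_{z̄}) + Fθ = θ_{z z̄} - Γ θ_z - conj Γ θ_{z̄} + Fθ`, with
`F = ⟨∂_z, ∂_{z̄}⟩`. -/
def ellQ (s : ℝ × ℝ → Fin (n + 3) → ℝ) (θ : ℝ × ℝ → ℂ) (p : ℝ × ℝ) : ℂ :=
  dz (dzbar θ) p - Γc s p * dz θ p - (starRingEnd ℂ) (Γc s p) * dzbar θ p
    + onDzDzbar (metric s p) * θ p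

/-- `φ` is a smooth solution of `φ_{z̄} = 2Γφ` on `W`. -/
def IsSolution (s : ℝ × ℝ → Fin (n + 3) → ℝ) (W : Set (ℝ × ℝ)) (φ : ℝ × ℝ → ℂ) : Prop :=
  ContDiffOn ℝ ∞ φ W ∧ ∀ p ∈ W, dzbar φ p = 2 * Γc s p * φ p

/-- A normalization of the solutions of `φ_{z̄} = 2Γφ`: a nowhere vanishing solution `φ₀`,
relative to which the solutions are the functions `ζ φ₀` with `ζ` holomorphic. -/
def IsNormalization (s : ℝ × ℝ → Fin (n + 3) → ℝ) (W : Set (ℝ × ℝ)) (φ₀ : ℝ × ℝ → ℂ) : Prop :=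
  IsSolution s W φ₀ ∧ ∀ p ∈ W, φ₀ p ≠ 0

/-- `φ^ζ = ζ φ₀`. -/
def phiZeta (φ₀ : ℝ × ℝ → ℂ) (ζ : ℂ → ℂ) (p : ℝ × ℝ) : ℂ := ζ (toC p) * φ₀ p

/-- `f(z, z̄)` extends to a holomorphic function `Φ(z, w)` of two independent variables. -/
def IsPolarization (r : ℝ) (f : ℝ × ℝ → ℂ) (Φ : ℂ × ℂ → ℂ) : Prop :=
  DifferentiableOn ℂ Φ (Metric.ball 0 r ×ˢ Metric.ball 0 r) ∧
    ∀ p ∈ disc r, f p = Φ (toC p, (starRingEnd ℂ) (toC p))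

/-- The initial condition `φ(z, 0) = ζ(z)`, where `z` and `z̄` are independent variables. -/
def HasInitialValue (r : ℝ) (φ : ℝ × ℝ → ℂ) (ζ : ℂ → ℂ) : Prop :=
  ∃ Φ : ℂ × ℂ → ℂ, IsPolarization r φ Φ ∧ ∀ z ∈ Metric.ball (0 : ℂ) r, Φ (z, 0) = ζ z

/-- `ρ^ζ = √(-(4 Re φ^ζ + 1))`. -/
def rhoZeta (φ₀ : ℝ × ℝ → ℂ) (ζ : ℂ → ℂ) (p : ℝ × ℝ) : ℂ :=
  (Real.sqrt (-(4 * (phiZeta φ₀ ζ p).re + 1)) : ℝ)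

/-- The set `C_s` for an elliptic surface with complex-conjugate coordinates on the disc of
radius `r`, with respect to the normalization `φ₀`. -/
def ellC (s : ℝ × ℝ → Fin (n + 3) → ℝ) (r : ℝ) (φ₀ : ℝ × ℝ → ℂ) : Set (ℂ → ℂ) :=
  {ζ | DifferentiableOn ℂ ζ (Metric.ball 0 r) ∧
    (∀ p ∈ disc r, phiZeta φ₀ ζ p ≠ -1 / 2 ∧ 4 * (phiZeta φ₀ ζ p).re + 1 < 0) ∧
    ∀ p ∈ disc r, ellQ s (rhoZeta φ₀ ζ) p = 0}

/-- The correspondence between triples and elements of `C_s`: the eigenvalue of the complex-linear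
extension of `2(D₁² + D₂²)` on `∂_z`, on which `J = i`, is `2 + 1/φ^ζ`. -/
def ellCorr (J : ℝ × ℝ → (ℝ × ℝ →L[ℝ] ℝ × ℝ)) (W : Set (ℝ × ℝ)) (φ₀ : ℝ × ℝ → ℂ) (T : Triple)
    (ζ : ℂ → ℂ) : Prop :=
  ∀ p ∈ W, (2 : ℝ) • (T.D₁ p ^ 2 + T.D₂ p ^ 2) =
    (2 + 1 / phiZeta φ₀ ζ p).re • (1 : ℝ × ℝ →L[ℝ] ℝ × ℝ) + (2 + 1 / phiZeta φ₀ ζ p).im • J p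

end

end ConjugateSurface

open ConjugateSurface

open scoped ContDiff

namespace ConjugateSurface

open Set Filter Topology MeasureTheory

/-! ### Integrals depending on a parameter -/

/-! In conjugate coordinates the tensors in `span {I, J}` are diagonal: with real eigenvalues `a_i,
b_i` on `∂_u, ∂_v` in the hyperbolic case, and with a complex eigenvalue `a_i` on `∂_z` and `b_i =
conj a_i` on `∂_{z̄}` in the elliptic case. Both cases give the same system `IsFrame` over an
`RCLike` field, for two directions `c, d`, with `a_i b_i = 1/2`.

Put `A = a₁² + a₂²`, `B = b₁² + b₂²`, `δ = a₂b₁ - a₁b₂`. In the combination of the Codazzi equations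
that gives the derivative of `A` along `d`, the one-form drops out and `A_d = 2Γ(1 - A)`. Hence `x =
1/(A - 1)` solves the linear equation `x_d = 2Γx`, and likewise `y = 1/(B - 1)` solves `y_c = 2Γ'y`
(`IsFrame.pd_inv`). Up to the factor 2 these are the functions `φ` of the statement: they depend on
one function of one variable each, or on one holomorphic function.

Conversely `A` and `B` determine the frame up to signs and permutation, because `a₁²a₂² = A/(4B)`;
connectedness makes the signs global (`IsFrame.eq_up_to_sign`). The remaining combination of the
Codazzi equations defines the one-form (`exists_isFrame`), which is expressed by `A`, `B` and `δ`
alone (`IsFrame.ψ_formula`). Since `δ² = AB - 1`, one has `δ²xy = S` with `S = x + y + 1`; inserting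
this in the Ricci equation leaves a second order equation for `S` (`IsFrame.ricci_iff`), and `S =
±ρ²` turns it into `Q(ρ) = 0` (`mul_hess_sqrt`).

The inequalities in `C_s` say which `x, y` come from frames. In the hyperbolic case these are `A >
0` and `AB > 1`. In the elliptic case `y = conj x`, `δ` is imaginary, and the conditions are `A ≠ 0`
and `|A| < 1`. Explicit square roots then produce the eigenvalues; on the disc a smooth root of `A`
exists by simple connectedness.

The normalization `φ₀` is `exp w` with `w_{z̄} = 2Γ`. This equation is solved by cutting off and
applying the Cauchy transform on smaller discs, followed by a Mittag-Leffler argument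
(`exists_dzbar_eq`). Quotients of solutions by `φ₀` are holomorphic. If `Γ` extends to `G(z, w)`,
then `exp (2 ∫₀^w G)` restricted to `w = z̄` is a normalization with initial value 1, and uniqueness
is the identity theorem on the totally real plane `w = z̄`. -/

theorem continuousOn_integral_param {P E : Type} [NormedAddCommGroup P] [NormedAddCommGroup E]
    [NormedSpace ℝ E] {W : Set P} {Ω : Set (P × ℝ)} (hΩ : IsOpen Ω)
    (hsub : W ×ˢ Icc (0 : ℝ) 1 ⊆ Ω) {F : P × ℝ → E} (hF : ContinuousOn F Ω) :
    ContinuousOn (fun p => ∫ s in (0 : ℝ)..1, F (p, s)) W := by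
  intro p hp
  apply ContinuousAt.continuousWithinAt
  -- The tube lemma around the compact segment `{p} × [0, 1]` gives one bound, the maximum there
  -- plus one, valid for all parameters near `p`; it serves as the dominating constant.
  obtain ⟨u, v, hu, hv, hpu, hIv, huv⟩ : ∃ (u : Set P) (v : Set ℝ), IsOpen u ∧ IsOpen v ∧
      {p} ⊆ u ∧ Icc (0 : ℝ) 1 ⊆ v ∧
      u ×ˢ v ⊆ Ω ∩ (fun q => ‖F q‖) ⁻¹' Iio (sSup ((fun s => ‖F (p, s)‖) '' Icc 0 1) + 1) := by
    apply generalized_tube_lemma isCompact_singleton isCompact_Icc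
    · exact hF.norm.isOpen_inter_preimage hΩ isOpen_Iio
    · rintro ⟨q, s⟩ ⟨rfl, hs⟩
      refine ⟨hsub ⟨hp, hs⟩, ?_⟩
      have hc : ContinuousOn (fun s => ‖F (q, s)‖) (Icc 0 1) :=
        (hF.comp (f := fun t : ℝ => (q, t)) (by fun_prop) fun t ht => hsub ⟨hp, ht⟩).norm
      have := le_csSup (isCompact_Icc.image_of_continuousOn hc).bddAbove (mem_image_of_mem _ hs)
      simp only [mem_preimage, mem_Iio]
      linarith
  have hpu' : u ∈ 𝓝 p := hu.mem_nhds (hpu rfl)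
  have hsubI : uIoc (0 : ℝ) 1 ⊆ Icc 0 1 := by
    rw [uIoc_of_le zero_le_one]; exact Ioc_subset_Icc_self
  refine intervalIntegral.continuousAt_of_dominated_interval
    (bound := fun _ => sSup ((fun s => ‖F (p, s)‖) '' Icc 0 1) + 1) ?_ ?_ (by simp) ?_
  · filter_upwards [hpu'] with q hq
    refine ContinuousOn.aestronglyMeasurable ?_ measurableSet_uIoc
    exact hF.comp (by fun_prop) fun s hs => (huv ⟨hq, hIv (hsubI hs)⟩).1
  · filter_upwards [hpu'] with q hq
    exact Eventually.of_forall fun s hs => (huv ⟨hq, hIv (hsubI hs)⟩).2.le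
  · refine Eventually.of_forall fun s hs => ?_
    have h1 : ContinuousAt F (p, s) := hF.continuousAt (hΩ.mem_nhds (hsub ⟨hp, hsubI hs⟩))
    exact ContinuousAt.comp (f := fun q : P => (q, s)) h1 (by fun_prop)

theorem hasFDerivAt_integral_param {P E : Type} [NormedAddCommGroup P] [NormedSpace ℝ P]
    [NormedAddCommGroup E] [NormedSpace ℝ E] {W : Set P} {Ω : Set (P × ℝ)}
    (hΩ : IsOpen Ω) (hsub : W ×ˢ Icc (0 : ℝ) 1 ⊆ Ω) {F : P × ℝ → E} (hF : ContDiffOn ℝ ∞ F Ω)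
    {p : P} (hp : p ∈ W) :
    HasFDerivAt (fun p => ∫ s in (0 : ℝ)..1, F (p, s))
      (∫ s in (0 : ℝ)..1, (fderiv ℝ F (p, s)).comp (ContinuousLinearMap.inl ℝ P ℝ)) p := by
  set F' : P × ℝ → P →L[ℝ] E := fun q => (fderiv ℝ F q).comp (ContinuousLinearMap.inl ℝ P ℝ)
  have hF' : ContinuousOn F' Ω :=
    (hF.continuousOn_fderiv_of_isOpen hΩ (by simp)).clm_comp continuousOn_const
  obtain ⟨u, v, hu, hv, hpu, hIv, huv⟩ : ∃ (u : Set P) (v : Set ℝ), IsOpen u ∧ IsOpen v ∧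
      {p} ⊆ u ∧ Icc (0 : ℝ) 1 ⊆ v ∧
      u ×ˢ v ⊆ Ω ∩ (fun q => ‖F' q‖) ⁻¹' Iio (sSup ((fun s => ‖F' (p, s)‖) '' Icc 0 1) + 1) := by
    apply generalized_tube_lemma isCompact_singleton isCompact_Icc
    · exact hF'.norm.isOpen_inter_preimage hΩ isOpen_Iio
    · rintro ⟨q, s⟩ ⟨rfl, hs⟩
      refine ⟨hsub ⟨hp, hs⟩, ?_⟩
      have hc : ContinuousOn (fun s => ‖F' (q, s)‖) (Icc 0 1) :=
        (hF'.comp (f := fun t : ℝ => (q, t)) (by fun_prop) fun t ht => hsub ⟨hp, ht⟩).norm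
      have := le_csSup (isCompact_Icc.image_of_continuousOn hc).bddAbove (mem_image_of_mem _ hs)
      simp only [mem_preimage, mem_Iio]
      linarith
  have hpu' : u ∈ 𝓝 p := hu.mem_nhds (hpu rfl)
  have hsubI : uIoc (0 : ℝ) 1 ⊆ Icc 0 1 := by
    rw [uIoc_of_le zero_le_one]; exact Ioc_subset_Icc_self
  have hm : ∀ q ∈ u, ContinuousOn (fun s => F (q, s)) (Icc 0 1) := fun q hq =>
    hF.continuousOn.comp (by fun_prop) fun s hs => (huv ⟨hq, hIv hs⟩).1
  refine intervalIntegral.hasFDerivAt_integral_of_dominated_of_fderiv_le (𝕜 := ℝ)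
    (F := fun q s => F (q, s)) (F' := fun q s => F' (q, s))
    (bound := fun _ => sSup ((fun s => ‖F' (p, s)‖) '' Icc 0 1) + 1) hpu' ?_ ?_ ?_ ?_ (by simp) ?_
  · filter_upwards [hpu'] with q hq
    exact ((hm q hq).mono hsubI).aestronglyMeasurable measurableSet_uIoc
  · exact ((hm p (hpu rfl)).mono (by rw [uIcc_of_le zero_le_one])).intervalIntegrable
  · refine ContinuousOn.aestronglyMeasurable ?_ measurableSet_uIoc
    exact hF'.comp (f := fun t : ℝ => (p, t)) (by fun_prop) fun t ht =>
      (huv ⟨hpu (mem_singleton p), hIv (hsubI ht)⟩).1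
  · exact Eventually.of_forall fun s hs q hq => (huv ⟨hq, hIv (hsubI hs)⟩).2.le
  · refine Eventually.of_forall fun s hs q hq => ?_
    have h1 : HasFDerivAt F (fderiv ℝ F (q, s)) (q, s) :=
      ((hF.contDiffAt (hΩ.mem_nhds (huv ⟨hq, hIv (hsubI hs)⟩).1)).differentiableAt
        (by simp)).hasFDerivAt
    exact h1.comp q (hasFDerivAt_prodMk_left q s)

/-- Induction on the order of differentiability. The target space must vary in the induction, since
the derivative is an integral of the same kind with values in `P →L[ℝ] E`. -/
theorem contDiffOn_integral_param {P : Type} [NormedAddCommGroup P] [NormedSpace ℝ P]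
    {W : Set P} (hW : IsOpen W) {Ω : Set (P × ℝ)} (hΩ : IsOpen Ω)
    (hsub : W ×ˢ Icc (0 : ℝ) 1 ⊆ Ω) {E : Type} [NormedAddCommGroup E] [NormedSpace ℝ E]
    {F : P × ℝ → E} (hF : ContDiffOn ℝ ∞ F Ω) :
    ContDiffOn ℝ ∞ (fun p => ∫ s in (0 : ℝ)..1, F (p, s)) W := by
  rw [contDiffOn_infty]
  intro n
  induction n generalizing E with
  | zero =>
    rw [Nat.cast_zero, contDiffOn_zero]
    exact continuousOn_integral_param hΩ hsub hF.continuousOn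
  | succ n ih =>
    rw [Nat.cast_succ, contDiffOn_succ_iff_fderiv_of_isOpen hW]
    refine ⟨fun p hp => (hasFDerivAt_integral_param hΩ hsub hF
      hp).differentiableAt.differentiableWithinAt, by simp, ?_⟩
    refine (ih (E := P →L[ℝ] E)
      (F := fun q => (fderiv ℝ F q).comp (ContinuousLinearMap.inl ℝ P ℝ)) ?_).congr
      fun p hp => (hasFDerivAt_integral_param hΩ hsub hF hp).fderiv
    exact ContDiffOn.clm_comp (hF.fderiv_of_isOpen hΩ (by simp)) contDiffOn_const

/-- The primitive `∫₀^v f(u, t) dt` of a smooth function on a product of intervals is smooth. -/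
theorem contDiffOn_primitive_snd {I K : Set ℝ} (hI : IsOpen I) (hK : IsOpen K)
    (hKc : K.OrdConnected) (h0 : 0 ∈ K) {f : ℝ × ℝ → ℝ} (hf : ContDiffOn ℝ ∞ f (I ×ˢ K)) :
    ContDiffOn ℝ ∞ (fun p : ℝ × ℝ => ∫ t in (0 : ℝ)..p.2, f (p.1, t)) (I ×ˢ K) := by
  -- Substituting `t = s v` moves the variable limit into the integrand; `s v` stays in `K` because
  -- `K` is an interval containing 0.
  have h : ContDiffOn ℝ ∞
      (fun p : ℝ × ℝ => ∫ s in (0 : ℝ)..1, (fun q : (ℝ × ℝ) × ℝ =>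
        q.1.2 * f (q.1.1, q.2 * q.1.2)) (p, s)) (I ×ˢ K) := by
    refine contDiffOn_integral_param (E := ℝ) (hI.prod hK)
      (F := fun q : (ℝ × ℝ) × ℝ => q.1.2 * f (q.1.1, q.2 * q.1.2))
      (Ω := (fun q : (ℝ × ℝ) × ℝ => (q.1.1, q.2 * q.1.2)) ⁻¹' (I ×ˢ K))
      ((hI.prod hK).preimage (by fun_prop)) ?_ ?_
    · rintro ⟨⟨u, v⟩, s⟩ ⟨⟨hu, hv⟩, hs⟩
      refine ⟨hu, hKc.uIcc_subset h0 hv ?_⟩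
      rw [← segment_eq_uIcc]
      exact ⟨1 - s, s, by linarith [hs.2], hs.1, by ring, by simp⟩
    · have h1 : ContDiff ℝ ∞ fun q : (ℝ × ℝ) × ℝ => q.1.2 := by fun_prop
      exact h1.contDiffOn.mul (hf.comp
        (f := fun q : (ℝ × ℝ) × ℝ => (q.1.1, q.2 * q.1.2)) (by fun_prop) fun q hq => hq)
  refine h.congr fun p _ => ?_
  have := intervalIntegral.mul_integral_comp_mul_right (f := fun t => f (p.1, t)) (a := 0) (b := 1)
    p.2
  simp only [zero_mul, one_mul] at this
  rw [← this, ← intervalIntegral.integral_const_mul]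

theorem contDiffOn_primitive_fst {I K : Set ℝ} (hI : IsOpen I) (hK : IsOpen K)
    (hIc : I.OrdConnected) (h0 : 0 ∈ I) {f : ℝ × ℝ → ℝ} (hf : ContDiffOn ℝ ∞ f (I ×ˢ K)) :
    ContDiffOn ℝ ∞ (fun p : ℝ × ℝ => ∫ t in (0 : ℝ)..p.1, f (t, p.2)) (I ×ˢ K) := by
  have h1 : ContDiffOn ℝ ∞ (fun q : ℝ × ℝ => f (q.2, q.1)) (K ×ˢ I) :=
    hf.comp (f := fun q : ℝ × ℝ => (q.2, q.1)) (by fun_prop) fun q hq => ⟨hq.2, hq.1⟩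
  exact (contDiffOn_primitive_snd hK hI hIc h0 h1).comp (f := fun q : ℝ × ℝ => (q.2, q.1))
    (by fun_prop) fun q hq => ⟨hq.2, hq.1⟩

/-! ### Complex combinations of the coordinate derivatives -/

section pd

variable {𝕜 : Type} [RCLike 𝕜]

/-- The derivative of `f` along the (possibly complex) vector `c.1 ∂_u + c.2 ∂_v`. -/
noncomputable def pd (c : 𝕜 × 𝕜) (f : ℝ × ℝ → 𝕜) (p : ℝ × ℝ) : 𝕜 := c.1 * pu f p + c.2 * pv f p

/-- `f` is differentiable at `p`, with derivative `f'` along `c.1 ∂_u + c.2 ∂_v`. -/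
def HasPd (c : 𝕜 × 𝕜) (f : ℝ × ℝ → 𝕜) (f' : 𝕜) (p : ℝ × ℝ) : Prop :=
  DifferentiableAt ℝ f p ∧ pd c f p = f'

variable {c d : 𝕜 × 𝕜} {f g : ℝ × ℝ → 𝕜} {f' g' : 𝕜} {p : ℝ × ℝ} {W : Set (ℝ × ℝ)}

theorem DifferentiableAt.hasPd (h : DifferentiableAt ℝ f p) : HasPd c f (pd c f p) p := ⟨h, rfl⟩

theorem differentiableAt_of_contDiffOn (hW : IsOpen W) (hf : ContDiffOn ℝ ∞ f W) (hp : p ∈ W) :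
    DifferentiableAt ℝ f p :=
  (hf.contDiffAt (hW.mem_nhds hp)).differentiableAt (by simp)

theorem hasPd_of_contDiffOn (hW : IsOpen W) (hf : ContDiffOn ℝ ∞ f W) (hp : p ∈ W) :
    HasPd c f (pd c f p) p :=
  ⟨differentiableAt_of_contDiffOn hW hf hp, rfl⟩

theorem contDiffOn_pd (c : 𝕜 × 𝕜) (hW : IsOpen W) (hf : ContDiffOn ℝ ∞ f W) :
    ContDiffOn ℝ ∞ (pd c f) W := by
  have h := hf.fderiv_of_isOpen hW (m := ∞) (by simp)
  exact (contDiffOn_const.mul (h.clm_apply contDiffOn_const)).add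
    (contDiffOn_const.mul (h.clm_apply contDiffOn_const))

theorem hasPd_const (a : 𝕜) : HasPd c (fun _ => a) 0 p :=
  ⟨by fun_prop, by simp [pd, pu, pv]⟩

theorem HasPd.add (hf : HasPd c f f' p) (hg : HasPd c g g' p) :
    HasPd c (fun q => f q + g q) (f' + g') p := by
  refine ⟨hf.1.add hg.1, ?_⟩
  rw [← hf.2, ← hg.2]
  simp only [pd, pu, pv, fderiv_fun_add hf.1 hg.1, add_apply]
  ring

theorem HasPd.neg (hf : HasPd c f f' p) : HasPd c (fun q => -f q) (-f') p := by
  refine ⟨hf.1.neg, ?_⟩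
  rw [← hf.2]
  simp only [pd, pu, pv, fderiv_fun_neg, neg_apply]
  ring

theorem HasPd.sub (hf : HasPd c f f' p) (hg : HasPd c g g' p) :
    HasPd c (fun q => f q - g q) (f' - g') p := by
  simpa only [sub_eq_add_neg] using hf.add hg.neg

theorem HasPd.mul (hf : HasPd c f f' p) (hg : HasPd c g g' p) :
    HasPd c (fun q => f q * g q) (f' * g p + f p * g') p := by
  refine ⟨hf.1.mul hg.1, ?_⟩
  rw [← hf.2, ← hg.2]
  simp only [pd, pu, pv, fderiv_fun_mul hf.1 hg.1, add_apply,
    smul_apply, smul_eq_mul]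
  ring

theorem HasPd.const_mul (a : 𝕜) (hf : HasPd c f f' p) :
    HasPd c (fun q => a * f q) (a * f') p := by
  simpa using (hasPd_const a).mul hf

theorem HasPd.congr (hf : HasPd c f f' p) (h : g =ᶠ[𝓝 p] f) : HasPd c g f' p := by
  refine ⟨hf.1.congr_of_eventuallyEq h, ?_⟩
  rw [← hf.2]
  simp only [pd, pu, pv, h.fderiv_eq]

theorem HasPd.congr_on (hf : HasPd c f f' p) (hW : IsOpen W) (hp : p ∈ W) (h : EqOn g f W) :
    HasPd c g f' p :=
  hf.congr (h.eventuallyEq_of_mem (hW.mem_nhds hp))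

theorem HasPd.unique (hf : HasPd c f f' p) (hg : HasPd c g g' p) (hW : IsOpen W) (hp : p ∈ W)
    (h : EqOn f g W) : f' = g' :=
  hf.2.symm.trans (hg.congr_on hW hp h).2

/-- Differentiate `f · f⁻¹ = 1`, which holds near `p`. -/
theorem HasPd.inv (hf : HasPd c f f' p) (h : f p ≠ 0) :
    HasPd c (fun q => (f q)⁻¹) (-f' / f p ^ 2) p := by
  have hd : DifferentiableAt ℝ (fun q => (f q)⁻¹) p := hf.1.inv h
  refine ⟨hd, ?_⟩
  have h1 := hf.mul (DifferentiableAt.hasPd (c := c) hd)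
  have h2 : HasPd c (fun q => f q * (f q)⁻¹) 0 p :=
    (hasPd_const 1).congr ((hf.1.continuousAt.eventually_ne h).mono fun q hq => mul_inv_cancel₀ hq)
  have h3 := h1.2.symm.trans h2.2
  field_simp at h3 ⊢
  linear_combination h3

/-- Derivatives along constant vectors commute. -/
theorem pd_comm (hW : IsOpen W) (hf : ContDiffOn ℝ ∞ f W) (hp : p ∈ W) :
    pd c (pd d f) p = pd d (pd c f) p := by
  have h2 : ContDiffAt ℝ ∞ f p := hf.contDiffAt (hW.mem_nhds hp)
  have hs : IsSymmSndFDerivAt ℝ f p := h2.isSymmSndFDerivAt (by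
    simpa using (WithTop.coe_le_coe.2 le_top : ((2 : ℕ∞) : WithTop ℕ∞) ≤ ∞))
  have hd : DifferentiableAt ℝ (fderiv ℝ f) p :=
    ((hf.fderiv_of_isOpen hW (m := ∞) (by simp)).contDiffAt (hW.mem_nhds hp)).differentiableAt
      (by simp)
  have key : ∀ (d : 𝕜 × 𝕜) (x : ℝ × ℝ), fderiv ℝ (pd d f) p x
      = d.1 * fderiv ℝ (fderiv ℝ f) p x eu + d.2 * fderiv ℝ (fderiv ℝ f) p x ev := by
    intro d x
    have h1 : ∀ y : ℝ × ℝ, HasFDerivAt (fun q => fderiv ℝ f q y)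
        ((fderiv ℝ (fderiv ℝ f) p).flip y) p := fun y => by
      simpa using hd.hasFDerivAt.clm_apply (hasFDerivAt_const y p)
    have h2 := ((h1 eu).const_mul d.1).add ((h1 ev).const_mul d.2)
    have h3 : fderiv ℝ (pd d f) p = _ := h2.fderiv
    rw [h3]
    simp
  simp only [pd, pu, pv] at key ⊢
  simp only [key, hs.eq ev eu]
  ring

end pd

/-! ### The algebra of the compatibility equations -/

section algebra

variable {K : Type} [Field K] [CharZero K]

/-- Primes are derivatives along one direction. Since `b_i = 1/(2a_i)`, the derivative of `δ = a₂b₁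
- a₁b₂` is a combination of `a₁'` and `a₂'`, which the Codazzi equations eliminate. The result
recovers `ψ` from `δ`, `A` and `B`. -/
theorem codazzi_algebra {a₁ a₂ b₁ b₂ Γ ψ a₁' a₂' b₁' b₂' : K} (h1 : a₁ * b₁ = 1 / 2)
    (h2 : a₂ * b₂ = 1 / 2) (h1' : a₁' * b₁ + a₁ * b₁' = 0) (h2' : a₂' * b₂ + a₂ * b₂' = 0)
    (c1 : a₁' = (b₁ - a₁) * Γ + ψ * a₂) (c2 : a₂' = (b₂ - a₂) * Γ - ψ * a₁) :
    2 * (a₁ ^ 2 + a₂ ^ 2) * (b₁ ^ 2 + b₂ ^ 2) * ψ =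
      -(a₂' * b₁ + a₂ * b₁' - (a₁' * b₂ + a₁ * b₂'))
        - 2 * (b₁ ^ 2 + b₂ ^ 2) * (a₂ * b₁ - a₁ * b₂) * Γ := by
  have ha1 : a₁ ≠ 0 := fun h => by simp [h] at h1
  have ha2 : a₂ ≠ 0 := fun h => by simp [h] at h2
  have e1 : b₁ = 1 / (2 * a₁) := by field_simp; linear_combination 2 * h1
  have e2 : b₂ = 1 / (2 * a₂) := by field_simp; linear_combination 2 * h2
  have e3 : b₁' = -a₁' / (2 * a₁ ^ 2) := by
    rw [e1] at h1'; field_simp at h1' ⊢; linear_combination h1'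
  have e4 : b₂' = -a₂' / (2 * a₂ ^ 2) := by
    rw [e2] at h2'; field_simp at h2' ⊢; linear_combination h2'
  rw [e3, e4, c1, c2, e1, e2]
  field_simp
  ring

/-- The Ricci equation with every derivative treated as an independent symbol: a subscript 1 is a
derivative along `c`, a subscript 2 one along `d`, except that `G₁, G₂` are the two Christoffel
symbols, `G₁₁` the derivative of `G₁` along `c`, `G₂₂` that of `G₂` along `d`, and `ψ₁, ψ₂` the
components of the form. Logarithmic differentiation makes all terms multiples of `δ`, leaving a
rational identity in `x`, `y` and their derivatives. -/
theorem ricci_algebra {x y x₁ y₂ G₁ G₂ G₁₁ G₂₂ F δ δ₁ δ₂ δ₁₂ ψ₁ ψ₂ ψ₂₁ ψ₁₂ x₂ y₁ x₁₂ y₁₂ S : K}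
    (hS : S = x + y + 1) (ex₂ : x₂ = 2 * G₁ * x) (ey₁ : y₁ = 2 * G₂ * y)
    (ex₁₂ : x₁₂ = 2 * (G₁₁ * x + G₁ * x₁)) (ey₁₂ : y₁₂ = 2 * (G₂₂ * y + G₂ * y₂))
    (hx : x ≠ 0) (hy : y ≠ 0) (hx1 : x + 1 ≠ 0) (hy1 : y + 1 ≠ 0) (hδ : δ ≠ 0) (hS0 : S ≠ 0)
    (h0 : δ * δ * (x * y) = S)
    (h1 : (δ₁ * δ + δ * δ₁) * (x * y) + δ * δ * (x₁ * y + x * y₁) = x₁ + y₁)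
    (h2 : (δ₂ * δ + δ * δ₂) * (x * y) + δ * δ * (x₂ * y + x * y₂) = x₂ + y₂)
    (h12 : (δ₁₂ * δ + δ₂ * δ₁ + (δ₁ * δ₂ + δ * δ₁₂)) * (x * y)
      + (δ₂ * δ + δ * δ₂) * (x₁ * y + x * y₁)
      + ((δ₁ * δ + δ * δ₁) * (x₂ * y + x * y₂)
        + δ * δ * (x₁₂ * y + x₂ * y₁ + (x₁ * y₂ + x * y₁₂))) = x₁₂ + y₁₂)
    (p2 : 2 * ((x + 1) * (y + 1)) * ψ₂ = -(δ₂ * (x * y)) - 2 * (x * (y + 1) * δ) * G₁)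
    (p1 : 2 * ((x + 1) * (y + 1)) * ψ₁ = δ₁ * (x * y) + 2 * ((x + 1) * y * δ) * G₂)
    (p21 : 2 * (x₁ * (y + 1) + (x + 1) * y₁) * ψ₂ + 2 * ((x + 1) * (y + 1)) * ψ₂₁ =
      -(δ₁₂ * (x * y) + δ₂ * (x₁ * y + x * y₁))
        - (2 * ((x₁ * (y + 1) + x * y₁) * δ + x * (y + 1) * δ₁) * G₁
          + 2 * (x * (y + 1) * δ) * G₁₁))
    (p12 : 2 * (x₂ * (y + 1) + (x + 1) * y₂) * ψ₁ + 2 * ((x + 1) * (y + 1)) * ψ₁₂ =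
      δ₁₂ * (x * y) + δ₁ * (x₂ * y + x * y₂)
        + (2 * ((x₂ * y + (x + 1) * y₂) * δ + (x + 1) * y * δ₂) * G₂
          + 2 * ((x + 1) * y * δ) * G₂₂)) :
    4 * S ^ 2 * (ψ₂₁ - ψ₁₂ - F * δ) =
      -(δ * (2 * S * (x₁₂ + y₁₂) - (x₁ + y₁) * (x₂ + y₂)
        - 2 * S * (G₁ * (x₁ + y₁) + G₂ * (x₂ + y₂)) + 4 * F * S ^ 2)) := by
  have hxy : x * y ≠ 0 := mul_ne_zero hx hy
  have hD : δ * δ = S / (x * y) := by field_simp; linear_combination h0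
  -- From `2 log δ = log S - log x - log y`; the equation for `y` replaces `y₁/(2y)` by `G₂`, and in
  -- `e2` that for `x` replaces `x₂/(2x)` by `G₁`.
  have e1 : δ₁ = δ * ((x₁ + y₁) / (2 * S) - x₁ / (2 * x) - G₂) := by
    apply mul_left_cancel₀ (mul_ne_zero (mul_ne_zero two_ne_zero hδ) hxy)
    have : 2 * δ * (x * y) * (δ * ((x₁ + y₁) / (2 * S) - x₁ / (2 * x) - G₂)) =
      2 * (δ * δ) * (x * y) * ((x₁ + y₁) / (2 * S) - x₁ / (2 * x) - G₂) := by ring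
    rw [this]
    rw [hD] at h1 ⊢
    subst ey₁
    field_simp at h1 ⊢
    linear_combination h1
  have e2 : δ₂ = δ * ((x₂ + y₂) / (2 * S) - G₁ - y₂ / (2 * y)) := by
    apply mul_left_cancel₀ (mul_ne_zero (mul_ne_zero two_ne_zero hδ) hxy)
    have : 2 * δ * (x * y) * (δ * ((x₂ + y₂) / (2 * S) - G₁ - y₂ / (2 * y))) =
      2 * (δ * δ) * (x * y) * ((x₂ + y₂) / (2 * S) - G₁ - y₂ / (2 * y)) := by ring
    rw [this]
    rw [hD] at h2 ⊢
    subst ex₂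
    field_simp at h2 ⊢
    linear_combination h2
  set m₁ := (x₁ + y₁) / (2 * S) - x₁ / (2 * x) - G₂ with hm₁
  set m₂ := (x₂ + y₂) / (2 * S) - G₁ - y₂ / (2 * y) with hm₂
  -- This is `δ₁₂/δ = m₁m₂ + ∂₁m₂`, where the derivative of `y₂/(2y)` along the first direction
  -- reduces to `G₂₂`.
  have e12 : δ₁₂ = δ * (m₁ * m₂ + (x₁₂ + y₁₂) / (2 * S) - (x₁ + y₁) * (x₂ + y₂) / (2 * S ^ 2)
      - G₁₁ - G₂₂) := by
    apply mul_left_cancel₀ (mul_ne_zero (mul_ne_zero two_ne_zero hδ) hxy)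
    have t1 : 2 * δ * (x * y) * (δ * (m₁ * m₂ + (x₁₂ + y₁₂) / (2 * S)
        - (x₁ + y₁) * (x₂ + y₂) / (2 * S ^ 2) - G₁₁ - G₂₂)) =
      2 * (δ * δ) * (x * y) * (m₁ * m₂ + (x₁₂ + y₁₂) / (2 * S)
        - (x₁ + y₁) * (x₂ + y₂) / (2 * S ^ 2) - G₁₁ - G₂₂) := by ring
    have t2 : 2 * δ * (x * y) * δ₁₂ = x₁₂ + y₁₂ - (2 * (δ * δ) * m₁ * m₂ * (x * y)
      + 2 * (δ * δ) * m₂ * (x₁ * y + x * y₁) + (2 * (δ * δ) * m₁ * (x₂ * y + x * y₂)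
        + δ * δ * (x₁₂ * y + x₂ * y₁ + (x₁ * y₂ + x * y₁₂)))) := by
      rw [e1, e2] at h12
      linear_combination h12
    rw [t1, t2, hD, hm₁, hm₂]
    subst ex₂ ey₁ ex₁₂ ey₁₂
    field_simp
    rw [hS]
    ring
  have f2 : ψ₂ = δ * (-(m₂ * (x * y)) - 2 * (x * (y + 1)) * G₁) / (2 * ((x + 1) * (y + 1))) := by
    field_simp
    rw [e2] at p2
    linear_combination p2
  have f1 : ψ₁ = δ * (m₁ * (x * y) + 2 * ((x + 1) * y) * G₂) / (2 * ((x + 1) * (y + 1))) := by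
    field_simp
    rw [e1] at p1
    linear_combination p1
  set m₁₂ := m₁ * m₂ + (x₁₂ + y₁₂) / (2 * S) - (x₁ + y₁) * (x₂ + y₂) / (2 * S ^ 2)
      - G₁₁ - G₂₂ with hm₁₂
  have f21 : ψ₂₁ = δ * (-(m₁₂ * (x * y) + m₂ * (x₁ * y + x * y₁))
        - (2 * ((x₁ * (y + 1) + x * y₁) + x * (y + 1) * m₁) * G₁
          + 2 * (x * (y + 1)) * G₁₁) - 2 * (x₁ * (y + 1) + (x + 1) * y₁) *
          (-(m₂ * (x * y)) - 2 * (x * (y + 1)) * G₁) / (2 * ((x + 1) * (y + 1))))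
          / (2 * ((x + 1) * (y + 1))) := by
    rw [f2, e12, e1, e2] at p21
    rw [eq_div_iff (by simp [hx1, hy1])]
    linear_combination p21
  have f12 : ψ₁₂ = δ * (m₁₂ * (x * y) + m₁ * (x₂ * y + x * y₂)
        + (2 * ((x₂ * y + (x + 1) * y₂) + (x + 1) * y * m₂) * G₂
          + 2 * ((x + 1) * y) * G₂₂) - 2 * (x₂ * (y + 1) + (x + 1) * y₂) *
          (m₁ * (x * y) + 2 * ((x + 1) * y) * G₂) / (2 * ((x + 1) * (y + 1))))
          / (2 * ((x + 1) * (y + 1))) := by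
    rw [f1, e12, e1, e2] at p12
    rw [eq_div_iff (by simp [hx1, hy1])]
    linear_combination p12
  rw [f21, f12, hm₁₂, hm₁, hm₂]
  clear_value m₁ m₂ m₁₂
  clear f21 f12 f1 f2 e12 hm₁₂ hm₁ hm₂ e1 e2 p1 p2 p12 p21 h12 h1 h2 hD h0
  subst ex₂ ey₁ ex₁₂ ey₁₂
  field_simp
  rw [hS]
  ring

end algebra

/-! ### Eigenvalue frames of triples -/

section frame

variable {𝕜 : Type} [RCLike 𝕜] {W : Set (ℝ × ℝ)} {c d : 𝕜 × 𝕜}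
  {Γ Γ' a₁ a₂ b₁ b₂ ψ₁ ψ₂ : ℝ × ℝ → 𝕜}

/-- The Codazzi equations for the eigenvalues `a₁, b₁` of `D₁` and `a₂, b₂` of `D₂` on the
directions `c`, `d`, where `Γ, Γ'` are the Christoffel symbols of `∇_c d` and `ψ₁, ψ₂` the
components of `ψ`. -/
structure IsFrame (W : Set (ℝ × ℝ)) (c d : 𝕜 × 𝕜) (Γ Γ' a₁ a₂ b₁ b₂ ψ₁ ψ₂ : ℝ × ℝ → 𝕜) :
    Prop where
  smooth_a₁ : ContDiffOn ℝ ∞ a₁ W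
  smooth_a₂ : ContDiffOn ℝ ∞ a₂ W
  smooth_b₁ : ContDiffOn ℝ ∞ b₁ W
  smooth_b₂ : ContDiffOn ℝ ∞ b₂ W
  smooth_ψ₁ : ContDiffOn ℝ ∞ ψ₁ W
  smooth_ψ₂ : ContDiffOn ℝ ∞ ψ₂ W
  half₁ : ∀ p ∈ W, a₁ p * b₁ p = 1 / 2
  half₂ : ∀ p ∈ W, a₂ p * b₂ p = 1 / 2
  cod_a₁ : ∀ p ∈ W, pd d a₁ p = (b₁ p - a₁ p) * Γ p + ψ₂ p * a₂ p
  cod_a₂ : ∀ p ∈ W, pd d a₂ p = (b₂ p - a₂ p) * Γ p - ψ₂ p * a₁ p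
  cod_b₁ : ∀ p ∈ W, pd c b₁ p = (a₁ p - b₁ p) * Γ' p + ψ₁ p * b₂ p
  cod_b₂ : ∀ p ∈ W, pd c b₂ p = (a₂ p - b₂ p) * Γ' p - ψ₁ p * b₁ p

namespace IsFrame

/-- The system is symmetric in the two directions, so each fact about `a_i` along `d` also yields
one about `b_i` along `c`. -/
theorem swap (h : IsFrame W c d Γ Γ' a₁ a₂ b₁ b₂ ψ₁ ψ₂) :
    IsFrame W d c Γ' Γ b₁ b₂ a₁ a₂ ψ₂ ψ₁ :=
  ⟨h.smooth_b₁, h.smooth_b₂, h.smooth_a₁, h.smooth_a₂, h.smooth_ψ₂, h.smooth_ψ₁,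
    fun p hp => by rw [mul_comm, h.half₁ p hp], fun p hp => by rw [mul_comm, h.half₂ p hp],
    h.cod_b₁, h.cod_b₂, h.cod_a₁, h.cod_a₂⟩

/-- In `a₁` times the first Codazzi equation plus `a₂` times the second, the terms with `ψ₂` cancel,
and `a₁b₁ + a₂b₂ = 1`. -/
theorem pd_sq_add_sq (hW : IsOpen W) (h : IsFrame W c d Γ Γ' a₁ a₂ b₁ b₂ ψ₁ ψ₂) {p : ℝ × ℝ}
    (hp : p ∈ W) :
    HasPd d (fun q => a₁ q * a₁ q + a₂ q * a₂ q)
      (2 * Γ p * (1 - (a₁ p * a₁ p + a₂ p * a₂ p))) p := by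
  have h1 := hasPd_of_contDiffOn (c := d) hW h.smooth_a₁ hp
  have h2 := hasPd_of_contDiffOn (c := d) hW h.smooth_a₂ hp
  have h3 := (h1.mul h1).add (h2.mul h2)
  refine ⟨h3.1, h3.2.trans ?_⟩
  rw [h.cod_a₁ p hp, h.cod_a₂ p hp]
  linear_combination 2 * Γ p * (h.half₁ p hp) + 2 * Γ p * (h.half₂ p hp)

/-- Inverting `A - 1` makes the equation for `A` linear and homogeneous. This is what lets functions
of one variable parametrize the triples. -/
theorem pd_inv (hW : IsOpen W) (h : IsFrame W c d Γ Γ' a₁ a₂ b₁ b₂ ψ₁ ψ₂) {x : ℝ × ℝ → 𝕜}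
    (hx : ContDiffOn ℝ ∞ x W) (hxa : ∀ p ∈ W, x p * (a₁ p * a₁ p + a₂ p * a₂ p - 1) = 1)
    {p : ℝ × ℝ} (hp : p ∈ W) : pd d x p = 2 * Γ p * x p := by
  have h1 := (hasPd_of_contDiffOn (c := d) hW hx hp).mul
    ((h.pd_sq_add_sq hW hp).sub (hasPd_const 1))
  have h2 := h1.unique (hasPd_const (c := d) (1 : 𝕜)) hW hp hxa
  have h3 : a₁ p * a₁ p + a₂ p * a₂ p - 1 ≠ 0 := right_ne_zero_of_mul_eq_one (hxa p hp)
  apply mul_right_cancel₀ h3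
  linear_combination h2

/-- The form depends on the eigenvalues only through `A`, `B` and `δ`, linearly in `δ`. Both the
reduction of the Ricci equation and the uniqueness of triples rest on this. -/
theorem ψ_formula (hW : IsOpen W) (h : IsFrame W c d Γ Γ' a₁ a₂ b₁ b₂ ψ₁ ψ₂) {p : ℝ × ℝ}
    (hp : p ∈ W) :
    2 * (a₁ p ^ 2 + a₂ p ^ 2) * (b₁ p ^ 2 + b₂ p ^ 2) * ψ₂ p =
      -pd d (fun q => a₂ q * b₁ q - a₁ q * b₂ q) p
        - 2 * (b₁ p ^ 2 + b₂ p ^ 2) * (a₂ p * b₁ p - a₁ p * b₂ p) * Γ p := by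
  have ha1 := hasPd_of_contDiffOn (c := d) hW h.smooth_a₁ hp
  have ha2 := hasPd_of_contDiffOn (c := d) hW h.smooth_a₂ hp
  have hb1 := hasPd_of_contDiffOn (c := d) hW h.smooth_b₁ hp
  have hb2 := hasPd_of_contDiffOn (c := d) hW h.smooth_b₂ hp
  rw [((ha2.mul hb1).sub (ha1.mul hb2)).2]
  exact codazzi_algebra (h.half₁ p hp) (h.half₂ p hp)
    ((ha1.mul hb1).unique (hasPd_const (1 / 2 : 𝕜)) hW hp h.half₁)
    ((ha2.mul hb2).unique (hasPd_const (1 / 2 : 𝕜)) hW hp h.half₂)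
    (h.cod_a₁ p hp) (h.cod_a₂ p hp)

/-- Lagrange's identity, in which the inner product `a₁b₁ + a₂b₂` equals 1. -/
theorem delta_sq (h : IsFrame W c d Γ Γ' a₁ a₂ b₁ b₂ ψ₁ ψ₂) {p : ℝ × ℝ} (hp : p ∈ W) :
    (a₂ p * b₁ p - a₁ p * b₂ p) ^ 2 =
      (a₁ p * a₁ p + a₂ p * a₂ p) * (b₁ p * b₁ p + b₂ p * b₂ p) - 1 := by
  linear_combination (-(a₁ p * b₁ p + a₂ p * b₂ p) - 1) * (h.half₁ p hp + h.half₂ p hp)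

/-- The Ricci equation in terms of `S = x + y + 1`, `x = (a₁² + a₂² - 1)⁻¹`,
`y = (b₁² + b₂² - 1)⁻¹`. -/
theorem ricci_iff (hW : IsOpen W) (h : IsFrame W c d Γ Γ' a₁ a₂ b₁ b₂ ψ₁ ψ₂)
    (hΓ : ContDiffOn ℝ ∞ Γ W) (hΓ' : ContDiffOn ℝ ∞ Γ' W) {x y S : ℝ × ℝ → 𝕜} {F : 𝕜}
    (hx : ContDiffOn ℝ ∞ x W) (hy : ContDiffOn ℝ ∞ y W)
    (hxa : ∀ p ∈ W, x p * (a₁ p * a₁ p + a₂ p * a₂ p - 1) = 1)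
    (hyb : ∀ p ∈ W, y p * (b₁ p * b₁ p + b₂ p * b₂ p - 1) = 1)
    (hS : ∀ p, S p = x p + y p + 1)
    (hA : ∀ p ∈ W, a₁ p * a₁ p + a₂ p * a₂ p ≠ 0) (hB : ∀ p ∈ W, b₁ p * b₁ p + b₂ p * b₂ p ≠ 0)
    (hδ : ∀ p ∈ W, a₂ p * b₁ p - a₁ p * b₂ p ≠ 0) {p : ℝ × ℝ} (hp : p ∈ W) :
    pd c ψ₂ p - pd d ψ₁ p = F * (a₂ p * b₁ p - a₁ p * b₂ p) ↔
      2 * S p * pd c (pd d S) p - pd c S p * pd d S p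
        - 2 * S p * (Γ p * pd c S p + Γ' p * pd d S p) + 4 * F * S p ^ 2 = 0 := by
  set δ : ℝ × ℝ → 𝕜 := fun q => a₂ q * b₁ q - a₁ q * b₂ q with hδdef
  have sδ : ContDiffOn ℝ ∞ δ W :=
    (h.smooth_a₂.mul h.smooth_b₁).sub (h.smooth_a₁.mul h.smooth_b₂)
  have ex : ∀ q ∈ W, x q + 1 = x q * (a₁ q * a₁ q + a₂ q * a₂ q) := fun q hq => by
    linear_combination -hxa q hq
  have ey : ∀ q ∈ W, y q + 1 = y q * (b₁ q * b₁ q + b₂ q * b₂ q) := fun q hq => by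
    linear_combination -hyb q hq
  have hx0 : ∀ q ∈ W, x q ≠ 0 := fun q hq => left_ne_zero_of_mul_eq_one (hxa q hq)
  have hy0 : ∀ q ∈ W, y q ≠ 0 := fun q hq => left_ne_zero_of_mul_eq_one (hyb q hq)
  -- Multiply `δ² = AB - 1` by `xy` and use `xA = x + 1`, `yB = y + 1`.
  have hδS : ∀ q ∈ W, δ q * δ q * (x q * y q) = x q + y q + 1 := fun q hq => by
    have := h.delta_sq hq
    simp only [hδdef]
    linear_combination (x q * y q) * this + (x q + 1) * ey q hq * (-1) +
      (-y q * (b₁ q * b₁ q + b₂ q * b₂ q)) * ex q hq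
  have hxd : ∀ q ∈ W, pd d x q = 2 * Γ q * x q := fun q hq => h.pd_inv hW hx hxa hq
  have hyc : ∀ q ∈ W, pd c y q = 2 * Γ' q * y q := fun q hq => h.swap.pd_inv hW hy hyb hq
  have hψ₂ : ∀ q ∈ W, 2 * ((x q + 1) * (y q + 1)) * ψ₂ q =
      -(pd d δ q * (x q * y q)) - 2 * (x q * (y q + 1) * δ q) * Γ q := fun q hq => by
    have := h.ψ_formula hW hq
    rw [ex q hq, ey q hq]
    linear_combination x q * y q * this
  have hψ₁ : ∀ q ∈ W, 2 * ((x q + 1) * (y q + 1)) * ψ₁ q =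
      pd c δ q * (x q * y q) + 2 * ((x q + 1) * y q * δ q) * Γ' q := fun q hq => by
    have h1 := h.swap.ψ_formula hW hq
    -- Exchanging the two directions replaces `δ` by `-δ`.
    have h2 : pd c (fun q => b₂ q * a₁ q - b₁ q * a₂ q) q = -pd c δ q := by
      rw [← ((hasPd_of_contDiffOn (c := c) hW sδ hq).neg).2]
      congr 1
      ext r
      simp only [hδdef]
      ring
    rw [h2] at h1
    rw [ex q hq, ey q hq]
    simp only [hδdef] at h1 ⊢
    linear_combination x q * y q * h1
  have jx : ∀ {e : 𝕜 × 𝕜} {q}, q ∈ W → HasPd e x (pd e x q) q :=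
    fun hq => hasPd_of_contDiffOn hW hx hq
  have jy : ∀ {e : 𝕜 × 𝕜} {q}, q ∈ W → HasPd e y (pd e y q) q :=
    fun hq => hasPd_of_contDiffOn hW hy hq
  have jδ : ∀ {e : 𝕜 × 𝕜} {q}, q ∈ W → HasPd e δ (pd e δ q) q :=
    fun hq => hasPd_of_contDiffOn hW sδ hq
  have jxd : HasPd c (pd d x) (pd c (pd d x) p) p :=
    hasPd_of_contDiffOn hW (contDiffOn_pd d hW hx) hp
  have jyd : HasPd c (pd d y) (pd c (pd d y) p) p :=
    hasPd_of_contDiffOn hW (contDiffOn_pd d hW hy) hp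
  have jδd : HasPd c (pd d δ) (pd c (pd d δ) p) p :=
    hasPd_of_contDiffOn hW (contDiffOn_pd d hW sδ) hp
  have jδc : HasPd d (pd c δ) (pd c (pd d δ) p) p := by
    rw [pd_comm hW sδ hp]
    exact hasPd_of_contDiffOn hW (contDiffOn_pd c hW sδ) hp
  have jΓ := hasPd_of_contDiffOn (c := c) hW hΓ hp
  have jΓ' := hasPd_of_contDiffOn (c := d) hW hΓ' hp
  have j1 : ∀ {e : 𝕜 × 𝕜} {q}, HasPd e (fun _ => (1 : 𝕜)) 0 q := hasPd_const 1
  have hSd : ∀ {e : 𝕜 × 𝕜}, ∀ q ∈ W, HasPd e S (pd e x q + pd e y q) q := by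
    intro e q hq
    have := ((jx (e := e) hq).add (jy hq)).add j1
    rw [add_zero] at this
    rwa [show S = fun q => x q + y q + 1 from funext hS]
  have hS1 : pd c S p = pd c x p + pd c y p := (hSd p hp).2
  have hS2 : ∀ q ∈ W, pd d S q = pd d x q + pd d y q := fun q hq => (hSd q hq).2
  have hS12 : pd c (pd d S) p = pd c (pd d x) p + pd c (pd d y) p :=
    ((jxd.add jyd).congr_on hW hp hS2).2
  have hx12 : pd c (pd d x) p = 2 * (pd c Γ p * x p + Γ p * pd c x p) := by
    have h2 := ((jΓ.const_mul 2).mul (jx hp)).congr_on hW hp hxd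
    rw [h2.2]
    ring
  have hy12 : pd c (pd d y) p = 2 * (pd d Γ' p * y p + Γ' p * pd d y p) := by
    rw [pd_comm hW hy hp]
    have h2 := ((jΓ'.const_mul 2).mul (jy hp)).congr_on hW hp hyc
    rw [h2.2]
    ring
  have hSne : S p ≠ 0 := by
    rw [hS, ← hδS p hp]
    exact mul_ne_zero (mul_ne_zero (hδ p hp) (hδ p hp)) (mul_ne_zero (hx0 p hp) (hy0 p hp))
  -- The relation `δ²xy = S` and the formulas for the form hold on an open set, so both sides can be
  -- differentiated; the results are the inputs of `ricci_algebra`.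
  have e0 : ∀ {e : 𝕜 × 𝕜}, ∀ q ∈ W, (pd e δ q * δ q + δ q * pd e δ q) * (x q * y q)
      + δ q * δ q * (pd e x q * y q + x q * pd e y q) = pd e x q + pd e y q := by
    intro e q hq
    have h1 := (((jδ (e := e) hq).mul (jδ hq)).mul ((jx hq).mul (jy hq))).unique
      (((jx hq).add (jy hq)).add j1) hW hq hδS
    rw [add_zero] at h1
    exact h1
  have e12 := ((((jδd.mul (jδ hp)).add ((jδ hp).mul jδd)).mul ((jx hp).mul (jy hp))).add
    (((jδ hp).mul (jδ hp)).mul ((jxd.mul (jy hp)).add ((jx hp).mul jyd)))).unique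
      (jxd.add jyd) hW hp (e0 (e := d))
  have p21 := ((((((jx hp).add j1).mul ((jy hp).add j1)).const_mul 2).mul
    (hasPd_of_contDiffOn (c := c) hW h.smooth_ψ₂ hp))).unique
    ((jδd.mul ((jx hp).mul (jy hp))).neg.sub
      (((((jx hp).mul ((jy hp).add j1)).mul (jδ hp)).const_mul 2).mul jΓ)) hW hp hψ₂
  have p12 := ((((((jx hp).add j1).mul ((jy hp).add j1)).const_mul 2).mul
    (hasPd_of_contDiffOn (c := d) hW h.smooth_ψ₁ hp))).unique
    ((jδc.mul ((jx hp).mul (jy hp))).add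
      ((((((jx hp).add j1).mul (jy hp)).mul (jδ hp)).const_mul 2).mul jΓ')) hW hp hψ₁
  have key := ricci_algebra (F := F) (δ := δ p) (δ₁ := pd c δ p) (δ₂ := pd d δ p)
    (δ₁₂ := pd c (pd d δ) p) (ψ₂₁ := pd c ψ₂ p) (ψ₁₂ := pd d ψ₁ p) (hS p) (hxd p hp) (hyc p hp) hx12 hy12 (hx0 p hp) (hy0 p hp)
    (by rw [ex p hp]; exact mul_ne_zero (hx0 p hp) (hA p hp))
    (by rw [ey p hp]; exact mul_ne_zero (hy0 p hp) (hB p hp)) (hδ p hp) hSne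
    (by rw [hS]; exact hδS p hp) (e0 p hp) (e0 p hp) (by linear_combination e12)
    (hψ₂ p hp) (hψ₁ p hp)
    (by simp only [add_zero] at p21; linear_combination p21)
    (by simp only [add_zero] at p12; linear_combination p12)
  rw [hS12, hS1, hS2 p hp, ← sub_eq_zero]
  have hδp := hδ p hp
  constructor
  · intro h0
    rw [h0, mul_zero, eq_comm, neg_eq_zero] at key
    exact (mul_eq_zero.1 key).resolve_left hδp
  · intro h0
    rw [h0, mul_zero, neg_zero] at key
    exact (mul_eq_zero.1 key).resolve_left (mul_ne_zero (by norm_num) (pow_ne_zero 2 hSne))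

end IsFrame

/-- Along `d`, the combination `a₂ · (first) - a₁ · (second)` of the Codazzi equations reads `A ψ₂ =
…` and is taken as the definition of `ψ₂`. The combination `a₁ · (first) + a₂ · (second)` is the
assumed equation for `A`. As `A ≠ 0`, the two together give back both equations; the same works
along `c`. -/
theorem exists_isFrame (hW : IsOpen W) (hΓ : ContDiffOn ℝ ∞ Γ W) (hΓ' : ContDiffOn ℝ ∞ Γ' W)
    (sa₁ : ContDiffOn ℝ ∞ a₁ W) (sa₂ : ContDiffOn ℝ ∞ a₂ W) (sb₁ : ContDiffOn ℝ ∞ b₁ W)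
    (sb₂ : ContDiffOn ℝ ∞ b₂ W) (half₁ : ∀ p ∈ W, a₁ p * b₁ p = 1 / 2)
    (half₂ : ∀ p ∈ W, a₂ p * b₂ p = 1 / 2)
    (hA : ∀ p ∈ W, a₁ p * a₁ p + a₂ p * a₂ p ≠ 0) (hB : ∀ p ∈ W, b₁ p * b₁ p + b₂ p * b₂ p ≠ 0)
    (hAd : ∀ p ∈ W, pd d (fun q => a₁ q * a₁ q + a₂ q * a₂ q) p =
      2 * Γ p * (1 - (a₁ p * a₁ p + a₂ p * a₂ p)))
    (hBc : ∀ p ∈ W, pd c (fun q => b₁ q * b₁ q + b₂ q * b₂ q) p =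
      2 * Γ' p * (1 - (b₁ p * b₁ p + b₂ p * b₂ p))) :
    IsFrame W c d Γ Γ' a₁ a₂ b₁ b₂
      (fun p => (b₂ p * pd c b₁ p - b₁ p * pd c b₂ p - (b₂ p * a₁ p - b₁ p * a₂ p) * Γ' p) *
        (b₁ p * b₁ p + b₂ p * b₂ p)⁻¹)
      (fun p => (a₂ p * pd d a₁ p - a₁ p * pd d a₂ p - (a₂ p * b₁ p - a₁ p * b₂ p) * Γ p) *
        (a₁ p * a₁ p + a₂ p * a₂ p)⁻¹) := by
  have key : ∀ {d : 𝕜 × 𝕜} {Γ a₁ a₂ b₁ b₂ : ℝ × ℝ → 𝕜}, ContDiffOn ℝ ∞ a₁ W → ContDiffOn ℝ ∞ a₂ W →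
      (∀ p ∈ W, a₁ p * b₁ p = 1 / 2) → (∀ p ∈ W, a₂ p * b₂ p = 1 / 2) →
      (∀ p ∈ W, a₁ p * a₁ p + a₂ p * a₂ p ≠ 0) →
      (∀ p ∈ W, pd d (fun q => a₁ q * a₁ q + a₂ q * a₂ q) p =
        2 * Γ p * (1 - (a₁ p * a₁ p + a₂ p * a₂ p))) → ∀ p ∈ W,
      pd d a₁ p = (b₁ p - a₁ p) * Γ p + (a₂ p * pd d a₁ p - a₁ p * pd d a₂ p
        - (a₂ p * b₁ p - a₁ p * b₂ p) * Γ p) * (a₁ p * a₁ p + a₂ p * a₂ p)⁻¹ * a₂ p ∧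
      pd d a₂ p = (b₂ p - a₂ p) * Γ p - (a₂ p * pd d a₁ p - a₁ p * pd d a₂ p
        - (a₂ p * b₁ p - a₁ p * b₂ p) * Γ p) * (a₁ p * a₁ p + a₂ p * a₂ p)⁻¹ * a₁ p := by
    intro d Γ a₁ a₂ b₁ b₂ sa₁ sa₂ h1 h2 hA hAd p hp
    have j1 := hasPd_of_contDiffOn (c := d) hW sa₁ hp
    have j2 := hasPd_of_contDiffOn (c := d) hW sa₂ hp
    have h3 := ((j1.mul j1).add (j2.mul j2)).2.symm.trans (hAd p hp)
    have hA' := hA p hp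
    have h1 := h1 p hp
    have h2 := h2 p hp
    have e : a₁ p * pd d a₁ p + a₂ p * pd d a₂ p
        = Γ p * (1 - (a₁ p * a₁ p + a₂ p * a₂ p)) := by
      linear_combination h3 / 2
    constructor
    · apply mul_right_cancel₀ hA'
      rw [add_mul, mul_right_comm _ (_)⁻¹, inv_mul_cancel_right₀ hA']
      linear_combination a₁ p * e - a₁ p * Γ p * (h1 + h2)
    · apply mul_right_cancel₀ hA'
      rw [sub_mul, mul_right_comm _ (_)⁻¹, inv_mul_cancel_right₀ hA']
      linear_combination a₂ p * e - a₂ p * Γ p * (h1 + h2)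
  have ka := key sa₁ sa₂ half₁ half₂ hA hAd
  have kb := key sb₁ sb₂ (fun p hp => by rw [mul_comm, half₁ p hp])
    (fun p hp => by rw [mul_comm, half₂ p hp]) hB hBc
  refine ⟨sa₁, sa₂, sb₁, sb₂, ?_, ?_, half₁, half₂, fun p hp => (ka p hp).1,
    fun p hp => (ka p hp).2, fun p hp => (kb p hp).1, fun p hp => (kb p hp).2⟩
  · exact (((sb₂.mul (contDiffOn_pd c hW sb₁)).sub (sb₁.mul (contDiffOn_pd c hW sb₂))).sub
      (((sb₂.mul sa₁).sub (sb₁.mul sa₂)).mul hΓ')).mul (((sb₁.mul sb₁).add (sb₂.mul sb₂)).inv hB)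
  · exact (((sa₂.mul (contDiffOn_pd d hW sa₁)).sub (sa₁.mul (contDiffOn_pd d hW sa₂))).sub
      (((sa₂.mul sb₁).sub (sa₁.mul sb₂)).mul hΓ)).mul (((sa₁.mul sa₁).add (sa₂.mul sa₂)).inv hA)

/-- `4 ρ³ Q(ρ)` in terms of `S = ± ρ²`. -/
theorem mul_hess_sqrt (hW : IsOpen W) {ρ S : ℝ × ℝ → 𝕜} {κ F : 𝕜} (hκ : κ * κ = 1)
    (hρ : ContDiffOn ℝ ∞ ρ W) (hρS : ∀ p ∈ W, S p = κ * (ρ p * ρ p)) {p : ℝ × ℝ} (hp : p ∈ W) :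
    2 * S p * pd c (pd d S) p - pd c S p * pd d S p
        - 2 * S p * (Γ p * pd c S p + Γ' p * pd d S p) + 4 * F * S p ^ 2 =
      4 * ρ p ^ 3 * (pd c (pd d ρ) p - Γ p * pd c ρ p - Γ' p * pd d ρ p + F * ρ p) := by
  have j : ∀ {e : 𝕜 × 𝕜} {q}, q ∈ W → HasPd e ρ (pd e ρ q) q :=
    fun hq => hasPd_of_contDiffOn hW hρ hq
  have jd : HasPd c (pd d ρ) (pd c (pd d ρ) p) p :=
    hasPd_of_contDiffOn hW (contDiffOn_pd d hW hρ) hp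
  have h1 : ∀ {e : 𝕜 × 𝕜}, ∀ q ∈ W, pd e S q = κ * (pd e ρ q * ρ q + ρ q * pd e ρ q) :=
    fun q hq => ((((j hq).mul (j hq)).const_mul κ).congr_on hW hq hρS).2
  have h12 := ((((jd.mul (j hp)).add ((j hp).mul jd)).const_mul κ).congr_on hW hp (h1 (e := d))).2
  rw [h12, h1 p hp, h1 p hp, hρS p hp]
  linear_combination (4 * ρ p ^ 3 * (pd c (pd d ρ) p - Γ p * pd c ρ p - Γ' p * pd d ρ p
    + F * ρ p)) * hκ

/-- Frames with equal `a₁² + a₂²` and `b₁² + b₂²` agree up to signs and permutation. -/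
theorem IsFrame.eq_up_to_sign (hW : IsOpen W) (hWc : IsPreconnected W)
    {a₁' a₂' b₁' b₂' ψ₁' ψ₂' : ℝ × ℝ → 𝕜}
    (h : IsFrame W c d Γ Γ' a₁ a₂ b₁ b₂ ψ₁ ψ₂) (h' : IsFrame W c d Γ Γ' a₁' a₂' b₁' b₂' ψ₁' ψ₂')
    (hAA : ∀ p ∈ W, a₁' p * a₁' p + a₂' p * a₂' p = a₁ p * a₁ p + a₂ p * a₂ p)
    (hBB : ∀ p ∈ W, b₁' p * b₁' p + b₂' p * b₂' p = b₁ p * b₁ p + b₂ p * b₂ p)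
    (hA : ∀ p ∈ W, a₁ p * a₁ p + a₂ p * a₂ p ≠ 0) (hB : ∀ p ∈ W, b₁ p * b₁ p + b₂ p * b₂ p ≠ 0)
    (hδ : ∀ p ∈ W, a₂ p * b₁ p - a₁ p * b₂ p ≠ 0) :
    ∃ ε₁ ε₂ : ℝ, (ε₁ = 1 ∨ ε₁ = -1) ∧ (ε₂ = 1 ∨ ε₂ = -1) ∧
      ((∀ p ∈ W, a₁' p = ε₁ * a₁ p ∧ a₂' p = ε₂ * a₂ p ∧ b₁' p = ε₁ * b₁ p ∧ b₂' p = ε₂ * b₂ p ∧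
          ψ₁' p = ε₁ * ε₂ * ψ₁ p ∧ ψ₂' p = ε₁ * ε₂ * ψ₂ p) ∨
       (∀ p ∈ W, a₁' p = ε₁ * a₂ p ∧ a₂' p = ε₂ * a₁ p ∧ b₁' p = ε₁ * b₂ p ∧ b₂' p = ε₂ * b₁ p ∧
          ψ₁' p = -(ε₁ * ε₂) * ψ₁ p ∧ ψ₂' p = -(ε₁ * ε₂) * ψ₂ p)) := by
  have ne_a : ∀ {a b : ℝ × ℝ → 𝕜}, (∀ p ∈ W, a p * b p = 1 / 2) → ∀ {p}, p ∈ W → a p ≠ 0 :=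
    fun hh p hp h0 => by have := hh p hp; simp [h0] at this
  have b_eq : ∀ {a b a' b' : ℝ × ℝ → 𝕜} {ε : ℝ}, (ε = 1 ∨ ε = -1) → (∀ p ∈ W, a p * b p = 1 / 2) →
      (∀ p ∈ W, a' p * b' p = 1 / 2) → (∀ p ∈ W, a' p = ε * a p) → ∀ p ∈ W, b' p = ε * b p := by
    intro a b a' b' ε hε h1 h2 h3 p hp
    apply mul_left_cancel₀ (ne_a h2 hp)
    rw [h2 p hp, h3 p hp]
    have : (ε : 𝕜) * ε = 1 := by rcases hε with rfl | rfl <;> simp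
    linear_combination (-(ε : 𝕜) * ε) * h1 p hp - this / 2
  -- Equal squares of nonvanishing continuous functions on a preconnected set: one sign serves for
  -- all points.
  have sgn : ∀ {a a' : ℝ × ℝ → 𝕜}, ContDiffOn ℝ ∞ a W → ContDiffOn ℝ ∞ a' W →
      (∀ p ∈ W, a p ≠ 0) → (∀ p ∈ W, a' p * a' p = a p * a p) →
      ∃ ε : ℝ, (ε = 1 ∨ ε = -1) ∧ ∀ p ∈ W, a' p = ε * a p := by
    intro a a' ha ha' h0 hsq
    rcases hWc.eq_or_eq_neg_of_sq_eq ha'.continuousOn ha.continuousOn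
      (fun p hp => by simpa [sq] using hsq p hp) (fun hp => h0 _ hp) with h1 | h1
    · exact ⟨1, Or.inl rfl, fun p hp => by simp [h1 hp]⟩
    · exact ⟨-1, Or.inr rfl, fun p hp => by simp [h1 hp]⟩
  -- By `ψ_formula` the form is multiplied by the same sign as `δ` when `A` and `B` are unchanged.
  have ψ_eq : ∀ {c d : 𝕜 × 𝕜} {Γ Γ' a₁ a₂ b₁ b₂ ψ₁ ψ₂ a₁' a₂' b₁' b₂' ψ₁' ψ₂' : ℝ × ℝ → 𝕜} {ε : ℝ},
      IsFrame W c d Γ Γ' a₁ a₂ b₁ b₂ ψ₁ ψ₂ → IsFrame W c d Γ Γ' a₁' a₂' b₁' b₂' ψ₁' ψ₂' →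
      (∀ p ∈ W, a₁' p * a₁' p + a₂' p * a₂' p = a₁ p * a₁ p + a₂ p * a₂ p) →
      (∀ p ∈ W, b₁' p * b₁' p + b₂' p * b₂' p = b₁ p * b₁ p + b₂ p * b₂ p) →
      (∀ p ∈ W, a₁ p * a₁ p + a₂ p * a₂ p ≠ 0) → (∀ p ∈ W, b₁ p * b₁ p + b₂ p * b₂ p ≠ 0) →
      (∀ p ∈ W, a₂' p * b₁' p - a₁' p * b₂' p = ε * (a₂ p * b₁ p - a₁ p * b₂ p)) →
      ∀ p ∈ W, ψ₂' p = ε * ψ₂ p := by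
    intro c d Γ Γ' a₁ a₂ b₁ b₂ ψ₁ ψ₂ a₁' a₂' b₁' b₂' ψ₁' ψ₂' ε h h' hAA hBB hA hB hd p hp
    have f := h.ψ_formula hW hp
    have f' := h'.ψ_formula hW hp
    have hj : HasPd d (fun q => a₂ q * b₁ q - a₁ q * b₂ q) _ p := hasPd_of_contDiffOn hW
      ((h.smooth_a₂.mul h.smooth_b₁).sub (h.smooth_a₁.mul h.smooth_b₂)) hp
    rw [((hj.const_mul (ε : 𝕜)).congr_on hW hp hd).2] at f'
    apply mul_left_cancel₀ (mul_ne_zero (mul_ne_zero two_ne_zero (hA p hp)) (hB p hp))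
    linear_combination f' - ε * f - 2 * ψ₂' p * (b₁' p ^ 2 + b₂' p ^ 2) * hAA p hp
      - (2 * ψ₂' p * (a₁ p ^ 2 + a₂ p ^ 2)
        + 2 * (ε * (a₂ p * b₁ p - a₁ p * b₂ p)) * Γ p) * hBB p hp
      - 2 * (b₁' p ^ 2 + b₂' p ^ 2) * Γ p * hd p hp
  -- Since `b_i = 1/(2a_i)`, `4 a₁²a₂² B = A`: sum and product of the squares are both prescribed.
  have prod : ∀ p ∈ W, a₁' p * a₁' p * (a₂' p * a₂' p) = a₁ p * a₁ p * (a₂ p * a₂ p) := by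
    have gen : ∀ {a₁ a₂ b₁ b₂ : ℝ × ℝ → 𝕜}, (∀ p ∈ W, a₁ p * b₁ p = 1 / 2) →
        (∀ p ∈ W, a₂ p * b₂ p = 1 / 2) → ∀ p ∈ W,
        4 * (a₁ p * a₁ p * (a₂ p * a₂ p)) * (b₁ p * b₁ p + b₂ p * b₂ p) =
          a₁ p * a₁ p + a₂ p * a₂ p := fun {a₁ a₂ b₁ b₂} h1 h2 p hp => by
      linear_combination 4 * a₂ p * a₂ p * (a₁ p * b₁ p + 1 / 2) * h1 p hp
        + 4 * a₁ p * a₁ p * (a₂ p * b₂ p + 1 / 2) * h2 p hp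
    intro p hp
    have g := gen h.half₁ h.half₂ p hp
    have g' := gen h'.half₁ h'.half₂ p hp
    rw [hBB p hp, hAA p hp, ← g] at g'
    exact mul_left_cancel₀ (by norm_num) (mul_right_cancel₀ (hB p hp) g')
  -- Because `a₁a₂δ = (a₂² - a₁²)/2`.
  have hdiff : ∀ p ∈ W, a₁ p * a₁ p - a₂ p * a₂ p ≠ 0 := by
    intro p hp h0
    apply hδ p hp
    apply mul_left_cancel₀ (mul_ne_zero (ne_a h.half₁ hp) (ne_a h.half₂ hp))
    linear_combination (a₂ p * a₂ p) * h.half₁ p hp - a₁ p * a₁ p * h.half₂ p hp - h0 / 2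
  -- The differences `a₁² - a₂²` have equal squares. Their relative sign is constant and decides
  -- whether the tensors occur in the same order or permuted.
  obtain ⟨ε, hε, hεd⟩ := sgn ((h.smooth_a₁.mul h.smooth_a₁).sub (h.smooth_a₂.mul h.smooth_a₂))
    ((h'.smooth_a₁.mul h'.smooth_a₁).sub (h'.smooth_a₂.mul h'.smooth_a₂)) hdiff
    (fun p hp => by
      linear_combination (a₁' p * a₁' p + a₂' p * a₂' p + a₁ p * a₁ p + a₂ p * a₂ p) * hAA p hp
        - 4 * prod p hp)
  rcases hε with rfl | rfl
  · simp only [map_one, one_mul] at hεd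
    obtain ⟨ε₁, hε₁, h1⟩ := sgn h.smooth_a₁ h'.smooth_a₁ (fun p hp => ne_a h.half₁ hp)
      (fun p hp => by linear_combination (hAA p hp + hεd p hp) / 2)
    obtain ⟨ε₂, hε₂, h2⟩ := sgn h.smooth_a₂ h'.smooth_a₂ (fun p hp => ne_a h.half₂ hp)
      (fun p hp => by linear_combination (hAA p hp - hεd p hp) / 2)
    have hb1 := b_eq hε₁ h.half₁ h'.half₁ h1
    have hb2 := b_eq hε₂ h.half₂ h'.half₂ h2
    have hψ₂ := ψ_eq (ε := ε₁ * ε₂) h h' hAA hBB hA hB fun p hp => by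
      rw [h1 p hp, h2 p hp, hb1 p hp, hb2 p hp]; push_cast; ring
    have hψ₁ := ψ_eq (ε := ε₁ * ε₂) h.swap h'.swap hBB hAA hB hA fun p hp => by
      rw [h1 p hp, h2 p hp, hb1 p hp, hb2 p hp]; push_cast; ring
    push_cast at hψ₁ hψ₂
    exact ⟨ε₁, ε₂, hε₁, hε₂, Or.inl fun p hp =>
      ⟨h1 p hp, h2 p hp, hb1 p hp, hb2 p hp, hψ₁ p hp, hψ₂ p hp⟩⟩
  · simp only [map_neg, map_one, neg_mul, one_mul] at hεd
    obtain ⟨ε₁, hε₁, h1⟩ := sgn h.smooth_a₂ h'.smooth_a₁ (fun p hp => ne_a h.half₂ hp)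
      (fun p hp => by linear_combination (hAA p hp + hεd p hp) / 2)
    obtain ⟨ε₂, hε₂, h2⟩ := sgn h.smooth_a₁ h'.smooth_a₂ (fun p hp => ne_a h.half₁ hp)
      (fun p hp => by linear_combination (hAA p hp - hεd p hp) / 2)
    have hb1 := b_eq hε₁ h.half₂ h'.half₁ h1
    have hb2 := b_eq hε₂ h.half₁ h'.half₂ h2
    have hψ₂ := ψ_eq (ε := -(ε₁ * ε₂)) h h' hAA hBB hA hB fun p hp => by
      rw [h1 p hp, h2 p hp, hb1 p hp, hb2 p hp]; push_cast; ring
    have hψ₁ := ψ_eq (ε := -(ε₁ * ε₂)) h.swap h'.swap hBB hAA hB hA fun p hp => by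
      rw [h1 p hp, h2 p hp, hb1 p hp, hb2 p hp]; push_cast; ring
    push_cast at hψ₁ hψ₂
    exact ⟨ε₁, ε₂, hε₁, hε₂, Or.inr fun p hp =>
      ⟨h1 p hp, h2 p hp, hb1 p hp, hb2 p hp, hψ₁ p hp, hψ₂ p hp⟩⟩

end frame

/-! ### Linear algebra in the coordinate plane -/

section plane

variable {E : Type} [AddCommGroup E] [Module ℝ E]

theorem clm_ext_frame {F : Type} [NormedAddCommGroup F] [NormedSpace ℝ F] {f g : ℝ × ℝ →L[ℝ] F}
    (hu : f eu = g eu) (hv : f ev = g ev) : f = g := by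
  ext
  · exact hu
  · exact hv

theorem apply_frame {F : Type} [NormedAddCommGroup F] [NormedSpace ℝ F] (f : ℝ × ℝ →L[ℝ] F)
    (x : ℝ × ℝ) : f x = x.1 • f eu + x.2 • f ev := by
  conv_lhs => rw [eq_frame x]
  simp

theorem det_eq (f : ℝ × ℝ →L[ℝ] ℝ × ℝ) :
    f.det = (f eu).1 * (f ev).2 - (f ev).1 * (f eu).2 := by
  rw [ContinuousLinearMap.det, ← LinearMap.det_toMatrix (Module.Basis.finTwoProd ℝ),
    Matrix.det_fin_two]
  simp [LinearMap.toMatrix_apply, eu, ev]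

theorem finrank_range_eq_two_iff (f : ℝ × ℝ →L[ℝ] ℝ × ℝ) :
    Module.finrank ℝ (LinearMap.range (f : ℝ × ℝ →ₗ[ℝ] ℝ × ℝ)) = 2 ↔ f.det ≠ 0 := by
  have h2 : Module.finrank ℝ (ℝ × ℝ) = 2 := by simp
  rw [ContinuousLinearMap.det, ← isUnit_iff_ne_zero, ← LinearMap.isUnit_iff_isUnit_det,
    LinearMap.isUnit_iff_range_eq_top]
  constructor
  · intro h
    exact Submodule.eq_top_of_finrank_eq (h.trans h2.symm)
  · intro h
    rw [h, finrank_top, h2]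

/-- Bilinearity of a function of two tangent vectors. -/
structure IsBilin (f : ℝ × ℝ → ℝ × ℝ → E) : Prop where
  add_left : ∀ x x' y, f (x + x') y = f x y + f x' y
  smul_left : ∀ (a : ℝ) x y, f (a • x) y = a • f x y
  add_right : ∀ x y y', f x (y + y') = f x y + f x y'
  smul_right : ∀ (a : ℝ) x y, f x (a • y) = a • f x y

namespace IsBilin

variable {f g : ℝ × ℝ → ℝ × ℝ → E}

theorem apply_right (hf : IsBilin f) (x y : ℝ × ℝ) : f x y = y.1 • f x eu + y.2 • f x ev := by
  conv_lhs => rw [eq_frame y]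
  rw [hf.add_right, hf.smul_right, hf.smul_right]

theorem apply_left (hf : IsBilin f) (x y : ℝ × ℝ) : f x y = x.1 • f eu y + x.2 • f ev y := by
  conv_lhs => rw [eq_frame x]
  rw [hf.add_left, hf.smul_left, hf.smul_left]

/-- An alternating form on the plane is determined by its value on one frame. Hence the Codazzi and
Ricci equations need checking on `∂_u, ∂_v` only. -/
theorem sub_flip (hf : IsBilin f) (x y : ℝ × ℝ) :
    f x y - f y x = (x.1 * y.2 - x.2 * y.1) • (f eu ev - f ev eu) := by
  rw [hf.apply_left x y, hf.apply_left y x, hf.apply_right eu y, hf.apply_right ev y,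
    hf.apply_right eu x, hf.apply_right ev x]
  module

theorem forall_sub_flip_iff (hf : IsBilin f) (hg : IsBilin g) :
    (∀ x y, f x y - f y x = g x y - g y x) ↔ f eu ev - f ev eu = g eu ev - g ev eu :=
  ⟨fun h => h eu ev, fun h x y => by rw [hf.sub_flip, hg.sub_flip, h]⟩

theorem add (hf : IsBilin f) (hg : IsBilin g) : IsBilin fun x y => f x y + g x y where
  add_left x x' y := by rw [hf.add_left, hg.add_left]; abel
  smul_left a x y := by rw [hf.smul_left, hg.smul_left, smul_add]
  add_right x y y' := by rw [hf.add_right, hg.add_right]; abel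
  smul_right a x y := by rw [hf.smul_right, hg.smul_right, smul_add]

theorem neg (hf : IsBilin f) : IsBilin fun x y => -f x y where
  add_left x x' y := by rw [hf.add_left]; abel
  smul_left a x y := by rw [hf.smul_left, smul_neg]
  add_right x y y' := by rw [hf.add_right]; abel
  smul_right a x y := by rw [hf.smul_right, smul_neg]

theorem comp {F : Type} [AddCommGroup F] [Module ℝ F] (hf : IsBilin f) (L : E →ₗ[ℝ] F)
    (A B : ℝ × ℝ →L[ℝ] ℝ × ℝ) : IsBilin fun x y => L (f (A x) (B y)) where
  add_left x x' y := by rw [map_add, hf.add_left, map_add]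
  smul_left a x y := by rw [map_smul, hf.smul_left, map_smul]
  add_right x y y' := by rw [map_add, hf.add_right, map_add]
  smul_right a x y := by rw [map_smul, hf.smul_right, map_smul]

end IsBilin

theorem isBilin_smul (ψ : ℝ × ℝ →L[ℝ] ℝ) (D : ℝ × ℝ →L[ℝ] ℝ × ℝ) :
    IsBilin fun x y => ψ x • D y where
  add_left x x' y := by rw [map_add, add_smul]
  smul_left a x y := by rw [map_smul, smul_assoc]
  add_right x y y' := by rw [map_add, smul_add]
  smul_right a x y := by rw [map_smul, smul_comm]

theorem isBilin_clm {F : Type} [NormedAddCommGroup F] [NormedSpace ℝ F]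
    (L : ℝ × ℝ →L[ℝ] ℝ × ℝ →L[ℝ] F) : IsBilin fun x y => L x y where
  add_left x x' y := by simp
  smul_left a x y := by simp
  add_right x y y' := by simp
  smul_right a x y := by simp

end plane

/-! ### The geometry of a surface in coordinates -/

section surface

variable {n : ℕ} {s : ℝ × ℝ → Fin (n + 3) → ℝ} {W : Set (ℝ × ℝ)} {p : ℝ × ℝ}

theorem lorentz_smul (a : ℝ) (x y : Fin (n + 3) → ℝ) : lorentz (a • x) y = a * lorentz x y := by
  simpa [lorentz] using lorentz_add_smul a 0 x x y

theorem lorentz_add (x x' y : Fin (n + 3) → ℝ) :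
    lorentz (x + x') y = lorentz x y + lorentz x' y := by
  simpa using lorentz_add_smul 1 1 x x' y

theorem isBilin_metric (s : ℝ × ℝ → Fin (n + 3) → ℝ) (p : ℝ × ℝ) : IsBilin (metric s p) where
  add_left x x' y := by simp only [metric, map_add, lorentz_add]
  smul_left a x y := by simp only [metric, map_smul, lorentz_smul, smul_eq_mul]
  add_right x y y' := by
    simp only [metric, map_add, lorentz_comm (fderiv ℝ s p x), lorentz_add]
  smul_right a x y := by
    simp only [metric, map_smul, lorentz_comm (fderiv ℝ s p x), lorentz_smul, smul_eq_mul]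

theorem metric_comm (s : ℝ × ℝ → Fin (n + 3) → ℝ) (p x y : ℝ × ℝ) :
    metric s p x y = metric s p y x := lorentz_comm _ _

theorem IsSurface.contDiffOn_fderiv (hs : IsSurface s W) (hW : IsOpen W) :
    ContDiffOn ℝ ∞ (fderiv ℝ s) W := hs.smooth.fderiv_of_isOpen hW (by simp)

theorem contDiffOn_lorentz {x y : ℝ × ℝ → Fin (n + 3) → ℝ} (hx : ContDiffOn ℝ ∞ x W)
    (hy : ContDiffOn ℝ ∞ y W) : ContDiffOn ℝ ∞ (fun p => lorentz (x p) (y p)) W := by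
  rw [contDiffOn_pi] at hx hy
  unfold lorentz
  exact ((hx 0).mul (hy 0)).neg.add (ContDiffOn.sum fun i _ => (hx _).mul (hy _))

theorem IsSurface.contDiffOn_metric (hs : IsSurface s W) (hW : IsOpen W) (x y : ℝ × ℝ) :
    ContDiffOn ℝ ∞ (fun p => metric s p x y) W :=
  contDiffOn_lorentz ((hs.contDiffOn_fderiv hW).clm_apply contDiffOn_const)
    ((hs.contDiffOn_fderiv hW).clm_apply contDiffOn_const)

theorem IsSurface.second_eq (hs : IsSurface s W) (hW : IsOpen W) (hp : p ∈ W) (x y : ℝ × ℝ) :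
    second s p x y = fderiv ℝ (fderiv ℝ s) p x y := by
  have hd : DifferentiableAt ℝ (fderiv ℝ s) p :=
    ((hs.contDiffOn_fderiv hW).contDiffAt (hW.mem_nhds hp)).differentiableAt (by simp)
  have h := (hd.hasFDerivAt.clm_apply (hasFDerivAt_const y p)).fderiv
  rw [second, h]
  simp

theorem IsSurface.contDiffOn_second (hs : IsSurface s W) (hW : IsOpen W) (x y : ℝ × ℝ) :
    ContDiffOn ℝ ∞ (fun p => second s p x y) W :=
  (ContDiffOn.fderiv_of_isOpen ((hs.contDiffOn_fderiv hW).clm_apply contDiffOn_const) hW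
    (by simp)).clm_apply contDiffOn_const

theorem IsSurface.contDiffOn_christoffel (hs : IsSurface s W) (hW : IsOpen W) (x y : ℝ × ℝ) :
    ContDiffOn ℝ ∞ (fun p => christoffel s p x y) W := by
  have h1 : ContDiffOn ℝ ∞ (fun p => lorentz (second s p x y) (fderiv ℝ s p eu)) W :=
    contDiffOn_lorentz (hs.contDiffOn_second hW x y)
      ((hs.contDiffOn_fderiv hW).clm_apply contDiffOn_const)
  have h2 : ContDiffOn ℝ ∞ (fun p => lorentz (second s p x y) (fderiv ℝ s p ev)) W :=
    contDiffOn_lorentz (hs.contDiffOn_second hW x y)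
      ((hs.contDiffOn_fderiv hW).clm_apply contDiffOn_const)
  have hE := hs.contDiffOn_metric hW eu eu
  have hF := hs.contDiffOn_metric hW eu ev
  have hG := hs.contDiffOn_metric hW ev ev
  have hg : ContDiffOn ℝ ∞ (fun p => gramDet s p) W := (hE.mul hG).sub (hF.pow 2)
  exact (((hG.mul h1).sub (hF.mul h2)).div hg hs.nondegenerate).prodMk
    (((hE.mul h2).sub (hF.mul h1)).div hg hs.nondegenerate)

theorem IsSurface.isBilin_second (hs : IsSurface s W) (hW : IsOpen W) (hp : p ∈ W) :
    IsBilin (second s p) := by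
  have h := isBilin_clm (fderiv ℝ (fderiv ℝ s) p)
  rwa [show (fun x y => fderiv ℝ (fderiv ℝ s) p x y) = second s p from
    funext₂ fun x y => (hs.second_eq hW hp x y).symm] at h

theorem IsSurface.isBilin_christoffel (hs : IsSurface s W) (hW : IsOpen W) (hp : p ∈ W) :
    IsBilin (christoffel s p) := by
  have h := hs.isBilin_second hW hp
  constructor
  · intro x x' y
    ext <;> simp only [christoffel, h.add_left, lorentz_add, Prod.fst_add, Prod.snd_add] <;> ring
  · intro a x y
    ext <;> simp only [christoffel, h.smul_left, lorentz_smul, Prod.smul_fst, Prod.smul_snd,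
      smul_eq_mul] <;> ring
  · intro x y y'
    ext <;> simp only [christoffel, h.add_right, lorentz_add, Prod.fst_add, Prod.snd_add] <;> ring
  · intro a x y
    ext <;> simp only [christoffel, h.smul_right, lorentz_smul, Prod.smul_fst, Prod.smul_snd,
      smul_eq_mul] <;> ring

/-- Vanishing torsion, inherited from the symmetry of the second derivative of `s`. -/
theorem IsSurface.christoffel_comm (hs : IsSurface s W) (hW : IsOpen W) (hp : p ∈ W)
    (x y : ℝ × ℝ) : christoffel s p x y = christoffel s p y x := by
  have h : second s p x y = second s p y x := by
    rw [hs.second_eq hW hp, hs.second_eq hW hp]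
    exact ((hs.smooth.contDiffAt (hW.mem_nhds hp)).isSymmSndFDerivAt (by
      simpa using (WithTop.coe_le_coe.2 le_top : ((2 : ℕ∞) : WithTop ℕ∞) ≤ ∞))).eq x y
  simp only [christoffel, h]

theorem contDiffOn_clm_iff {F : Type} [NormedAddCommGroup F] [NormedSpace ℝ F]
    {D : ℝ × ℝ → ℝ × ℝ →L[ℝ] F} :
    ContDiffOn ℝ ∞ D W ↔
      ContDiffOn ℝ ∞ (fun q => D q eu) W ∧ ContDiffOn ℝ ∞ (fun q => D q ev) W := by
  rw [contDiffOn_clm_apply]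
  refine ⟨fun h => ⟨h _, h _⟩, fun h y => ?_⟩
  simp only [apply_frame _ y]
  exact (contDiffOn_const.smul h.1).add (contDiffOn_const.smul h.2)

theorem fderiv_clm_apply_const {F : Type} [NormedAddCommGroup F] [NormedSpace ℝ F]
    {D : ℝ × ℝ → ℝ × ℝ →L[ℝ] F} (hW : IsOpen W) (hD : ContDiffOn ℝ ∞ D W) (hp : p ∈ W)
    (x y : ℝ × ℝ) : fderiv ℝ (fun q => D q y) p x = fderiv ℝ D p x y := by
  have hd : DifferentiableAt ℝ D p := (hD.contDiffAt (hW.mem_nhds hp)).differentiableAt (by simp)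
  rw [(hd.hasFDerivAt.clm_apply (hasFDerivAt_const y p)).fderiv]
  simp

theorem covDerivEnd_eq (D : ℝ × ℝ → ℝ × ℝ →L[ℝ] ℝ × ℝ) (x y : ℝ × ℝ) :
    covDerivEnd s D p x y = fderiv ℝ (fun q => D q y) p x + christoffel s p x (D p y)
      + -D p (christoffel s p x y) := by
  simp [covDerivEnd, covDeriv, sub_eq_add_neg]

theorem IsSurface.isBilin_covDerivEnd (hs : IsSurface s W) (hW : IsOpen W)
    {D : ℝ × ℝ → ℝ × ℝ →L[ℝ] ℝ × ℝ} (hD : ContDiffOn ℝ ∞ D W) (hp : p ∈ W) :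
    IsBilin (covDerivEnd s D p) := by
  rw [show covDerivEnd s D p = fun x y => fderiv ℝ D p x y + christoffel s p x (D p y)
      + -D p (christoffel s p x y) from funext₂ fun x y => by
    rw [covDerivEnd_eq, fderiv_clm_apply_const hW hD hp]]
  have hc := hs.isBilin_christoffel hW hp
  exact ((isBilin_clm _).add (hc.comp LinearMap.id (ContinuousLinearMap.id ℝ _) (D p))).add
    (hc.comp (D p : ℝ × ℝ →ₗ[ℝ] ℝ × ℝ) (ContinuousLinearMap.id ℝ _)
      (ContinuousLinearMap.id ℝ _)).neg

/-- The Codazzi equation holds as soon as it holds on the coordinate frame. -/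
theorem IsSurface.codazzi_iff (hs : IsSurface s W) (hW : IsOpen W)
    {D : ℝ × ℝ → ℝ × ℝ →L[ℝ] ℝ × ℝ} (hD : ContDiffOn ℝ ∞ D W) (hp : p ∈ W)
    (D' : ℝ × ℝ →L[ℝ] ℝ × ℝ) (ψ : ℝ × ℝ →L[ℝ] ℝ) :
    (∀ x y, covDerivEnd s D p x y - covDerivEnd s D p y x = ψ x • D' y - ψ y • D' x) ↔
      pu (fun q => D q ev) p + christoffel s p eu (D p ev)
        - (pv (fun q => D q eu) p + christoffel s p ev (D p eu)) = ψ eu • D' ev - ψ ev • D' eu := by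
  rw [(hs.isBilin_covDerivEnd hW hD hp).forall_sub_flip_iff (isBilin_smul ψ D'), covDerivEnd_eq,
    covDerivEnd_eq, hs.christoffel_comm hW hp ev eu, add_sub_add_right_eq_sub]
  rfl

theorem IsSurface.ricci_iff (hW : IsOpen W) {ψ : ℝ × ℝ → ℝ × ℝ →L[ℝ] ℝ}
    (hψ : ContDiffOn ℝ ∞ ψ W) (hp : p ∈ W) (D D' : ℝ × ℝ →L[ℝ] ℝ × ℝ) :
    (∀ x y, extD ψ p x y = metric s p (D' x) (D y) - metric s p (D x) (D' y)) ↔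
      pu (fun q => ψ q ev) p - pv (fun q => ψ q eu) p =
        metric s p (D' eu) (D ev) - metric s p (D eu) (D' ev) := by
  have h := (isBilin_clm (fderiv ℝ ψ p)).forall_sub_flip_iff
    ((isBilin_metric s p).comp LinearMap.id D' D)
  simp only [LinearMap.id_apply] at h
  simp only [metric_comm s p (D _) (D' _), pu, pv, fderiv_clm_apply_const hW hψ hp]
  exact h

end surface

/-! ### Hyperbolic surfaces -/

section hyperbolic

variable {n : ℕ} {s : ℝ × ℝ → Fin (n + 3) → ℝ} {J : ℝ × ℝ → ℝ × ℝ →L[ℝ] ℝ × ℝ}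
  {W : Set (ℝ × ℝ)} {p : ℝ × ℝ}

/-- The functions `f` and `|f|` have the same square, so they agree up to a global sign. -/
theorem IsPreconnected.pos_or_neg {X : Type} [TopologicalSpace X] {W : Set X}
    (hW : IsPreconnected W) {f : X → ℝ} (hf : ContinuousOn f W) (h0 : ∀ p ∈ W, f p ≠ 0) :
    (∀ p ∈ W, 0 < f p) ∨ (∀ p ∈ W, f p < 0) := by
  rcases hW.eq_or_eq_neg_of_sq_eq hf hf.abs (fun p _ => by simp)
    (fun {p} hp => abs_ne_zero.2 (h0 p hp)) with h | h
  · exact Or.inl fun p hp => by rw [h hp]; exact abs_pos.2 (h0 p hp)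
  · exact Or.inr fun p hp => by rw [h hp]; exact neg_neg_of_pos (abs_pos.2 (h0 p hp))

theorem pd_one_zero (f : ℝ × ℝ → ℝ) : pd ((1, 0) : ℝ × ℝ) f = pu f := by ext p; simp [pd]

theorem pd_zero_one (f : ℝ × ℝ → ℝ) : pd ((0, 1) : ℝ × ℝ) f = pv f := by ext p; simp [pd]

theorem fderiv_smul_const_apply {a : ℝ × ℝ → ℝ} (ha : DifferentiableAt ℝ a p) (x y : ℝ × ℝ) :
    fderiv ℝ (fun q => a q • y) p x = fderiv ℝ a p x • y := by
  rw [fderiv_smul_const ha]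
  simp

theorem fderiv_congr_on {E : Type} [NormedAddCommGroup E] [NormedSpace ℝ E] {f g : ℝ × ℝ → E}
    (hW : IsOpen W) (hp : p ∈ W) (h : EqOn f g W) : fderiv ℝ f p = fderiv ℝ g p :=
  (h.eventuallyEq_of_mem (hW.mem_nhds hp)).fderiv_eq

/-- Admissibility of a triple in terms of the eigenvalues of the tensors. -/
theorem IsSurface.hyp_admissible_iff (hs : IsSurface s W) (hW : IsOpen W)
    (hJ : ∀ p ∈ W, J p eu = eu ∧ J p ev = -ev) {T : Triple} {a₁ a₂ b₁ b₂ : ℝ × ℝ → ℝ}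
    (h1 : ∀ p ∈ W, T.D₁ p eu = a₁ p • eu ∧ T.D₁ p ev = b₁ p • ev)
    (h2 : ∀ p ∈ W, T.D₂ p eu = a₂ p • eu ∧ T.D₂ p ev = b₂ p • ev) :
    IsAdmissible s J W T ↔
      IsFrame W ((1, 0) : ℝ × ℝ) (0, 1) (Γ₁ s) (Γ₂ s) a₁ a₂ b₁ b₂ (fun p => T.ψ p eu)
        (fun p => T.ψ p ev) ∧
      ∀ p ∈ W, pd ((1, 0) : ℝ × ℝ) (fun p => T.ψ p ev) p
          - pd ((0, 1) : ℝ × ℝ) (fun p => T.ψ p eu) p =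
          metric s p eu ev * (a₂ p * b₁ p - a₁ p * b₂ p) ∧
        a₂ p * b₁ p - a₁ p * b₂ p ≠ 0 ∧ a₁ p * a₁ p + a₂ p * a₂ p ≠ 1 ∧
        b₁ p * b₁ p + b₂ p * b₂ p ≠ 1 := by
  have smooth : ∀ {D : ℝ × ℝ → ℝ × ℝ →L[ℝ] ℝ × ℝ} {a b : ℝ × ℝ → ℝ},
      (∀ p ∈ W, D p eu = a p • eu ∧ D p ev = b p • ev) →
      (ContDiffOn ℝ ∞ D W ↔ ContDiffOn ℝ ∞ a W ∧ ContDiffOn ℝ ∞ b W) := by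
    intro D a b h
    rw [contDiffOn_clm_iff]
    constructor
    · rintro ⟨hu, hv⟩
      exact ⟨hu.fst.congr fun p hp => by rw [(h p hp).1]; simp [eu],
        hv.snd.congr fun p hp => by rw [(h p hp).2]; simp [ev]⟩
    · rintro ⟨ha, hb⟩
      exact ⟨(ha.smul contDiffOn_const).congr fun p hp => (h p hp).1,
        (hb.smul contDiffOn_const).congr fun p hp => (h p hp).2⟩
  have span : ∀ {D : ℝ × ℝ → ℝ × ℝ →L[ℝ] ℝ × ℝ} {a b : ℝ × ℝ → ℝ},
      (∀ p ∈ W, D p eu = a p • eu ∧ D p ev = b p • ev) → ∀ p ∈ W,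
      D p ∈ Submodule.span ℝ {1, J p} := by
    intro D a b h p hp
    rw [Submodule.mem_span_pair]
    refine ⟨(a p + b p) / 2, (a p - b p) / 2, clm_ext_frame ?_ ?_⟩
    · rw [(h p hp).1]
      simp only [_root_.add_apply, _root_.smul_apply, one_apply_eq_self, (hJ p hp).1]
      module
    · rw [(h p hp).2]
      simp only [_root_.add_apply, _root_.smul_apply, one_apply_eq_self, (hJ p hp).2]
      module
  have det : ∀ {D : ℝ × ℝ → ℝ × ℝ →L[ℝ] ℝ × ℝ} {a b : ℝ × ℝ → ℝ},
      (∀ p ∈ W, D p eu = a p • eu ∧ D p ev = b p • ev) → ∀ p ∈ W, (D p).det = a p * b p := by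
    intro D a b h p hp
    rw [det_eq, (h p hp).1, (h p hp).2]
    simp [eu, ev]
  have cod : ∀ {D D' : ℝ × ℝ → ℝ × ℝ →L[ℝ] ℝ × ℝ} {a b a' b' : ℝ × ℝ → ℝ},
      (∀ p ∈ W, D p eu = a p • eu ∧ D p ev = b p • ev) →
      (∀ p ∈ W, D' p eu = a' p • eu ∧ D' p ev = b' p • ev) → ContDiffOn ℝ ∞ D W →
      ∀ p ∈ W, ∀ ψ : ℝ × ℝ →L[ℝ] ℝ,
      ((∀ x y, covDerivEnd s D p x y - covDerivEnd s D p y x = ψ x • D' p y - ψ y • D' p x) ↔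
        pv a p = (b p - a p) * Γ₁ s p + ψ ev * a' p ∧
        pu b p = (a p - b p) * Γ₂ s p + ψ eu * b' p) := by
    intro D D' a b a' b' h h' hD p hp ψ
    obtain ⟨ha, hb⟩ := (smooth h).1 hD
    rw [hs.codazzi_iff hW hD hp]
    have hu : pv (fun q => D q eu) p = pv a p • eu := by
      rw [pv, fderiv_congr_on hW hp fun q hq => (h q hq).1,
        fderiv_smul_const_apply (differentiableAt_of_contDiffOn hW ha hp)]
      rfl
    have hv : pu (fun q => D q ev) p = pu b p • ev := by
      rw [pu, fderiv_congr_on hW hp fun q hq => (h q hq).2,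
        fderiv_smul_const_apply (differentiableAt_of_contDiffOn hW hb hp)]
      rfl
    have hc := hs.isBilin_christoffel hW hp
    rw [hu, hv, (h p hp).1, (h p hp).2, (h' p hp).1, (h' p hp).2, hc.smul_right, hc.smul_right,
      hs.christoffel_comm hW hp ev eu, Prod.ext_iff]
    simp only [Γ₁, Γ₂, eu, ev, Prod.fst_add, Prod.fst_sub, Prod.snd_add, Prod.snd_sub,
      Prod.smul_fst, Prod.smul_snd, smul_eq_mul, mul_zero, mul_one, zero_add, zero_sub, sub_zero]
    constructor
    · rintro ⟨e1, e2⟩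
      exact ⟨by linear_combination -e1, by linear_combination e2⟩
    · rintro ⟨e1, e2⟩
      exact ⟨by linear_combination -e1, by linear_combination e2⟩
  have sq : ∀ {D : ℝ × ℝ → ℝ × ℝ →L[ℝ] ℝ × ℝ} {a b : ℝ × ℝ → ℝ},
      (∀ p ∈ W, D p eu = a p • eu ∧ D p ev = b p • ev) → ∀ p ∈ W,
      (D p ^ 2) eu = (a p * a p) • eu ∧ (D p ^ 2) ev = (b p * b p) • ev := by
    intro D a b h p hp
    simp [pow_two, (h p hp).1, (h p hp).2, smul_smul]
  have eu1 : eu.1 = 1 := rfl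
  have ev2 : ev.2 = 1 := rfl
  have eu2 : eu.2 = 0 := rfl
  have ev1 : ev.1 = 0 := rfl
  have rank : ∀ p ∈ W, (Module.finrank ℝ (LinearMap.range
      ((T.D₁ p ^ 2 + T.D₂ p ^ 2 - 1 : ℝ × ℝ →L[ℝ] ℝ × ℝ) : ℝ × ℝ →ₗ[ℝ] ℝ × ℝ)) = 2 ↔
      a₁ p * a₁ p + a₂ p * a₂ p ≠ 1 ∧ b₁ p * b₁ p + b₂ p * b₂ p ≠ 1) := by
    intro p hp
    rw [finrank_range_eq_two_iff, det_eq]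
    have e1 := sq h1 p hp
    have e2 := sq h2 p hp
    simp only [_root_.sub_apply, _root_.add_apply, one_apply_eq_self, e1.1, e1.2, e2.1,
      e2.2, Prod.fst_sub, Prod.snd_sub, Prod.fst_add, Prod.snd_add, Prod.smul_fst, Prod.smul_snd,
      smul_eq_mul, eu1, eu2, ev1, ev2, mul_zero, mul_one, add_zero, sub_zero, mul_ne_zero_iff,
      sub_ne_zero]
  have ric : ContDiffOn ℝ ∞ T.ψ W → ∀ p ∈ W, ((∀ x y, extD T.ψ p x y =
      metric s p (T.D₂ p x) (T.D₁ p y) - metric s p (T.D₁ p x) (T.D₂ p y)) ↔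
      pd ((1, 0) : ℝ × ℝ) (fun p => T.ψ p ev) p - pd ((0, 1) : ℝ × ℝ) (fun p => T.ψ p eu) p =
          metric s p eu ev * (a₂ p * b₁ p - a₁ p * b₂ p)) := by
    intro hψ p hp
    rw [IsSurface.ricci_iff hW hψ hp, pd_one_zero, pd_zero_one, (h1 p hp).1, (h1 p hp).2,
      (h2 p hp).1, (h2 p hp).2]
    have hm := isBilin_metric s p
    simp only [hm.smul_left, hm.smul_right, smul_eq_mul]
    constructor <;> intro e <;> linear_combination e
  have ne : ∀ {p}, p ∈ W → a₁ p * b₁ p = 1 / 2 → a₂ p * b₂ p = 1 / 2 →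
      (T.D₂ p ^ 2 ≠ T.D₁ p ^ 2 ↔ a₂ p * b₁ p - a₁ p * b₂ p ≠ 0) := by
    intro p hp e1 e2
    have ha1 : a₁ p ≠ 0 := fun h => by simp [h] at e1
    have ha2 : a₂ p ≠ 0 := fun h => by simp [h] at e2
    have e3 : b₁ p = 1 / (2 * a₁ p) := by field_simp; linear_combination 2 * e1
    have e4 : b₂ p = 1 / (2 * a₂ p) := by field_simp; linear_combination 2 * e2
    -- The determinant condition ties `b_i` to `a_i`, so equality of the squares on `∂_u` already
    -- implies it on `∂_v`.
    have hδ : a₂ p * b₁ p - a₁ p * b₂ p = 0 ↔ a₂ p * a₂ p = a₁ p * a₁ p := by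
      rw [e3, e4]
      field_simp
      constructor <;> intro h <;> linear_combination h
    rw [not_iff_not, hδ]
    have s1 := sq h1 p hp
    have s2 := sq h2 p hp
    constructor
    · intro h
      have := congrArg (fun f : ℝ × ℝ →L[ℝ] ℝ × ℝ => (f eu).1) h
      simpa only [s1.1, s2.1, Prod.smul_fst, eu1, smul_eq_mul, mul_one] using this
    · intro h
      refine clm_ext_frame ?_ ?_
      · rw [s1.1, s2.1, h]
      · rw [s1.2, s2.2, e3, e4]
        congr 1
        field_simp
        linear_combination -h
  constructor
  · intro h
    have d1 : ∀ p ∈ W, a₁ p * b₁ p = 1 / 2 := fun p hp => by rw [← det h1 p hp, h.det₁ p hp]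
    have d2 : ∀ p ∈ W, a₂ p * b₂ p = 1 / 2 := fun p hp => by rw [← det h2 p hp, h.det₂ p hp]
    have c1 := fun p hp => (cod h1 h2 h.smooth₁ p hp (T.ψ p)).1 (h.codazzi₁ p hp)
    -- The second Codazzi equation is the first with the tensors exchanged and `ψ` replaced by `-ψ`.
    have c2 := fun p hp => (cod h2 h1 h.smooth₂ p hp (-T.ψ p)).1 fun x y => by
      rw [h.codazzi₂ p hp x y]
      simp only [_root_.neg_apply]
      module
    have ψs := contDiffOn_clm_iff.1 h.smoothψ
    refine ⟨⟨((smooth h1).1 h.smooth₁).1, ((smooth h2).1 h.smooth₂).1, ((smooth h1).1 h.smooth₁).2,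
      ((smooth h2).1 h.smooth₂).2, ψs.1, ψs.2, d1, d2, ?_, ?_, ?_, ?_⟩,
      fun p hp => ⟨(ric h.smoothψ p hp).1 (h.ricci p hp), (ne hp (d1 p hp) (d2 p hp)).1
        (h.sq_ne p hp), (rank p hp).1 (h.rank_eq p hp)⟩⟩ <;> intro p hp
    · rw [pd_zero_one, (c1 p hp).1]
    · rw [pd_zero_one, (c2 p hp).1, _root_.neg_apply]; ring
    · rw [pd_one_zero, (c1 p hp).2]
    · rw [pd_one_zero, (c2 p hp).2, _root_.neg_apply]; ring
  · rintro ⟨h, h'⟩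
    have sm1 := (smooth h1).2 ⟨h.smooth_a₁, h.smooth_b₁⟩
    have sm2 := (smooth h2).2 ⟨h.smooth_a₂, h.smooth_b₂⟩
    have smψ := contDiffOn_clm_iff.2 ⟨h.smooth_ψ₁, h.smooth_ψ₂⟩
    refine ⟨sm1, sm2, smψ, span h1, span h2, fun p hp => (det h1 p hp).trans (h.half₁ p hp),
      fun p hp => (det h2 p hp).trans (h.half₂ p hp), fun p hp => (cod h1 h2 sm1 p hp _).2 ?_,
      fun p hp x y => ?_, fun p hp => (ric smψ p hp).2 (h' p hp).1,
      fun p hp => (ne hp (h.half₁ p hp) (h.half₂ p hp)).2 (h' p hp).2.1, fun p hp he => ?_,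
      fun p hp => (rank p hp).2 (h' p hp).2.2⟩
    · rw [← pd_zero_one, ← pd_one_zero]
      exact ⟨h.cod_a₁ p hp, h.cod_b₁ p hp⟩
    · have := (cod h2 h1 sm2 p hp (-T.ψ p)).2 ⟨by
        rw [← pd_zero_one, h.cod_a₂ p hp, _root_.neg_apply]; ring, by
        rw [← pd_one_zero, h.cod_b₂ p hp, _root_.neg_apply]; ring⟩ x y
      rw [this]
      simp only [_root_.neg_apply]
      module
    -- Over the reals `D₂² = -D₁²` would give `a₂² = -a₁² < 0`, so this condition is automatic.
    · have s1 := sq h1 p hp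
      have s2 := sq h2 p hp
      have := congrArg (fun f : ℝ × ℝ →L[ℝ] ℝ × ℝ => (f eu).1) he
      simp only [_root_.neg_apply, s1.1, s2.1, Prod.smul_fst, Prod.fst_neg, smul_eq_mul, eu1,
        mul_one] at this
      have ha1 : a₁ p ≠ 0 := fun h0 => by simpa [h0] using h.half₁ p hp
      nlinarith [mul_self_pos.2 ha1, mul_self_nonneg (a₂ p)]

/-- The tensors of an admissible triple are diagonal in real-conjugate coordinates. -/
theorem IsAdmissible.hyp_diagonal (hJ : ∀ p ∈ W, J p eu = eu ∧ J p ev = -ev) {T : Triple}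
    (h : IsAdmissible s J W T) :
    (∀ p ∈ W, T.D₁ p eu = (T.D₁ p eu).1 • eu ∧ T.D₁ p ev = (T.D₁ p ev).2 • ev) ∧
    (∀ p ∈ W, T.D₂ p eu = (T.D₂ p eu).1 • eu ∧ T.D₂ p ev = (T.D₂ p ev).2 • ev) := by
  have key : ∀ (D : ℝ × ℝ →L[ℝ] ℝ × ℝ), ∀ p ∈ W, D ∈ Submodule.span ℝ {1, J p} →
      D eu = (D eu).1 • eu ∧ D ev = (D ev).2 • ev := by
    intro D p hp hD
    obtain ⟨α, β, rfl⟩ := Submodule.mem_span_pair.1 hD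
    simp only [_root_.add_apply, _root_.smul_apply, one_apply_eq_self, (hJ p hp).1,
      (hJ p hp).2]
    constructor <;> ext <;> simp [eu, ev]
  exact ⟨fun p hp => key _ p hp (h.span₁ p hp), fun p hp => key _ p hp (h.span₂ p hp)⟩

end hyperbolic

/-! ### Hyperbolic surfaces: the functions `φ^U`, `φ^V`, and the passage from triples to `C_s`. -/

section hyperbolic

variable {n : ℕ} {s : ℝ × ℝ → Fin (n + 3) → ℝ} {J : ℝ × ℝ → ℝ × ℝ →L[ℝ] ℝ × ℝ}
  {W : Set (ℝ × ℝ)} {p : ℝ × ℝ} {I K : Set ℝ}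

theorem hasDerivAt_primitive (hK : IsOpen K) (hKc : K.OrdConnected) (h0 : 0 ∈ K) {g : ℝ → ℝ}
    (hg : ContinuousOn g K) {v : ℝ} (hv : v ∈ K) :
    HasDerivAt (fun v => ∫ t in (0 : ℝ)..v, g t) (g v) v :=
  intervalIntegral.integral_hasDerivAt_right
    ((hg.mono (hKc.uIcc_subset h0 hv)).intervalIntegrable)
    (hg.stronglyMeasurableAtFilter hK v hv) (hg.continuousAt (hK.mem_nhds hv))

/-- The product of `f` with `exp (-2 ∫ g)` has zero derivative on an interval. -/
theorem eq_mul_exp_primitive (hK : IsOpen K) (hKc : K.OrdConnected) (h0 : 0 ∈ K) {f g : ℝ → ℝ}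
    (hg : ContinuousOn g K) (hf : ∀ t ∈ K, HasDerivAt f (2 * g t * f t) t) {v : ℝ} (hv : v ∈ K) :
    f v = f 0 * Real.exp (2 * ∫ t in (0 : ℝ)..v, g t) := by
  have hd : ∀ t ∈ K, HasDerivAt (fun v => f v * Real.exp (-(2 * ∫ t in (0 : ℝ)..v, g t))) 0 t := by
    intro t ht
    exact ((hf t ht).mul ((hasDerivAt_primitive hK hKc h0 hg ht).const_mul 2).neg.exp).congr_deriv
      (by ring)
  have h := hK.is_const_of_deriv_eq_zero hKc.isPreconnected
    (fun t ht => (hd t ht).differentiableAt.differentiableWithinAt) (fun t ht => (hd t ht).deriv)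
    hv h0
  simp only [intervalIntegral.integral_same, mul_zero, neg_zero, Real.exp_zero, mul_one] at h
  rw [← h, mul_assoc, ← Real.exp_add]
  simp

theorem hasDerivAt_slice_snd {f : ℝ × ℝ → ℝ} (h : DifferentiableAt ℝ f p) :
    HasDerivAt (fun t => f (p.1, t)) (pv f p) p.2 :=
  h.hasFDerivAt.comp_hasDerivAt p.2 ((hasDerivAt_const p.2 p.1).prodMk (hasDerivAt_id p.2))

theorem hasDerivAt_slice_fst {f : ℝ × ℝ → ℝ} (h : DifferentiableAt ℝ f p) :
    HasDerivAt (fun t => f (t, p.2)) (pu f p) p.1 :=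
  h.hasFDerivAt.comp_hasDerivAt p.1 ((hasDerivAt_id p.1).prodMk (hasDerivAt_const p.1 p.2))

theorem IsSurface.contDiffOn_Γ₁ (hs : IsSurface s W) (hW : IsOpen W) : ContDiffOn ℝ ∞ (Γ₁ s) W :=
  (hs.contDiffOn_christoffel hW eu ev).fst

theorem IsSurface.contDiffOn_Γ₂ (hs : IsSurface s W) (hW : IsOpen W) : ContDiffOn ℝ ∞ (Γ₂ s) W :=
  (hs.contDiffOn_christoffel hW eu ev).snd

theorem continuousOn_slice_snd {f : ℝ × ℝ → ℝ} (hf : ContinuousOn f (I ×ˢ K)) {u : ℝ}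
    (hu : u ∈ I) : ContinuousOn (fun t => f (u, t)) K :=
  hf.comp (by fun_prop) fun _ ht => ⟨hu, ht⟩

theorem continuousOn_slice_fst {f : ℝ × ℝ → ℝ} (hf : ContinuousOn f (I ×ˢ K)) {v : ℝ}
    (hv : v ∈ K) : ContinuousOn (fun t => f (t, v)) I :=
  hf.comp (by fun_prop) fun _ ht => ⟨ht, hv⟩

section phi

variable (hs : IsSurface s (I ×ˢ K)) (hI : IsOpen I) (hK : IsOpen K)
include hs hI hK

theorem contDiffOn_phiU (hKc : K.OrdConnected) (h0 : 0 ∈ K) {U : ℝ → ℝ} (hU : ContDiffOn ℝ ∞ U I) :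
    ContDiffOn ℝ ∞ (phiU s U) (I ×ˢ K) :=
  (hU.comp contDiffOn_fst fun _ hp => hp.1).mul
    (contDiffOn_const.mul (contDiffOn_primitive_snd hI hK hKc h0
      (hs.contDiffOn_Γ₁ (hI.prod hK)))).exp

theorem contDiffOn_phiV (hIc : I.OrdConnected) (h0 : 0 ∈ I) {V : ℝ → ℝ} (hV : ContDiffOn ℝ ∞ V K) :
    ContDiffOn ℝ ∞ (phiV s V) (I ×ˢ K) :=
  (hV.comp contDiffOn_snd fun _ hp => hp.2).mul
    (contDiffOn_const.mul (contDiffOn_primitive_fst hI hK hIc h0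
      (hs.contDiffOn_Γ₂ (hI.prod hK)))).exp

theorem pv_phiU (hKc : K.OrdConnected) (h0 : 0 ∈ K) {U : ℝ → ℝ} (hU : ContDiffOn ℝ ∞ U I)
    (hp : p ∈ I ×ˢ K) : pv (phiU s U) p = 2 * Γ₁ s p * phiU s U p := by
  have h1 := hasDerivAt_slice_snd (differentiableAt_of_contDiffOn (hI.prod hK)
    (contDiffOn_phiU hs hI hK hKc h0 hU) hp)
  have h2 := (((hasDerivAt_primitive hK hKc h0 (continuousOn_slice_snd
    (hs.contDiffOn_Γ₁ (hI.prod hK)).continuousOn hp.1) hp.2).const_mul 2).exp).const_mul (U p.1)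
  rw [h1.unique h2, phiU]
  ring

theorem pu_phiV (hIc : I.OrdConnected) (h0 : 0 ∈ I) {V : ℝ → ℝ} (hV : ContDiffOn ℝ ∞ V K)
    (hp : p ∈ I ×ˢ K) : pu (phiV s V) p = 2 * Γ₂ s p * phiV s V p := by
  have h1 := hasDerivAt_slice_fst (differentiableAt_of_contDiffOn (hI.prod hK)
    (contDiffOn_phiV hs hI hK hIc h0 hV) hp)
  have h2 := (((hasDerivAt_primitive hI hIc h0 (continuousOn_slice_fst
    (hs.contDiffOn_Γ₂ (hI.prod hK)).continuousOn hp.2) hp.1).const_mul 2).exp).const_mul (V p.2)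
  rw [h1.unique h2, phiV]
  ring

theorem eq_phiU (hKc : K.OrdConnected) (h0 : 0 ∈ K) {φ : ℝ × ℝ → ℝ}
    (hφ : ContDiffOn ℝ ∞ φ (I ×ˢ K)) (hd : ∀ p ∈ I ×ˢ K, pv φ p = 2 * Γ₁ s p * φ p)
    (hp : p ∈ I ×ˢ K) : φ p = phiU s (fun u => φ (u, 0)) p := by
  refine eq_mul_exp_primitive (f := fun t => φ (p.1, t)) hK hKc h0 (continuousOn_slice_snd
    (hs.contDiffOn_Γ₁ (hI.prod hK)).continuousOn hp.1) (fun t ht => ?_) hp.2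
  have hq : (p.1, t) ∈ I ×ˢ K := ⟨hp.1, ht⟩
  have := hasDerivAt_slice_snd (differentiableAt_of_contDiffOn (hI.prod hK) hφ hq)
  rwa [hd _ hq] at this

theorem eq_phiV (hIc : I.OrdConnected) (h0 : 0 ∈ I) {φ : ℝ × ℝ → ℝ}
    (hφ : ContDiffOn ℝ ∞ φ (I ×ˢ K)) (hd : ∀ p ∈ I ×ˢ K, pu φ p = 2 * Γ₂ s p * φ p)
    (hp : p ∈ I ×ˢ K) : φ p = phiV s (fun v => φ (0, v)) p := by
  refine eq_mul_exp_primitive (f := fun t => φ (t, p.2)) hI hIc h0 (continuousOn_slice_fst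
    (hs.contDiffOn_Γ₂ (hI.prod hK)).continuousOn hp.2) (fun t ht => ?_) hp.1
  have hq : (t, p.2) ∈ I ×ˢ K := ⟨ht, hp.2⟩
  have := hasDerivAt_slice_fst (differentiableAt_of_contDiffOn (hI.prod hK) hφ hq)
  rwa [hd _ hq] at this

end phi

/-- The Ricci equation of a frame is equivalent to `Q(ρ) = 0`. -/
theorem IsFrame.ricci_iff_hypQ (hs : IsSurface s W) (hW : IsOpen W) (hWc : IsPreconnected W)
    {a₁ a₂ b₁ b₂ ψ₁ ψ₂ : ℝ × ℝ → ℝ}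
    (h : IsFrame W ((1, 0) : ℝ × ℝ) (0, 1) (Γ₁ s) (Γ₂ s) a₁ a₂ b₁ b₂ ψ₁ ψ₂) {U V : ℝ → ℝ}
    (hU : ContDiffOn ℝ ∞ (phiU s U) W) (hV : ContDiffOn ℝ ∞ (phiV s V) W)
    (hx : ∀ p ∈ W, 2 * phiU s U p * (a₁ p * a₁ p + a₂ p * a₂ p - 1) = 1)
    (hy : ∀ p ∈ W, 2 * phiV s V p * (b₁ p * b₁ p + b₂ p * b₂ p - 1) = 1)
    (hδ : ∀ p ∈ W, a₂ p * b₁ p - a₁ p * b₂ p ≠ 0) (hp : p ∈ W) :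
    pd ((1, 0) : ℝ × ℝ) ψ₂ p - pd ((0, 1) : ℝ × ℝ) ψ₁ p =
        metric s p eu ev * (a₂ p * b₁ p - a₁ p * b₂ p) ↔ hypQ s (rhoUV s U V) p = 0 := by
  set x : ℝ × ℝ → ℝ := fun p => 2 * phiU s U p
  set y : ℝ × ℝ → ℝ := fun p => 2 * phiV s V p
  set S : ℝ × ℝ → ℝ := fun p => x p + y p + 1 with hSdef
  have sx : ContDiffOn ℝ ∞ x W := contDiffOn_const.mul hU
  have sy : ContDiffOn ℝ ∞ y W := contDiffOn_const.mul hV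
  have sS : ContDiffOn ℝ ∞ S W := (sx.add sy).add contDiffOn_const
  have ha : ∀ p ∈ W, a₁ p ≠ 0 := fun p hp h0 => by simpa [h0] using h.half₁ p hp
  have hb : ∀ p ∈ W, b₁ p ≠ 0 := fun p hp h0 => by simpa [h0] using h.half₁ p hp
  have hA : ∀ p ∈ W, a₁ p * a₁ p + a₂ p * a₂ p ≠ 0 := fun p hp =>
    (add_pos_of_pos_of_nonneg (mul_self_pos.2 (ha p hp)) (mul_self_nonneg _)).ne'
  have hB : ∀ p ∈ W, b₁ p * b₁ p + b₂ p * b₂ p ≠ 0 := fun p hp =>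
    (add_pos_of_pos_of_nonneg (mul_self_pos.2 (hb p hp)) (mul_self_nonneg _)).ne'
  -- Again `S = δ²xy`, a product of nonzero factors.
  have hS0 : ∀ p ∈ W, S p ≠ 0 := by
    intro p hp h0
    have h1 := h.delta_sq hp
    have h2 : (a₂ p * b₁ p - a₁ p * b₂ p) ^ 2 * (x p * y p) = S p := by
      have e1 : x p * (a₁ p * a₁ p + a₂ p * a₂ p) = x p + 1 := by linear_combination hx p hp
      have e2 : y p * (b₁ p * b₁ p + b₂ p * b₂ p) = y p + 1 := by linear_combination hy p hp
      rw [h1]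
      linear_combination (y p * (b₁ p * b₁ p + b₂ p * b₂ p)) * e1 + (x p + 1) * e2
    rw [h0] at h2
    exact mul_ne_zero (pow_ne_zero 2 (hδ p hp)) (mul_ne_zero
      (left_ne_zero_of_mul_eq_one (hx p hp)) (left_ne_zero_of_mul_eq_one (hy p hp))) h2
  have hρ : rhoUV s U V = fun p => Real.sqrt |S p| := by
    ext q
    simp only [rhoUV, hSdef, x, y]
    congr 2
    ring
  -- The sign of `S` is constant on the connected domain, which removes the absolute value and makes
  -- `ρ` smooth.
  obtain ⟨κ, hκ, hκS⟩ : ∃ κ : ℝ, κ * κ = 1 ∧ ∀ q ∈ W, |S q| = κ * S q := by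
    rcases IsPreconnected.pos_or_neg hWc sS.continuousOn hS0 with h | h
    · exact ⟨1, by norm_num, fun q hq => by rw [abs_of_pos (h q hq), one_mul]⟩
    · exact ⟨-1, by norm_num, fun q hq => by rw [abs_of_neg (h q hq), neg_one_mul]⟩
  have sρ : ContDiffOn ℝ ∞ (rhoUV s U V) W := by
    rw [hρ]
    exact ((contDiffOn_const.mul sS).congr hκS).sqrt fun q hq => abs_ne_zero.2 (hS0 q hq)
  have hρS : ∀ q ∈ W, S q = κ * (rhoUV s U V q * rhoUV s U V q) := by
    intro q hq
    rw [hρ, Real.mul_self_sqrt (abs_nonneg _), hκS q hq, ← mul_assoc, hκ, one_mul]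
  have hρ0 : rhoUV s U V p ≠ 0 := by
    rw [hρ]
    exact (Real.sqrt_pos.2 (abs_pos.2 (hS0 p hp))).ne'
  rw [h.ricci_iff hW (hs.contDiffOn_Γ₁ hW) (hs.contDiffOn_Γ₂ hW) sx sy hx hy (S := S)
    (fun _ => rfl) hA hB hδ hp, mul_hess_sqrt hW hκ sρ hρS hp, mul_eq_zero,
    or_iff_right (mul_ne_zero four_ne_zero (pow_ne_zero 3 hρ0)), hypQ]
  simp only [pd_one_zero, pd_zero_one]

/-- Everything follows from `D xy = x + y + 1` with `D > 0`. If `x` and `y` have opposite signs,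
then `x + y + 1 < 0`. If both were negative, then `x + y + 1 > 0`, while `x + 1 = xA < 0` would
force `y > 0`. -/
theorem hyp_trichotomy {x y A B D : ℝ} (hA : 0 < A) (hx : x * (A - 1) = 1)
    (hy : y * (B - 1) = 1) (hD : 0 < D) (hAB : A * B - 1 = D) :
    (0 < x ∧ 0 < y) ∨ (0 < x ∧ x < -(y + 1)) ∨ (0 < y ∧ y < -(x + 1)) := by
  have h1 : x * A = x + 1 := by linear_combination hx
  have h2 : y * B = y + 1 := by linear_combination hy
  have h3 : D * (x * y) = x + y + 1 := by
    rw [← hAB]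
    linear_combination (y * B) * h1 + (x + 1) * h2
  have hx0 : x ≠ 0 := left_ne_zero_of_mul_eq_one hx
  have hy0 : y ≠ 0 := left_ne_zero_of_mul_eq_one hy
  rcases hx0.lt_or_gt with hx | hx <;> rcases hy0.lt_or_gt with hy | hy
  · exfalso
    nlinarith [mul_pos_of_neg_of_neg hx hy, mul_neg_of_neg_of_pos hx hA, 
      mul_pos hD (mul_pos_of_neg_of_neg hx hy)]
  · right; right
    refine ⟨hy, ?_⟩
    nlinarith [mul_pos hD (mul_pos (neg_pos.2 hx) hy)]
  · right; left
    refine ⟨hx, ?_⟩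
    nlinarith [mul_pos hD (mul_pos (neg_pos.2 hy) hx)]
  · exact Or.inl ⟨hx, hy⟩

theorem two_smul_sq_add_sq_apply {D D' : ℝ × ℝ →L[ℝ] ℝ × ℝ} {x : ℝ × ℝ} {a a' : ℝ}
    (h : D x = a • x) (h' : D' x = a' • x) :
    (2 : ℝ) • (D ^ 2 + D' ^ 2) x = (2 * (a * a + a' * a')) • x := by
  have e : (D ^ 2 + D' ^ 2) x = D (D x) + D' (D' x) := by rw [pow_two, pow_two]; rfl
  rw [e, h, h', map_smul, map_smul, h, h', smul_smul, smul_smul, ← add_smul, smul_smul]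

/-- Every admissible triple has an associated element of `C_s`. -/
theorem IsSurface.exists_hypCorr (hs : IsSurface s (I ×ˢ K)) (hI : IsOpen I)
    (hIc : I.OrdConnected) (hI0 : 0 ∈ I) (hK : IsOpen K) (hKc : K.OrdConnected) (hK0 : 0 ∈ K)
    (hJ : ∀ p ∈ I ×ˢ K, J p eu = eu ∧ J p ev = -ev) {T : Triple}
    (hT : IsAdmissible s J (I ×ˢ K) T) : ∃ UV ∈ hypC s I K, hypCorr s (I ×ˢ K) T UV := by
  have hW := hI.prod hK
  have hWc : IsPreconnected (I ×ˢ K) := hIc.isPreconnected.prod hKc.isPreconnected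
  obtain ⟨h1, h2⟩ := hT.hyp_diagonal hJ
  obtain ⟨hf, hr⟩ := (hs.hyp_admissible_iff hW hJ h1 h2).1 hT
  set a₁ : ℝ × ℝ → ℝ := fun p => (T.D₁ p eu).1
  set b₁ : ℝ × ℝ → ℝ := fun p => (T.D₁ p ev).2
  set a₂ : ℝ × ℝ → ℝ := fun p => (T.D₂ p eu).1
  set b₂ : ℝ × ℝ → ℝ := fun p => (T.D₂ p ev).2
  set x : ℝ × ℝ → ℝ := fun p => (a₁ p * a₁ p + a₂ p * a₂ p - 1)⁻¹
  set y : ℝ × ℝ → ℝ := fun p => (b₁ p * b₁ p + b₂ p * b₂ p - 1)⁻¹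
  have hA1 : ∀ p ∈ I ×ˢ K, a₁ p * a₁ p + a₂ p * a₂ p - 1 ≠ 0 := fun p hp =>
    sub_ne_zero.2 (hr p hp).2.2.1
  have hB1 : ∀ p ∈ I ×ˢ K, b₁ p * b₁ p + b₂ p * b₂ p - 1 ≠ 0 := fun p hp =>
    sub_ne_zero.2 (hr p hp).2.2.2
  have hxa : ∀ p ∈ I ×ˢ K, x p * (a₁ p * a₁ p + a₂ p * a₂ p - 1) = 1 := fun p hp =>
    inv_mul_cancel₀ (hA1 p hp)
  have hyb : ∀ p ∈ I ×ˢ K, y p * (b₁ p * b₁ p + b₂ p * b₂ p - 1) = 1 := fun p hp =>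
    inv_mul_cancel₀ (hB1 p hp)
  have sx : ContDiffOn ℝ ∞ x (I ×ˢ K) := (((hf.smooth_a₁.mul hf.smooth_a₁).add
    (hf.smooth_a₂.mul hf.smooth_a₂)).sub contDiffOn_const).inv hA1
  have sy : ContDiffOn ℝ ∞ y (I ×ˢ K) := (((hf.smooth_b₁.mul hf.smooth_b₁).add
    (hf.smooth_b₂.mul hf.smooth_b₂)).sub contDiffOn_const).inv hB1
  have hxv : ∀ p ∈ I ×ˢ K, pv x p = 2 * Γ₁ s p * x p := fun p hp => by
    rw [← pd_zero_one]; exact hf.pd_inv hW sx hxa hp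
  have hyu : ∀ p ∈ I ×ˢ K, pu y p = 2 * Γ₂ s p * y p := fun p hp => by
    rw [← pd_one_zero]; exact hf.swap.pd_inv hW sy hyb hp
  -- Since `x = 2φ^U` and the exponential factor is 1 on `v = 0`, `U` must be half the restriction
  -- of `x` to that line; similarly for `V`.
  set U : ℝ → ℝ := fun u => x (u, 0) / 2
  set V : ℝ → ℝ := fun v => y (0, v) / 2
  have hxU : ∀ p ∈ I ×ˢ K, x p = 2 * phiU s U p := fun p hp => by
    rw [eq_phiU hs hI hK hKc hK0 sx hxv hp]
    simp only [phiU, U]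
    ring
  have hyV : ∀ p ∈ I ×ˢ K, y p = 2 * phiV s V p := fun p hp => by
    rw [eq_phiV hs hI hK hIc hI0 sy hyu hp]
    simp only [phiV, V]
    ring
  have sU : ContDiffOn ℝ ∞ U I :=
    (sx.comp (f := fun u : ℝ => (u, (0 : ℝ))) (by fun_prop) fun u hu => ⟨hu, hK0⟩).div_const 2
  have sV : ContDiffOn ℝ ∞ V K :=
    (sy.comp (f := fun v : ℝ => ((0 : ℝ), v)) (by fun_prop) fun v hv => ⟨hI0, hv⟩).div_const 2
  refine ⟨(U, V), ⟨sU, sV, ?_, fun p hp => ?_⟩, fun p hp => ?_⟩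
  · have tri : ∀ p ∈ I ×ˢ K, (0 < x p ∧ 0 < y p) ∨ (0 < x p ∧ x p < -(y p + 1)) ∨
        (0 < y p ∧ y p < -(x p + 1)) := fun p hp =>
      hyp_trichotomy
        (add_pos_of_pos_of_nonneg (mul_self_pos.2 (left_ne_zero_of_mul_eq_one
          (by linear_combination 2 * hf.half₁ p hp : a₁ p * (2 * b₁ p) = 1))) (mul_self_nonneg _))
        (hxa p hp) (hyb p hp) (sq_pos_of_ne_zero (hr p hp).2.1) (hf.delta_sq hp).symm
    have x0 : ∀ p ∈ I ×ˢ K, x p ≠ 0 := fun p hp => left_ne_zero_of_mul_eq_one (hxa p hp)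
    have y0 : ∀ p ∈ I ×ˢ K, y p ≠ 0 := fun p hp => left_ne_zero_of_mul_eq_one (hyb p hp)
    -- The trichotomy is pointwise, whereas `C_s` asks for one alternative on the whole domain; the
    -- constant signs of `x` and `y` select it.
    rcases IsPreconnected.pos_or_neg hWc sx.continuousOn x0 with px | nx
    · rcases IsPreconnected.pos_or_neg hWc sy.continuousOn y0 with py | ny
      · exact Or.inl ⟨fun u hu => half_pos (px (u, 0) ⟨hu, hK0⟩),
          fun v hv => half_pos (py (0, v) ⟨hI0, hv⟩)⟩
      · refine Or.inr (Or.inl fun p hp => ?_)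
        rw [← hxU p hp, ← hyV p hp]
        rcases tri p hp with t | t | t
        · exact absurd t.2 (ny p hp).not_gt
        · exact t
        · exact absurd t.1 (ny p hp).not_gt
    · refine Or.inr (Or.inr fun p hp => ?_)
      rw [← hxU p hp, ← hyV p hp]
      rcases tri p hp with t | t | t
      · exact absurd t.1 (nx p hp).not_gt
      · exact absurd t.1 (nx p hp).not_gt
      · exact t
  · refine (hf.ricci_iff_hypQ hs hW hWc (contDiffOn_phiU hs hI hK hKc hK0 sU)
      (contDiffOn_phiV hs hI hK hIc hI0 sV) (fun q hq => ?_) (fun q hq => ?_)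
      (fun q hq => (hr q hq).2.1) hp).1 (hr p hp).1
    · rw [← hxU q hq, hxa q hq]
    · rw [← hyV q hq, hyb q hq]
  · have e1 := hxU p hp
    have e2 := hyV p hp
    simp only [x, y] at e1 e2
    have f1 : 1 / phiU s U p = 2 * (a₁ p * a₁ p + a₂ p * a₂ p - 1) := by
      rw [show phiU s U p = (a₁ p * a₁ p + a₂ p * a₂ p - 1)⁻¹ / 2 by rw [e1]; ring]
      field_simp
    have f2 : 1 / phiV s V p = 2 * (b₁ p * b₁ p + b₂ p * b₂ p - 1) := by
      rw [show phiV s V p = (b₁ p * b₁ p + b₂ p * b₂ p - 1)⁻¹ / 2 by rw [e2]; ring]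
      field_simp
    rw [two_smul_sq_add_sq_apply (h1 p hp).1 (h2 p hp).1,
      two_smul_sq_add_sq_apply (h1 p hp).2 (h2 p hp).2, f1, f2]
    constructor <;> congr 1 <;> simp only [a₁, a₂, b₁, b₂] <;> ring

end hyperbolic

/-- The converse of `IsFrame.pd_inv`: from the linear equation for `x` back to the one for `A = 1 +
1/x`. -/
theorem pd_one_add_inv {𝕜 : Type} [RCLike 𝕜] {W : Set (ℝ × ℝ)} {d : 𝕜 × 𝕜} {x f : ℝ × ℝ → 𝕜}
    {g : 𝕜} {p : ℝ × ℝ} (hW : IsOpen W) (hx : ContDiffOn ℝ ∞ x W) (hx0 : ∀ q ∈ W, x q ≠ 0)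
    (hp : p ∈ W) (hd : pd d x p = 2 * g * x p) (hf : ∀ q ∈ W, f q = 1 + (x q)⁻¹) :
    pd d f p = 2 * g * (1 - f p) := by
  have h := ((hasPd_const (c := d) (1 : 𝕜)).add
    ((hasPd_of_contDiffOn (c := d) hW hx hp).inv (hx0 p hp))).congr_on hW hp hf
  have := hx0 p hp
  rw [h.2, hd, hf p hp]
  field_simp
  ring

/-! ### Hyperbolic surfaces: from `C_s` back to triples, and uniqueness of the triple. -/

section hyperbolic

variable {n : ℕ} {s : ℝ × ℝ → Fin (n + 3) → ℝ} {J : ℝ × ℝ → ℝ × ℝ →L[ℝ] ℝ × ℝ}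
  {W : Set (ℝ × ℝ)} {I K : Set ℝ}

/-- The squares `a₁², a₂²` have sum `A` and product `A/(4B)`, so they are `(A/2)(1 ± q)` with `q =
√(1 - 1/(AB))`. From `A > 0` and `AB > 1` it follows that `0 < q < 1`: both roots are positive, and
all square roots are smooth. Then `b_i = 1/(2a_i)`. -/
theorem exists_frame_of_sq_add_sq {A B : ℝ × ℝ → ℝ} (sA : ContDiffOn ℝ ∞ A W)
    (sB : ContDiffOn ℝ ∞ B W) (hA : ∀ p ∈ W, 0 < A p) (hAB : ∀ p ∈ W, 1 < A p * B p) :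
    ∃ a₁ a₂ b₁ b₂ : ℝ × ℝ → ℝ, ContDiffOn ℝ ∞ a₁ W ∧ ContDiffOn ℝ ∞ a₂ W ∧ ContDiffOn ℝ ∞ b₁ W ∧
      ContDiffOn ℝ ∞ b₂ W ∧ ∀ p ∈ W, a₁ p * b₁ p = 1 / 2 ∧ a₂ p * b₂ p = 1 / 2 ∧
        a₁ p * a₁ p + a₂ p * a₂ p = A p ∧ b₁ p * b₁ p + b₂ p * b₂ p = B p := by
  set C : ℝ × ℝ → ℝ := fun p => 1 - (A p * B p)⁻¹
  have hC0 : ∀ p ∈ W, 0 < C p := fun p hp => sub_pos.2 (inv_lt_one_of_one_lt₀ (hAB p hp))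
  have hC1 : ∀ p ∈ W, C p < 1 := fun p hp =>
    sub_lt_self _ (inv_pos.2 (zero_lt_one.trans (hAB p hp)))
  have sC : ContDiffOn ℝ ∞ C W := contDiffOn_const.sub ((sA.mul sB).inv fun p hp =>
    (zero_lt_one.trans (hAB p hp)).ne')
  set q : ℝ × ℝ → ℝ := fun p => Real.sqrt (C p)
  have sq : ContDiffOn ℝ ∞ q W := sC.sqrt fun p hp => (hC0 p hp).ne'
  have hq0 : ∀ p ∈ W, 0 ≤ q p := fun p _ => Real.sqrt_nonneg _
  have hq1 : ∀ p ∈ W, q p < 1 := fun p hp => by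
    rw [Real.sqrt_lt' one_pos, one_pow]; exact hC1 p hp
  have hqq : ∀ p ∈ W, q p * q p = C p := fun p hp => Real.mul_self_sqrt (hC0 p hp).le
  have pos₁ : ∀ p ∈ W, 0 < A p / 2 * (1 + q p) := fun p hp =>
    mul_pos (half_pos (hA p hp)) (by linarith [hq0 p hp])
  have pos₂ : ∀ p ∈ W, 0 < A p / 2 * (1 - q p) := fun p hp =>
    mul_pos (half_pos (hA p hp)) (sub_pos.2 (hq1 p hp))
  set a₁ : ℝ × ℝ → ℝ := fun p => Real.sqrt (A p / 2 * (1 + q p))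
  set a₂ : ℝ × ℝ → ℝ := fun p => Real.sqrt (A p / 2 * (1 - q p))
  have h₁ : ∀ p ∈ W, a₁ p ≠ 0 := fun p hp => (Real.sqrt_pos.2 (pos₁ p hp)).ne'
  have h₂ : ∀ p ∈ W, a₂ p ≠ 0 := fun p hp => (Real.sqrt_pos.2 (pos₂ p hp)).ne'
  have s₁ : ContDiffOn ℝ ∞ a₁ W :=
    ((sA.div_const 2).mul (contDiffOn_const.add sq)).sqrt fun p hp => (pos₁ p hp).ne'
  have s₂ : ContDiffOn ℝ ∞ a₂ W :=
    ((sA.div_const 2).mul (contDiffOn_const.sub sq)).sqrt fun p hp => (pos₂ p hp).ne'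
  refine ⟨a₁, a₂, fun p => 1 / 2 * (a₁ p)⁻¹, fun p => 1 / 2 * (a₂ p)⁻¹, s₁, s₂,
    contDiffOn_const.mul (s₁.inv h₁), contDiffOn_const.mul (s₂.inv h₂), fun p hp => ?_⟩
  have n₁ := h₁ p hp
  have n₂ := h₂ p hp
  have e₁ : a₁ p * a₁ p = A p / 2 * (1 + q p) := Real.mul_self_sqrt (pos₁ p hp).le
  have e₂ : a₂ p * a₂ p = A p / 2 * (1 - q p) := Real.mul_self_sqrt (pos₂ p hp).le
  have hsum : a₁ p * a₁ p + a₂ p * a₂ p = A p := by rw [e₁, e₂]; ring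
  refine ⟨by field_simp, by field_simp, hsum, ?_⟩
  have e₃ : a₁ p * a₁ p * (a₂ p * a₂ p) * B p = A p / 4 := by
    have hAB0 : A p * B p ≠ 0 := (zero_lt_one.trans (hAB p hp)).ne'
    have hcc : (1 - q p * q p) * (A p * B p) = 1 := by
      rw [hqq p hp]
      simp only [C]
      rw [sub_sub_cancel, inv_mul_cancel₀ hAB0]
    rw [e₁, e₂]
    linear_combination A p / 4 * hcc
  have e₄ : B p = A p / 4 / (a₁ p * a₁ p * (a₂ p * a₂ p)) := by
    rw [eq_div_iff (mul_ne_zero (mul_ne_zero n₁ n₁) (mul_ne_zero n₂ n₂)), ← e₃]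
    ring
  rw [e₄, ← hsum]
  field_simp
  ring

/-- The converse of `hyp_trichotomy`, with `A = (x + 1)/x` and `AB - 1 = (x + y + 1)/(xy)`. -/
theorem one_add_inv_pos {x y : ℝ}
    (h : (0 < x ∧ 0 < y) ∨ (0 < x ∧ x < -(y + 1)) ∨ (0 < y ∧ y < -(x + 1))) :
    x ≠ 0 ∧ y ≠ 0 ∧ 0 < 1 + x⁻¹ ∧ 1 < (1 + x⁻¹) * (1 + y⁻¹) := by
  have key : x ≠ 0 ∧ y ≠ 0 ∧ 0 < (x + 1) / x ∧ 0 < (x + y + 1) / (x * y) := by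
    rcases h with ⟨hx, hy⟩ | ⟨hx, hy⟩ | ⟨hy, hx⟩
    · exact ⟨hx.ne', hy.ne', by positivity, by positivity⟩
    · have hy' : y < 0 := by linarith
      exact ⟨hx.ne', hy'.ne, by positivity,
        div_pos_of_neg_of_neg (by linarith) (mul_neg_of_pos_of_neg hx hy')⟩
    · have hx' : x < 0 := by linarith
      exact ⟨hx'.ne, hy.ne', div_pos_of_neg_of_neg (by linarith) hx',
        div_pos_of_neg_of_neg (by linarith) (mul_neg_of_neg_of_pos hx' hy)⟩
  obtain ⟨hx, hy, h1, h2⟩ := key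
  refine ⟨hx, hy, ?_, ?_⟩
  · rwa [show 1 + x⁻¹ = (x + 1) / x by field_simp]
  · rw [← sub_pos]
    rwa [show (1 + x⁻¹) * (1 + y⁻¹) - 1 = (x + y + 1) / (x * y) by field_simp; ring]

theorem one_div_of_two_mul {x φ A : ℝ} (h : x = 2 * φ) (hA : A = 1 + x⁻¹) : 1 / φ = 2 * (A - 1) := by
  rw [hA, h, add_sub_cancel_left, mul_inv, ← mul_assoc, mul_inv_cancel₀ two_ne_zero, one_mul,
    one_div]

/-- Every element of `C_s` comes from an admissible triple. -/
theorem IsSurface.exists_hypCorr_symm (hs : IsSurface s (I ×ˢ K)) (hI : IsOpen I)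
    (hIc : I.OrdConnected) (hI0 : 0 ∈ I) (hK : IsOpen K) (hKc : K.OrdConnected) (hK0 : 0 ∈ K)
    (hJ : ∀ p ∈ I ×ˢ K, J p eu = eu ∧ J p ev = -ev) {UV : (ℝ → ℝ) × (ℝ → ℝ)}
    (hUV : UV ∈ hypC s I K) : ∃ T, IsAdmissible s J (I ×ˢ K) T ∧ hypCorr s (I ×ˢ K) T UV := by
  have hW := hI.prod hK
  have hWc : IsPreconnected (I ×ˢ K) := hIc.isPreconnected.prod hKc.isPreconnected
  obtain ⟨U, V⟩ := UV
  obtain ⟨sU, sV, hpos, hQ⟩ := hUV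
  dsimp only at sU sV hpos hQ
  have sφ := contDiffOn_phiU hs hI hK hKc hK0 sU
  have sφ' := contDiffOn_phiV hs hI hK hIc hI0 sV
  set x : ℝ × ℝ → ℝ := fun p => 2 * phiU s U p with hxdef
  set y : ℝ × ℝ → ℝ := fun p => 2 * phiV s V p with hydef
  have sx : ContDiffOn ℝ ∞ x (I ×ˢ K) := contDiffOn_const.mul sφ
  have sy : ContDiffOn ℝ ∞ y (I ×ˢ K) := contDiffOn_const.mul sφ'
  have hpos' : ∀ p ∈ I ×ˢ K, x p ≠ 0 ∧ y p ≠ 0 ∧ 0 < 1 + (x p)⁻¹ ∧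
      1 < (1 + (x p)⁻¹) * (1 + (y p)⁻¹) := fun p hp => by
    apply one_add_inv_pos
    rcases hpos with h | h | h
    · exact Or.inl ⟨mul_pos two_pos (mul_pos (h.1 p.1 hp.1) (Real.exp_pos _)),
        mul_pos two_pos (mul_pos (h.2 p.2 hp.2) (Real.exp_pos _))⟩
    · exact Or.inr (Or.inl (h p hp))
    · exact Or.inr (Or.inr (h p hp))
  have hx0 : ∀ p ∈ I ×ˢ K, x p ≠ 0 := fun p hp => (hpos' p hp).1
  have hy0 : ∀ p ∈ I ×ˢ K, y p ≠ 0 := fun p hp => (hpos' p hp).2.1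
  obtain ⟨a₁, a₂, b₁, b₂, sa₁, sa₂, sb₁, sb₂, hab⟩ := exists_frame_of_sq_add_sq
    (contDiffOn_const.add (sx.inv hx0)) (contDiffOn_const.add (sy.inv hy0))
    (fun p hp => (hpos' p hp).2.2.1) (fun p hp => (hpos' p hp).2.2.2)
  have hA : ∀ p ∈ I ×ˢ K, a₁ p * a₁ p + a₂ p * a₂ p = 1 + (x p)⁻¹ := fun p hp => (hab p hp).2.2.1
  have hB : ∀ p ∈ I ×ˢ K, b₁ p * b₁ p + b₂ p * b₂ p = 1 + (y p)⁻¹ := fun p hp => (hab p hp).2.2.2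
  have hA0 : ∀ p ∈ I ×ˢ K, a₁ p * a₁ p + a₂ p * a₂ p ≠ 0 := fun p hp => by
    rw [hA p hp]; exact (hpos' p hp).2.2.1.ne'
  have hAB : ∀ p ∈ I ×ˢ K, 1 < (a₁ p * a₁ p + a₂ p * a₂ p) * (b₁ p * b₁ p + b₂ p * b₂ p) :=
    fun p hp => by rw [hA p hp, hB p hp]; exact (hpos' p hp).2.2.2
  have hB0 : ∀ p ∈ I ×ˢ K, b₁ p * b₁ p + b₂ p * b₂ p ≠ 0 := fun p hp =>
    right_ne_zero_of_mul (zero_lt_one.trans (hAB p hp)).ne'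
  have hf := exists_isFrame (c := ((1, 0) : ℝ × ℝ)) (d := (0, 1)) hW (hs.contDiffOn_Γ₁ hW)
    (hs.contDiffOn_Γ₂ hW) sa₁ sa₂ sb₁ sb₂ (fun p hp => (hab p hp).1) (fun p hp => (hab p hp).2.1)
    hA0 hB0
    (fun p hp => pd_one_add_inv hW sx hx0 hp (by
      rw [pd_zero_one, hxdef, ← pd_zero_one, ((hasPd_of_contDiffOn hW sφ hp).const_mul 2).2,
        pd_zero_one, pv_phiU hs hI hK hKc hK0 sU hp]; ring) hA)
    (fun p hp => pd_one_add_inv hW sy hy0 hp (by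
      rw [pd_one_zero, hydef, ← pd_one_zero, ((hasPd_of_contDiffOn hW sφ' hp).const_mul 2).2,
        pd_one_zero, pu_phiV hs hI hK hIc hI0 sV hp]; ring) hB)
  -- From here on only the frame equations matter, not the explicit components of the form.
  revert hf
  generalize (fun p => (b₂ p * pd ((1, 0) : ℝ × ℝ) b₁ p - b₁ p * pd ((1, 0) : ℝ × ℝ) b₂ p -
    (b₂ p * a₁ p - b₁ p * a₂ p) * Γ₂ s p) * (b₁ p * b₁ p + b₂ p * b₂ p)⁻¹) = ψ₁
  generalize (fun p => (a₂ p * pd ((0, 1) : ℝ × ℝ) a₁ p - a₁ p * pd ((0, 1) : ℝ × ℝ) a₂ p -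
    (a₂ p * b₁ p - a₁ p * b₂ p) * Γ₁ s p) * (a₁ p * a₁ p + a₂ p * a₂ p)⁻¹) = ψ₂
  intro hf
  set T : Triple :=
    ⟨fun p => (ContinuousLinearMap.fst ℝ ℝ ℝ).smulRight (a₁ p • eu) +
        (ContinuousLinearMap.snd ℝ ℝ ℝ).smulRight (b₁ p • ev),
      fun p => (ContinuousLinearMap.fst ℝ ℝ ℝ).smulRight (a₂ p • eu) +
        (ContinuousLinearMap.snd ℝ ℝ ℝ).smulRight (b₂ p • ev),
      fun p => (ContinuousLinearMap.fst ℝ ℝ ℝ).smulRight (ψ₁ p) +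
        (ContinuousLinearMap.snd ℝ ℝ ℝ).smulRight (ψ₂ p)⟩ with hT
  have h1 : ∀ p ∈ I ×ˢ K, T.D₁ p eu = a₁ p • eu ∧ T.D₁ p ev = b₁ p • ev := fun p _ => by
    simp [hT, eu, ev]
  have h2 : ∀ p ∈ I ×ˢ K, T.D₂ p eu = a₂ p • eu ∧ T.D₂ p ev = b₂ p • ev := fun p _ => by
    simp [hT, eu, ev]
  have hψ₁ : (fun p => T.ψ p eu) = ψ₁ := by ext p; simp [hT, eu]
  have hψ₂ : (fun p => T.ψ p ev) = ψ₂ := by ext p; simp [hT, ev]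
  have hxA : ∀ p ∈ I ×ˢ K, x p * (a₁ p * a₁ p + a₂ p * a₂ p - 1) = 1 := fun p hp => by
    rw [hA p hp, add_sub_cancel_left, mul_inv_cancel₀ (hx0 p hp)]
  have hyB : ∀ p ∈ I ×ˢ K, y p * (b₁ p * b₁ p + b₂ p * b₂ p - 1) = 1 := fun p hp => by
    rw [hB p hp, add_sub_cancel_left, mul_inv_cancel₀ (hy0 p hp)]
  have hδ : ∀ p ∈ I ×ˢ K, a₂ p * b₁ p - a₁ p * b₂ p ≠ 0 := fun p hp h0 => by
    have := hf.delta_sq hp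
    rw [h0] at this
    linarith [hAB p hp]
  refine ⟨T, (hs.hyp_admissible_iff hW hJ h1 h2).2 ⟨by rw [hψ₁, hψ₂]; exact hf, fun p hp =>
    ⟨?_, hδ p hp, ?_, ?_⟩⟩, fun p hp => ?_⟩
  · rw [hψ₁, hψ₂]
    exact (hf.ricci_iff_hypQ hs hW hWc sφ sφ' hxA hyB hδ hp).2 (hQ p hp)
  · exact sub_ne_zero.1 (right_ne_zero_of_mul_eq_one (hxA p hp))
  · exact sub_ne_zero.1 (right_ne_zero_of_mul_eq_one (hyB p hp))
  · rw [two_smul_sq_add_sq_apply (h1 p hp).1 (h2 p hp).1,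
      two_smul_sq_add_sq_apply (h1 p hp).2 (h2 p hp).2]
    dsimp only
    rw [one_div_of_two_mul (x := x p) rfl (hA p hp), one_div_of_two_mul (x := y p) rfl (hB p hp)]
    constructor <;> congr 1 <;> ring

theorem Triple.Equivalent.sq_add_sq {T T' : Triple} (h : T.Equivalent W T') {p : ℝ × ℝ}
    (hp : p ∈ W) : T'.D₁ p ^ 2 + T'.D₂ p ^ 2 = T.D₁ p ^ 2 + T.D₂ p ^ 2 := by
  obtain ⟨ε₁, ε₂, h1, h2, h⟩ := h
  have key : ∀ (ε : ℝ) (_ : ε = 1 ∨ ε = -1) (D : ℝ × ℝ →L[ℝ] ℝ × ℝ), (ε • D) ^ 2 = D ^ 2 := by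
    rintro ε (rfl | rfl) D <;> rw [smul_pow] <;> norm_num
  rcases h with h | h <;> obtain ⟨e1, e2, -⟩ := h p hp <;> rw [e1, e2, key _ h1, key _ h2]
  exact add_comm _ _

theorem eqOn_of_mul_exp_eq {x x' : ℝ} {e : ℝ} (h : 2 + 1 / (x * Real.exp e) =
    2 + 1 / (x' * Real.exp e)) : x = x' := by
  have h1 := add_left_cancel h
  -- Inversion is injective with the convention `0⁻¹ = 0` as well, so no nonvanishing is needed.
  rw [one_div, one_div, inv_inj] at h1
  exact mul_right_cancel₀ (Real.exp_ne_zero e) h1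

theorem smul_right_injective_eu : Function.Injective fun a : ℝ => a • eu := fun a b h => by
  simpa [eu] using h

theorem smul_right_injective_ev : Function.Injective fun a : ℝ => a • ev := fun a b h => by
  simpa [ev] using h

/-- Triples are equivalent if and only if they have the same element of `C_s`. -/
theorem IsSurface.hyp_equivalent_iff (hs : IsSurface s (I ×ˢ K)) (hI : IsOpen I)
    (hIc : I.OrdConnected) (hI0 : 0 ∈ I) (hK : IsOpen K) (hKc : K.OrdConnected) (hK0 : 0 ∈ K)
    (hJ : ∀ p ∈ I ×ˢ K, J p eu = eu ∧ J p ev = -ev) {T T' : Triple}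
    (hT : IsAdmissible s J (I ×ˢ K) T) (hT' : IsAdmissible s J (I ×ˢ K) T')
    {UV UV' : (ℝ → ℝ) × (ℝ → ℝ)} (h : hypCorr s (I ×ˢ K) T UV)
    (h' : hypCorr s (I ×ˢ K) T' UV') :
    T.Equivalent (I ×ˢ K) T' ↔ EqOn UV.1 UV'.1 I ∧ EqOn UV.2 UV'.2 K := by
  have hW := hI.prod hK
  have hWc : IsPreconnected (I ×ˢ K) := hIc.isPreconnected.prod hKc.isPreconnected
  constructor
  · intro he
    refine ⟨fun u hu => ?_, fun v hv => ?_⟩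
    · have hp : (u, (0 : ℝ)) ∈ I ×ˢ K := ⟨hu, hK0⟩
      have e1 := (h _ hp).1
      rw [← he.sq_add_sq hp, (h' _ hp).1] at e1
      exact (eqOn_of_mul_exp_eq (smul_right_injective_eu e1)).symm
    · have hp : ((0 : ℝ), v) ∈ I ×ˢ K := ⟨hI0, hv⟩
      have e1 := (h _ hp).2
      rw [← he.sq_add_sq hp, (h' _ hp).2] at e1
      exact (eqOn_of_mul_exp_eq (smul_right_injective_ev e1)).symm
  · intro he
    obtain ⟨d1, d2⟩ := hT.hyp_diagonal hJ
    obtain ⟨hf, hr⟩ := (hs.hyp_admissible_iff hW hJ d1 d2).1 hT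
    obtain ⟨d1', d2'⟩ := hT'.hyp_diagonal hJ
    obtain ⟨hf', -⟩ := (hs.hyp_admissible_iff hW hJ d1' d2').1 hT'
    have hpos : ∀ a b : ℝ, ∀ c : ℝ, a * c = 1 / 2 → a * a + b * b ≠ 0 := fun a b c h0 =>
      (add_pos_of_pos_of_nonneg (mul_self_pos.2 (fun ha => by simp [ha] at h0))
        (mul_self_nonneg _)).ne'
    have hAA : ∀ p ∈ I ×ˢ K, (T'.D₁ p eu).1 * (T'.D₁ p eu).1 + (T'.D₂ p eu).1 * (T'.D₂ p eu).1 =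
        (T.D₁ p eu).1 * (T.D₁ p eu).1 + (T.D₂ p eu).1 * (T.D₂ p eu).1 := by
      intro p hp
      have e1 := (h p hp).1
      have e2 := (h' p hp).1
      rw [two_smul_sq_add_sq_apply (d1 p hp).1 (d2 p hp).1] at e1
      rw [two_smul_sq_add_sq_apply (d1' p hp).1 (d2' p hp).1] at e2
      have e3 := smul_right_injective_eu e1
      have e4 := smul_right_injective_eu e2
      simp only [phiU, ← he.1 hp.1] at e3 e4
      linarith
    have hBB : ∀ p ∈ I ×ˢ K, (T'.D₁ p ev).2 * (T'.D₁ p ev).2 + (T'.D₂ p ev).2 * (T'.D₂ p ev).2 =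
        (T.D₁ p ev).2 * (T.D₁ p ev).2 + (T.D₂ p ev).2 * (T.D₂ p ev).2 := by
      intro p hp
      have e1 := (h p hp).2
      have e2 := (h' p hp).2
      rw [two_smul_sq_add_sq_apply (d1 p hp).2 (d2 p hp).2] at e1
      rw [two_smul_sq_add_sq_apply (d1' p hp).2 (d2' p hp).2] at e2
      have e3 := smul_right_injective_ev e1
      have e4 := smul_right_injective_ev e2
      simp only [phiV, ← he.2 hp.2] at e3 e4
      linarith
    obtain ⟨ε₁, ε₂, h1, h2, hε⟩ := hf.eq_up_to_sign hW hWc hf' hAA hBB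
      (fun p hp => hpos _ _ _ (hf.half₁ p hp))
      (fun p hp => hpos _ _ _ (hf.swap.half₁ p hp)) (fun p hp => (hr p hp).2.1)
    simp only [RCLike.ofReal_real_eq_id, id] at hε
    refine ⟨ε₁, ε₂, h1, h2, hε.imp (fun H p hp => ?_) fun H p hp => ?_⟩ <;>
    · obtain ⟨e1, e2, e3, e4, e5, e6⟩ := H p hp
      refine ⟨clm_ext_frame ?_ ?_, clm_ext_frame ?_ ?_, clm_ext_frame e5 e6⟩
      · rw [(d1' p hp).1, e1, _root_.smul_apply, mul_smul]
        first | rw [← (d1 p hp).1] | rw [← (d2 p hp).1]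
      · rw [(d1' p hp).2, e3, _root_.smul_apply, mul_smul]
        first | rw [← (d1 p hp).2] | rw [← (d2 p hp).2]
      · rw [(d2' p hp).1, e2, _root_.smul_apply, mul_smul]
        first | rw [← (d1 p hp).1] | rw [← (d2 p hp).1]
      · rw [(d2' p hp).2, e4, _root_.smul_apply, mul_smul]
        first | rw [← (d1 p hp).2] | rw [← (d2 p hp).2]

theorem InducesBijection.exists_iff {α β : Type} {P : α → Prop} {ra : α → α → Prop} {B : Set β}
    {rb : β → β → Prop} {R : α → β → Prop} (h : InducesBijection {a | P a} ra B rb R) :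
    (∃ a, P a) ↔ B.Nonempty :=
  ⟨fun ⟨a, ha⟩ => (h.1 a ha).imp fun _ hb => hb.1, fun ⟨b, hb⟩ => (h.2.1 b hb).imp fun _ ha => ha.1⟩

/-- The classes of admissible triples correspond to the elements of `C_s`. -/
theorem IsSurface.hyp_inducesBijection (hs : IsSurface s (I ×ˢ K)) (hI : IsOpen I)
    (hIc : I.OrdConnected) (hI0 : 0 ∈ I) (hK : IsOpen K) (hKc : K.OrdConnected) (hK0 : 0 ∈ K)
    (hJ : ∀ p ∈ I ×ˢ K, J p eu = eu ∧ J p ev = -ev) :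
    InducesBijection {T | IsAdmissible s J (I ×ˢ K) T} (Triple.Equivalent (I ×ˢ K))
      (hypC s I K) (fun UV UV' => EqOn UV.1 UV'.1 I ∧ EqOn UV.2 UV'.2 K)
      (hypCorr s (I ×ˢ K)) :=
  ⟨fun _ hT => hs.exists_hypCorr hI hIc hI0 hK hKc hK0 hJ hT,
    fun _ hUV => hs.exists_hypCorr_symm hI hIc hI0 hK hKc hK0 hJ hUV,
    fun _ hT _ hT' _ _ _ _ h h' => hs.hyp_equivalent_iff hI hIc hI0 hK hKc hK0 hJ hT hT' h h'⟩

end hyperbolic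

/-! ### The inhomogeneous Cauchy–Riemann equation -/

theorem fderiv_integral_param_apply {P E : Type} [NormedAddCommGroup P] [NormedSpace ℝ P]
    [NormedAddCommGroup E] [NormedSpace ℝ E] [CompleteSpace E] {F : P × ℝ → E}
    (hF : ContDiff ℝ ∞ F) (p x : P) :
    fderiv ℝ (fun p => ∫ s in (0 : ℝ)..1, F (p, s)) p x =
      ∫ s in (0 : ℝ)..1, fderiv ℝ (fun q => F (q, s)) p x := by
  have hc : Continuous fun s : ℝ => (fderiv ℝ F (p, s)).comp (ContinuousLinearMap.inl ℝ P ℝ) :=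
    ((hF.continuous_fderiv (by simp)).comp (by fun_prop)).clm_comp continuous_const
  rw [(hasFDerivAt_integral_param (W := univ) isOpen_univ (subset_univ _) hF.contDiffOn
    (mem_univ p)).fderiv, ContinuousLinearMap.intervalIntegral_apply (hc.intervalIntegrable _ _)]
  congr 1
  ext s
  have h : HasFDerivAt (fun q => F (q, s))
      ((fderiv ℝ F (p, s)).comp (ContinuousLinearMap.inl ℝ P ℝ)) p :=
    ((hF.differentiable (by simp) (p, s)).hasFDerivAt.comp p
      ((hasFDerivAt_id p).prodMk (hasFDerivAt_const s p)))
  rw [h.fderiv]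

theorem fderiv_integral_integral_param_apply {P E : Type} [NormedAddCommGroup P] [NormedSpace ℝ P]
    [NormedAddCommGroup E] [NormedSpace ℝ E] [CompleteSpace E] {F : (P × ℝ) × ℝ → E}
    (hF : ContDiff ℝ ∞ F) (p x : P) :
    fderiv ℝ (fun p => ∫ t in (0 : ℝ)..1, ∫ s in (0 : ℝ)..1, F ((p, t), s)) p x =
      ∫ t in (0 : ℝ)..1, ∫ s in (0 : ℝ)..1, fderiv ℝ (fun q => F ((q, t), s)) p x := by
  have h1 : ContDiff ℝ ∞ fun q : P × ℝ => ∫ s in (0 : ℝ)..1, F (q, s) :=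
    contDiffOn_univ.1 (contDiffOn_integral_param (W := univ) isOpen_univ isOpen_univ
      (subset_univ _) hF.contDiffOn)
  rw [fderiv_integral_param_apply h1 p x]
  refine intervalIntegral.integral_congr fun t _ => ?_
  exact fderiv_integral_param_apply (P := P) (F := fun q : P × ℝ => F ((q.1, t), q.2))
    (hF.comp (by fun_prop : ContDiff ℝ ∞ fun q : P × ℝ => ((q.1, t), q.2))) p x

/-- The unit vector at the angle `2πt`. -/
noncomputable def unitVec (t : ℝ) : ℝ × ℝ := (Real.cos (2 * Real.pi * t), Real.sin (2 * Real.pi * t))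

/-- The unit vector at the angle `2πt + π/2`. -/
noncomputable def unitVec' (t : ℝ) : ℝ × ℝ :=
  (-Real.sin (2 * Real.pi * t), Real.cos (2 * Real.pi * t))

/-- `e^{-2πit}`. -/
noncomputable def conjUnit (t : ℝ) : ℂ :=
  (Real.cos (2 * Real.pi * t) : ℂ) - Complex.I * (Real.sin (2 * Real.pi * t) : ℂ)

theorem contDiff_unitVec : ContDiff ℝ ∞ unitVec := by
  unfold unitVec; fun_prop

theorem continuous_unitVec' : Continuous unitVec' := by
  unfold unitVec'; fun_prop

theorem contDiff_conjUnit : ContDiff ℝ ∞ conjUnit := by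
  have h1 : ContDiff ℝ ∞ fun t : ℝ => Real.cos (2 * Real.pi * t) := by fun_prop
  have h2 : ContDiff ℝ ∞ fun t : ℝ => Real.sin (2 * Real.pi * t) := by fun_prop
  exact (Complex.ofRealCLM.contDiff.comp h1).sub
    (contDiff_const.mul (Complex.ofRealCLM.contDiff.comp h2))

theorem hasDerivAt_unitVec (t : ℝ) : HasDerivAt unitVec ((2 * Real.pi) • unitVec' t) t := by
  have h : HasDerivAt (fun t : ℝ => 2 * Real.pi * t) (2 * Real.pi) t := by
    simpa using (hasDerivAt_id t).const_mul (2 * Real.pi)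
  refine (h.cos.prodMk h.sin).congr_deriv ?_
  simp only [unitVec', Prod.smul_mk, smul_eq_mul]
  congr 1 <;> ring

theorem unitVec_one : unitVec 1 = unitVec 0 := by simp [unitVec]

/-- The Cauchy–Riemann operator in polar coordinates: radial derivative plus `i` times the
normalized angular derivative is `e^{-iθ}(∂_u + i∂_v)`. -/
theorem fderiv_unitVec (L : ℝ × ℝ →L[ℝ] ℂ) (t : ℝ) :
    L (unitVec t) + Complex.I * L (unitVec' t) = conjUnit t * (L eu + Complex.I * L ev) := by
  rw [eq_frame (unitVec t), eq_frame (unitVec' t)]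
  simp only [map_add, map_smul, unitVec, unitVec', conjUnit, Complex.real_smul]
  push_cast
  linear_combination (Complex.sin (2 * Real.pi * t) * L ev) * Complex.I_mul_I

/-- The solution of `w_{z̄} = f` given by convolution with the Cauchy kernel, in polar
coordinates. -/
noncomputable def cauchyTransform (R : ℝ) (f : ℝ × ℝ → ℂ) (p : ℝ × ℝ) : ℂ :=
  ∫ t in (0 : ℝ)..1, ∫ s in (0 : ℝ)..1, 2 * R * (conjUnit t * f (p - (R * s) • unitVec t))

section cauchy

variable {R : ℝ} {f : ℝ × ℝ → ℂ} (hf : ContDiff ℝ ∞ f)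
include hf

/-- The polar Jacobian cancels the singularity of the Cauchy kernel, leaving only `e^{-iθ}`. The
factor `2R` is `1/π` times `2π` from the angle `2πt` and `R` from the radius `Rs`. -/
theorem contDiff_cauchyTransform_integrand : ContDiff ℝ ∞ (fun q : ((ℝ × ℝ) × ℝ) × ℝ =>
    2 * R * (conjUnit q.1.2 * f (q.1.1 - (R * q.2) • unitVec q.1.2))) := by
  refine contDiff_const.mul ((contDiff_conjUnit.comp (by fun_prop)).mul (hf.comp ?_))
  exact (by fun_prop : ContDiff ℝ ∞ fun q : ((ℝ × ℝ) × ℝ) × ℝ => q.1.1).sub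
    ((by fun_prop : ContDiff ℝ ∞ fun q : ((ℝ × ℝ) × ℝ) × ℝ => R * q.2).smul
      (contDiff_unitVec.comp (by fun_prop)))

theorem contDiff_cauchyTransform_inner : ContDiff ℝ ∞ (fun q : (ℝ × ℝ) × ℝ =>
    ∫ s in (0 : ℝ)..1, 2 * R * (conjUnit q.2 * f (q.1 - (R * s) • unitVec q.2))) :=
  contDiffOn_univ.1 (contDiffOn_integral_param (W := univ) isOpen_univ isOpen_univ (subset_univ _)
    (contDiff_cauchyTransform_integrand hf).contDiffOn)

theorem contDiff_cauchyTransform : ContDiff ℝ ∞ (cauchyTransform R f) :=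
  contDiffOn_univ.1 (contDiffOn_integral_param (W := univ) isOpen_univ isOpen_univ (subset_univ _)
    (contDiff_cauchyTransform_inner hf).contDiffOn)

theorem fderiv_cauchyTransform (p x : ℝ × ℝ) : fderiv ℝ (cauchyTransform R f) p x =
    ∫ t in (0 : ℝ)..1, ∫ s in (0 : ℝ)..1,
      2 * R * (conjUnit t * fderiv ℝ f (p - (R * s) • unitVec t) x) := by
  have h := fderiv_integral_integral_param_apply (contDiff_cauchyTransform_integrand hf (R := R)) p x
  dsimp only at h
  unfold cauchyTransform
  rw [h]
  refine intervalIntegral.integral_congr fun t _ => intervalIntegral.integral_congr fun s _ => ?_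
  have h1 : HasFDerivAt (fun q => f (q - (R * s) • unitVec t))
      (fderiv ℝ f (p - (R * s) • unitVec t)) p :=
    ((hf.differentiable (by simp) (p - (R * s) • unitVec t)).hasFDerivAt.comp p
      ((hasFDerivAt_id p).sub_const ((R * s) • unitVec t))).congr_fderiv
        (ContinuousLinearMap.comp_id _)
  have h2 := ((h1.const_mul (conjUnit t)).const_mul (2 * R : ℂ)).fderiv
  simp only [h2]
  rfl

theorem integral_radial (p : ℝ × ℝ) (t : ℝ) :
    ∫ s in (0 : ℝ)..1, R * fderiv ℝ f (p - (R * s) • unitVec t) (unitVec t) =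
      f p - f (p - R • unitVec t) := by
  have hd : ∀ s : ℝ, HasDerivAt (fun s : ℝ => -f (p - (R * s) • unitVec t))
      (R * fderiv ℝ f (p - (R * s) • unitVec t) (unitVec t)) s := by
    intro s
    have h1 : HasDerivAt (fun s : ℝ => p - (R * s) • unitVec t) (-(R • unitVec t)) s := by
      simpa using ((((hasDerivAt_id s).const_mul R)).smul_const (unitVec t)).const_sub p
    refine ((hf.differentiable (by simp) _).hasFDerivAt.comp_hasDerivAt s h1).neg.congr_deriv ?_
    simp
  rw [intervalIntegral.integral_eq_sub_of_hasDerivAt (fun s _ => hd s)]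
  · simp
    ring
  · refine Continuous.intervalIntegrable ?_ _ _
    exact continuous_const.mul (((hf.continuous_fderiv (by simp)).comp
      (by fun_prop)).clm_apply continuous_const)

/-- Up to the nonzero constant `k`, the integrand is the derivative of `f` along a closed circle. -/
theorem integral_angular (hR : R ≠ 0) (p : ℝ × ℝ) {s : ℝ} (hs : s ≠ 0) :
    ∫ t in (0 : ℝ)..1, fderiv ℝ f (p - (R * s) • unitVec t) (unitVec' t) = 0 := by
  set k : ℂ := -((R * s * (2 * Real.pi) : ℝ) : ℂ)
  have hk : k ≠ 0 := by
    simp only [k, neg_ne_zero, ne_eq, Complex.ofReal_eq_zero]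
    exact mul_ne_zero (mul_ne_zero hR hs) Real.two_pi_pos.ne'
  have hd : ∀ t : ℝ, HasDerivAt (fun t : ℝ => f (p - (R * s) • unitVec t))
      (k * fderiv ℝ f (p - (R * s) • unitVec t) (unitVec' t)) t := by
    intro t
    have h1 : HasDerivAt (fun t : ℝ => p - (R * s) • unitVec t)
        (-((R * s) • (2 * Real.pi) • unitVec' t)) t := by
      simpa using ((hasDerivAt_unitVec t).const_smul (R * s)).const_sub p
    refine ((hf.differentiable (by simp) _).hasFDerivAt.comp_hasDerivAt t h1).congr_deriv ?_
    rw [map_neg, smul_smul, map_smul, Complex.real_smul, neg_mul]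
  have hi := intervalIntegral.integral_eq_sub_of_hasDerivAt (a := 0) (b := 1) (fun t _ => hd t) (by
    refine Continuous.intervalIntegrable ?_ _ _
    have := contDiff_unitVec.continuous
    have := continuous_unitVec'
    exact continuous_const.mul (((hf.continuous_fderiv (by simp)).comp
      (by fun_prop)).clm_apply (by fun_prop)))
  rw [unitVec_one, sub_self, intervalIntegral.integral_const_mul] at hi
  exact (mul_eq_zero.1 hi).resolve_left hk

/-- After differentiation under the integral, `∂_{z̄}` splits into a radial and an angular part. The
angular part integrates to zero on each circle; the radial part gives `f p` minus the values on the
circle of radius `R` about `p`, where `f` vanishes. -/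
theorem dzbar_cauchyTransform (hR : R ≠ 0) {p : ℝ × ℝ} (hp : ∀ t, f (p - R • unitVec t) = 0) :
    dzbar (cauchyTransform R f) p = f p := by
  have c1 := contDiff_unitVec.continuous
  have c2 := continuous_unitVec'
  have c3 := contDiff_conjUnit.continuous
  have c4 := hf.continuous_fderiv (by simp)
  set g₁ : ℝ → ℝ → ℂ := fun t s => fderiv ℝ f (p - (R * s) • unitVec t) (unitVec t) with hg₁
  set g₂ : ℝ → ℝ → ℂ := fun t s => fderiv ℝ f (p - (R * s) • unitVec t) (unitVec' t) with hg₂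
  have cg₁ : Continuous (Function.uncurry g₁) := by
    simp only [hg₁, Function.uncurry_def]
    exact (c4.comp (by fun_prop)).clm_apply (by fun_prop)
  have cg₂ : Continuous (Function.uncurry g₂) := by
    simp only [hg₂, Function.uncurry_def]
    exact (c4.comp (by fun_prop)).clm_apply (by fun_prop)
  have cf : ∀ x, Continuous (Function.uncurry fun t s : ℝ =>
      2 * R * (conjUnit t * fderiv ℝ f (p - (R * s) • unitVec t) x)) := by
    intro x
    simp only [Function.uncurry_def]
    exact continuous_const.mul ((c3.comp continuous_fst).mul
      ((c4.comp (by fun_prop)).clm_apply continuous_const))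
  have ii : ∀ {g : ℝ → ℝ → ℂ}, Continuous (Function.uncurry g) → ∀ t,
      IntervalIntegrable (g t) volume 0 1 := fun hg t =>
    (hg.comp (by fun_prop : Continuous fun s : ℝ => (t, s))).intervalIntegrable _ _
  have io : ∀ {g : ℝ → ℝ → ℂ}, Continuous (Function.uncurry g) →
      IntervalIntegrable (fun t => ∫ s in (0 : ℝ)..1, g t s) volume 0 1 := fun hg =>
    (intervalIntegral.continuous_parametric_intervalIntegral_of_continuous' hg 0 1
      ).intervalIntegrable _ _
  have e1 : dzbar (cauchyTransform R f) p = ∫ t in (0 : ℝ)..1, ∫ s in (0 : ℝ)..1,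
      (R * g₁ t s + R * Complex.I * g₂ t s) := by
    rw [dzbar, pu, pv, fderiv_cauchyTransform hf, fderiv_cauchyTransform hf,
      ← intervalIntegral.integral_const_mul, ← intervalIntegral.integral_add (io (cf eu))
      ((io (cf ev)).const_mul _), ← intervalIntegral.integral_div]
    congr 1
    ext t
    rw [← intervalIntegral.integral_const_mul, ← intervalIntegral.integral_add (ii (cf eu) t)
      ((ii (cf ev) t).const_mul _), ← intervalIntegral.integral_div]
    congr 1
    ext s
    have := fderiv_unitVec (fderiv ℝ f (p - (R * s) • unitVec t)) t
    simp only [hg₁, hg₂]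
    linear_combination -(R : ℂ) * this
  have e2 : ∫ t in (0 : ℝ)..1, ∫ s in (0 : ℝ)..1, R * g₁ t s = f p := by
    simp only [hg₁, integral_radial hf, hp, sub_zero, intervalIntegral.integral_const]
    simp
  -- Fubini makes the angular integral the inner one. The degenerate circle `s = 0` is excluded
  -- because the interval is open at 0.
  have e3 : ∫ t in (0 : ℝ)..1, ∫ s in (0 : ℝ)..1, g₂ t s = 0 := by
    rw [intervalIntegral_intervalIntegral_swap]
    · refine intervalIntegral.integral_zero_ae (ae_of_all _ fun s hs => ?_)
      rw [uIoc_of_le zero_le_one] at hs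
      exact integral_angular hf hR p hs.1.ne'
    · exact (cg₂.continuousOn.integrableOn_compact (isCompact_uIcc.prod isCompact_uIcc)).mono_set
        (prod_mono uIoc_subset_uIcc uIoc_subset_uIcc)
  have cR₁ : Continuous (Function.uncurry fun t s => R * g₁ t s) := by
    simp only [Function.uncurry_def] at cg₁ ⊢
    exact continuous_const.mul cg₁
  have cR₂ : Continuous (Function.uncurry fun t s => R * Complex.I * g₂ t s) := by
    simp only [Function.uncurry_def] at cg₂ ⊢
    exact continuous_const.mul cg₂
  rw [e1]
  simp only [fun t => intervalIntegral.integral_add (ii cR₁ t) (ii cR₂ t)]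
  rw [intervalIntegral.integral_add (io cR₁) (io cR₂), e2]
  simp only [intervalIntegral.integral_const_mul, e3, mul_zero, add_zero]

end cauchy

/-! ### Complex notation in the coordinate plane -/

/-- The complex coordinate `z = u + iv` as a real-linear isomorphism. -/
noncomputable def toCL : (ℝ × ℝ) ≃L[ℝ] ℂ := Complex.equivRealProdCLM.symm

theorem coe_toCL : (toCL : ℝ × ℝ → ℂ) = toC := by
  ext p
  apply Complex.ext <;> simp [toCL, toC]

theorem toC_eu : toC eu = 1 := by apply Complex.ext <;> simp [toC, eu]

theorem toC_ev : toC ev = Complex.I := by apply Complex.ext <;> simp [toC, ev]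

theorem contDiff_toC : ContDiff ℝ ∞ toC := coe_toCL ▸ toCL.contDiff

theorem hasFDerivAt_toC (p : ℝ × ℝ) : HasFDerivAt toC (toCL : (ℝ × ℝ) →L[ℝ] ℂ) p :=
  coe_toCL ▸ toCL.hasFDerivAt

theorem isOpen_disc (r : ℝ) : IsOpen (disc r) :=
  Metric.isOpen_ball.preimage contDiff_toC.continuous

theorem mem_disc_iff {r : ℝ} {p : ℝ × ℝ} : p ∈ disc r ↔ ‖toC p‖ < r := by
  simp [disc]

theorem disc_mono {r r' : ℝ} (h : r ≤ r') : disc r ⊆ disc r' := fun _ hp =>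
  mem_disc_iff.2 ((mem_disc_iff.1 hp).trans_le h)

theorem isPreconnected_disc (r : ℝ) : IsPreconnected (disc r) := by
  have : disc r = toCL ⁻¹' Metric.ball 0 r := by rw [coe_toCL]; rfl
  rw [this]
  exact ((convex_ball (0 : ℂ) r).linear_preimage ((toCL : (ℝ × ℝ) →L[ℝ] ℂ) : (ℝ × ℝ) →ₗ[ℝ] ℂ)).isPreconnected

theorem pd_dzbar (f : ℝ × ℝ → ℂ) : pd ((1 / 2, Complex.I / 2) : ℂ × ℂ) f = dzbar f := by
  ext p
  simp only [pd, dzbar]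
  ring

theorem pd_dz (f : ℝ × ℝ → ℂ) : pd ((1 / 2, -(Complex.I / 2)) : ℂ × ℂ) f = dz f := by
  ext p
  simp only [pd, dz]
  ring

theorem dzbar_comp_toC {F : ℂ → ℂ} {p : ℝ × ℝ} (hF : DifferentiableAt ℂ F (toC p)) :
    DifferentiableAt ℝ (fun q => F (toC q)) p ∧ dzbar (fun q => F (toC q)) p = 0 := by
  have h := (hF.restrictScalars ℝ).hasFDerivAt.comp p (hasFDerivAt_toC p)
  refine ⟨h.differentiableAt, ?_⟩
  have h' : fderiv ℝ (fun q => F (toC q)) p = _ := h.fderiv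
  have e := (differentiableAt_complex_iff_differentiableAt_real.1 hF).2
  have e1 : toCL eu = 1 := by rw [coe_toCL, toC_eu]
  have e2 : toCL ev = Complex.I := by rw [coe_toCL, toC_ev]
  simp only [dzbar, pu, pv, h', ContinuousLinearMap.comp_apply, ContinuousLinearEquiv.coe_coe, e1,
    e2, e, smul_eq_mul, ← mul_assoc, Complex.I_mul_I]
  ring

theorem differentiableOn_of_dzbar_eq_zero {f : ℝ × ℝ → ℂ} {r : ℝ}
    (hf : ∀ p ∈ disc r, DifferentiableAt ℝ f p) (h : ∀ p ∈ disc r, dzbar f p = 0) :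
    DifferentiableOn ℂ (fun z : ℂ => f (z.re, z.im)) (Metric.ball 0 r) := by
  intro z hz
  apply DifferentiableAt.differentiableWithinAt
  have hp : (z.re, z.im) ∈ disc r := hz
  have hd : HasFDerivAt (fun z : ℂ => (z.re, z.im)) (toCL.symm : ℂ →L[ℝ] ℝ × ℝ) z :=
    toCL.symm.hasFDerivAt
  have h1 : HasFDerivAt (fun z : ℂ => f (z.re, z.im)) _ z := (hf _ hp).hasFDerivAt.comp z hd
  rw [differentiableAt_complex_iff_differentiableAt_real]
  refine ⟨h1.differentiableAt, ?_⟩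
  have e1 : toCL.symm 1 = eu := by rw [← toC_eu, ← coe_toCL, toCL.symm_apply_apply]
  have e2 : toCL.symm Complex.I = ev := by rw [← toC_ev, ← coe_toCL, toCL.symm_apply_apply]
  have h2 := h _ hp
  rw [dzbar, div_eq_zero_iff, or_iff_left two_ne_zero] at h2
  simp only [h1.fderiv, ContinuousLinearMap.comp_apply, ContinuousLinearEquiv.coe_coe, e1, e2,
    smul_eq_mul]
  simp only [pu, pv] at h2
  linear_combination (-Complex.I) * h2 + fderiv ℝ f (z.re, z.im) ev * Complex.I_mul_I

theorem contDiffOn_comp_toC {F : ℂ → ℂ} {r : ℝ} (hF : DifferentiableOn ℂ F (Metric.ball 0 r)) :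
    ContDiffOn ℝ ∞ (fun p => F (toC p)) (disc r) :=
  ((hF.contDiffOn Metric.isOpen_ball).restrict_scalars ℝ).comp contDiff_toC.contDiffOn
    fun _ hp => hp

/-- Partial sums of the power series at 0 converge uniformly on smaller discs. These polynomials
supply the corrections in the Mittag-Leffler argument. -/
theorem exists_entire_approx {h : ℂ → ℂ} {R R' ε : ℝ} (hR : 0 < R) (hRR : R < R')
    (hh : DifferentiableOn ℂ h (Metric.ball 0 R')) (hε : 0 < ε) :
    ∃ P : ℂ → ℂ, Differentiable ℂ P ∧ ∀ z ∈ Metric.ball (0 : ℂ) R, ‖h z - P z‖ ≤ ε := by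
  obtain ⟨m, hm1, hm2⟩ := exists_between hRR
  lift m to NNReal using (hR.trans hm1).le
  lift R to NNReal using hR.le
  have hp := DifferentiableOn.hasFPowerSeriesOnBall (hh.mono (Metric.closedBall_subset_ball hm2))
    (by exact_mod_cast hR.trans hm1)
  have hu := hp.tendstoUniformlyOn (r' := R) (by exact_mod_cast hm1)
  obtain ⟨n, hn⟩ := (Metric.tendstoUniformlyOn_iff.1 hu ε hε).exists
  refine ⟨(cauchyPowerSeries h 0 m).partialSum n, ?_, fun z hz => ?_⟩
  · unfold FormalMultilinearSeries.partialSum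
    refine Differentiable.fun_sum fun i _ => ?_
    simp only [FormalMultilinearSeries.apply_eq_pow_smul_coeff]
    fun_prop
  · have := hn z hz
    rw [zero_add, dist_eq_norm] at this
    exact this.le

/-! ### Solving the Cauchy–Riemann equation on a disc -/

theorem exists_cutoff {a b : ℝ} (ha : 0 < a) (hab : a < b) : ∃ χ : ℝ × ℝ → ℝ, ContDiff ℝ ∞ χ ∧
    (∀ p ∈ disc a, χ p = 1) ∧ ∀ p, b ≤ ‖toC p‖ → χ p = 0 := by
  have hab2 : 0 < b ^ 2 - a ^ 2 := by nlinarith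
  have hn : ∀ p, ‖toC p‖ ^ 2 = p.1 ^ 2 + p.2 ^ 2 := fun p => by
    rw [Complex.sq_norm, Complex.normSq_apply]; simp only [toC]; ring
  refine ⟨fun p => Real.smoothTransition ((b ^ 2 - (p.1 ^ 2 + p.2 ^ 2)) / (b ^ 2 - a ^ 2)),
    Real.smoothTransition.contDiff.comp (by fun_prop), fun p hp => ?_, fun p hp => ?_⟩
  · apply Real.smoothTransition.one_of_one_le
    rw [one_le_div hab2, ← hn]
    have := mem_disc_iff.1 hp
    nlinarith [norm_nonneg (toC p)]
  · apply Real.smoothTransition.zero_of_nonpos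
    rw [← hn]
    exact div_nonpos_of_nonpos_of_nonneg (by nlinarith [norm_nonneg (toC p)]) hab2.le

theorem norm_toC_unitVec (t : ℝ) : ‖toC (unitVec t)‖ = 1 := by
  rw [← sq_eq_sq₀ (norm_nonneg _) zero_le_one, Complex.sq_norm, Complex.normSq_apply]
  simp only [toC, unitVec]
  linear_combination Real.cos_sq_add_sin_sq (2 * Real.pi * t)

theorem exists_dzbar_eq_on_smaller_disc {r R : ℝ} (hR : 0 < R) (hRr : R < r) {g : ℝ × ℝ → ℂ}
    (hg : ContDiffOn ℝ ∞ g (disc r)) :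
    ∃ w : ℝ × ℝ → ℂ, ContDiff ℝ ∞ w ∧ ∀ p ∈ disc R, dzbar w p = g p := by
  obtain ⟨b, hRb, hbr⟩ := exists_between hRr
  obtain ⟨χ, hχ, h1, h0⟩ := exists_cutoff hR hRb
  set f : ℝ × ℝ → ℂ := fun p => χ p • g p with hf
  have sf : ContDiff ℝ ∞ f := by
    rw [contDiff_iff_contDiffAt]
    intro p
    by_cases hp : p ∈ disc r
    · exact hχ.contDiffAt.smul (hg.contDiffAt ((isOpen_disc r).mem_nhds hp))
    · have ho : IsOpen {q : ℝ × ℝ | b < ‖toC q‖} :=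
        isOpen_lt continuous_const contDiff_toC.continuous.norm
      have hpb : p ∈ {q : ℝ × ℝ | b < ‖toC q‖} :=
        hbr.trans_le (not_lt.1 (mt mem_disc_iff.2 hp))
      exact contDiffAt_const (c := (0 : ℂ)) |>.congr_of_eventuallyEq
        (eventually_of_mem (ho.mem_nhds hpb) fun q hq => by
          simp only [hf, h0 q (le_of_lt hq), zero_smul])
  -- For `|p| < R < r` the circle of radius `2r` about `p` stays at distance more than `r > b` from
  -- 0, where the cut-off function vanishes.
  refine ⟨cauchyTransform (2 * r) f, contDiff_cauchyTransform sf, fun p hp => ?_⟩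
  rw [dzbar_cauchyTransform sf (by linarith : 2 * r ≠ 0), hf]
  · simp only [h1 p hp, one_smul]
  · intro t
    have hb : b ≤ ‖toC (p - (2 * r) • unitVec t)‖ := by
      have e : toC (p - (2 * r) • unitVec t) = toC p - (2 * r) • toC (unitVec t) := by
        rw [← coe_toCL, map_sub, map_smul]
      have h2 := norm_sub_norm_le ((2 * r) • toC (unitVec t)) (toC p)
      rw [norm_sub_rev, ← e, norm_smul, norm_toC_unitVec, Real.norm_of_nonneg (by linarith)] at h2
      linarith [mem_disc_iff.1 hp]
    simp only [hf, h0 _ hb, zero_smul]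

/-- The inhomogeneous Cauchy–Riemann equation is solvable on a disc. -/
theorem exists_dzbar_eq {r : ℝ} (hr : 0 < r) {g : ℝ × ℝ → ℂ} (hg : ContDiffOn ℝ ∞ g (disc r)) :
    ∃ w : ℝ × ℝ → ℂ, ContDiffOn ℝ ∞ w (disc r) ∧ ∀ p ∈ disc r, dzbar w p = g p := by
  obtain ⟨R, hmono, hRmem, hRlim⟩ := exists_seq_strictMono_tendsto' hr
  have hR0 : ∀ n, 0 < R n := fun n => (hRmem n).1
  have hRr : ∀ n, R n < r := fun n => (hRmem n).2
  choose w sw hw using fun n => exists_dzbar_eq_on_smaller_disc (hR0 (n + 1)) (hRr (n + 1)) hg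
  have dw : ∀ n p, DifferentiableAt ℝ (w n) p := fun n p => (sw n).differentiable (by simp) p
  have hhol : ∀ n, DifferentiableOn ℂ (fun z : ℂ => w (n + 1) (z.re, z.im) - w n (z.re, z.im))
      (Metric.ball 0 (R (n + 1))) := fun n => by
    refine differentiableOn_of_dzbar_eq_zero (f := fun p => w (n + 1) p - w n p)
      (fun p _ => (dw (n + 1) p).sub (dw n p)) fun p hp => ?_
    have h := (DifferentiableAt.hasPd (c := (1 / 2, Complex.I / 2)) (dw (n + 1) p)).sub
      (DifferentiableAt.hasPd (dw n p))
    rw [← pd_dzbar, h.2, pd_dzbar, pd_dzbar, hw n p hp,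
      hw (n + 1) p (disc_mono (hmono (Nat.lt_succ_self _)).le hp), sub_self]
  -- Consecutive solutions differ by a holomorphic function on the disc of radius `R (n + 1)`.
  -- Subtracting an entire function within `2⁻ⁿ` of it on the disc of radius `R n` leaves a locally
  -- summable remainder.
  choose P hP hPt using fun n => exists_entire_approx (hR0 n) (hmono (Nat.lt_succ_self n)) (hhol n)
    (pow_pos one_half_pos n)
  set t : ℕ → ℂ → ℂ := fun n z => w (n + 1) (z.re, z.im) - w n (z.re, z.im) - P n z with ht
  set W : ℝ × ℝ → ℂ := fun p => w 0 p + ∑' n, t n (toC p) with hW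
  -- The first `N` terms telescope to `w N - w 0` up to entire functions, and the tail is a uniform
  -- limit of holomorphic functions. So `W` differs from the solution `w N` by a holomorphic
  -- function and inherits its smoothness and its equation.
  have key : ∀ N, ∃ H : ℂ → ℂ, DifferentiableOn ℂ H (Metric.ball 0 (R N)) ∧
      ∀ p ∈ disc (R N), W p = w N p + H (toC p) := by
    intro N
    have hb : ∀ n z, z ∈ Metric.ball (0 : ℂ) (R N) → ‖t (n + N) z‖ ≤ (1 / 2) ^ (n + N) :=
      fun n z hz => hPt (n + N) z
        (Metric.ball_subset_ball (hmono.monotone (Nat.le_add_left N n)) hz)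
    have hsum : Summable fun n : ℕ => (1 / 2 : ℝ) ^ (n + N) :=
      (summable_nat_add_iff N).2 summable_geometric_two
    refine ⟨fun z => ∑' n, t (n + N) z - ∑ n ∈ Finset.range N, P n z,
      (Complex.differentiableOn_tsum_of_summable_norm hsum (fun n => ?_) Metric.isOpen_ball hb).sub
        (DifferentiableOn.fun_sum fun n _ => (hP n).differentiableOn), fun p hp => ?_⟩
    · exact ((hhol (n + N)).mono (Metric.ball_subset_ball
        (hmono.monotone (by omega)))).sub (hP _).differentiableOn
    · have hs : Summable fun n => t n (toC p) :=
        (summable_nat_add_iff N).1 (Summable.of_norm_bounded hsum fun n => hb n _ hp)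
      have h1 : ∑ n ∈ Finset.range N, t n (toC p) =
          w N p - w 0 p - ∑ n ∈ Finset.range N, P n (toC p) := by
        have e := Finset.sum_range_sub (fun n => w n p) N
        rw [← e, ← Finset.sum_sub_distrib]
        rfl
      rw [hW]
      simp only
      rw [← hs.sum_add_tsum_nat_add N, h1]
      ring
  have hloc : ∀ p ∈ disc r, ∃ N, p ∈ disc (R N) := fun p hp => by
    obtain ⟨N, hN⟩ := (hRlim.eventually (lt_mem_nhds (mem_disc_iff.1 hp))).exists
    exact ⟨N, mem_disc_iff.2 hN⟩
  refine ⟨W, fun p hp => ?_, fun p hp => ?_⟩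
  · obtain ⟨N, hN⟩ := hloc p hp
    obtain ⟨H, hH, hWH⟩ := key N
    exact ((((sw N).contDiffOn.add (contDiffOn_comp_toC hH)).congr hWH).contDiffAt
      ((isOpen_disc _).mem_nhds hN)).contDiffWithinAt
  · obtain ⟨N, hN⟩ := hloc p hp
    obtain ⟨H, hH, hWH⟩ := key N
    obtain ⟨d1, d2⟩ := dzbar_comp_toC (hH.differentiableAt (Metric.isOpen_ball.mem_nhds hN))
    have h := ((DifferentiableAt.hasPd (c := (1 / 2, Complex.I / 2)) (dw N p)).add
      (DifferentiableAt.hasPd d1)).congr_on (isOpen_disc _)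
      hN hWH
    rw [← pd_dzbar, h.2, pd_dzbar, pd_dzbar, d2, add_zero,
      hw N p (disc_mono (hmono (Nat.lt_succ_self N)).le hN)]

/-! ### Solutions of `φ_{z̄} = 2Γφ` -/

section solution

variable {n : ℕ} {s : ℝ × ℝ → Fin (n + 3) → ℝ} {W : Set (ℝ × ℝ)} {r : ℝ}

theorem HasPd.cexp {c : ℂ × ℂ} {f : ℝ × ℝ → ℂ} {f' : ℂ} {p : ℝ × ℝ} (hf : HasPd c f f' p) :
    HasPd c (fun q => Complex.exp (f q)) (Complex.exp (f p) * f') p := by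
  have h : HasFDerivAt (fun q => Complex.exp (f q)) (Complex.exp (f p) • fderiv ℝ f p) p :=
    hf.1.hasFDerivAt.cexp
  refine ⟨h.differentiableAt, ?_⟩
  rw [← hf.2]
  simp only [pd, pu, pv, h.fderiv, _root_.smul_apply, smul_eq_mul]
  ring

theorem IsSurface.contDiffOn_Γc (hs : IsSurface s W) (hW : IsOpen W) : ContDiffOn ℝ ∞ (Γc s) W := by
  have h1 : ∀ x y, ContDiffOn ℝ ∞ (fun p => (((christoffel s p x y).1 : ℝ) : ℂ)) W := fun x y =>
    Complex.ofRealCLM.contDiff.comp_contDiffOn (hs.contDiffOn_christoffel hW x y).fst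
  have h2 : ∀ x y, ContDiffOn ℝ ∞ (fun p => (((christoffel s p x y).2 : ℝ) : ℂ)) W := fun x y =>
    Complex.ofRealCLM.contDiff.comp_contDiffOn (hs.contDiffOn_christoffel hW x y).snd
  unfold Γc onDzDzbar
  exact ((((h1 _ _).add (contDiffOn_const.mul (h1 _ _))).sub
    (contDiffOn_const.mul (h1 _ _))).add (h1 _ _)).div_const 4 |>.add
    (contDiffOn_const.mul (((((h2 _ _).add (contDiffOn_const.mul (h2 _ _))).sub
    (contDiffOn_const.mul (h2 _ _))).add (h2 _ _)).div_const 4))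

/-- Take the exponential of a solution of `w_{z̄} = 2Γ`. -/
theorem IsSurface.exists_isNormalization (hr : 0 < r) (hs : IsSurface s (disc r)) :
    ∃ φ₀, IsNormalization s (disc r) φ₀ := by
  obtain ⟨w, sw, hw⟩ := exists_dzbar_eq hr
    ((contDiffOn_const (c := (2 : ℂ))).mul (hs.contDiffOn_Γc (isOpen_disc r)))
  refine ⟨fun p => Complex.exp (w p), ⟨sw.cexp, fun p hp => ?_⟩, fun p _ => Complex.exp_ne_zero _⟩
  rw [← pd_dzbar, (hasPd_of_contDiffOn (isOpen_disc r) sw hp).cexp.2, pd_dzbar, hw p hp]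
  ring

/-- The quotient `φ/φ₀` satisfies the Cauchy–Riemann equation. Only differentiability of `φ` is
required, so smoothness of solutions comes as a consequence. -/
theorem IsNormalization.exists_eq_phiZeta {φ₀ : ℝ × ℝ → ℂ} (h₀ : IsNormalization s (disc r) φ₀)
    {φ : ℝ × ℝ → ℂ} (hd : ∀ p ∈ disc r, DifferentiableAt ℝ φ p)
    (hφ : ∀ p ∈ disc r, dzbar φ p = 2 * Γc s p * φ p) :
    ∃ ζ : ℂ → ℂ, DifferentiableOn ℂ ζ (Metric.ball 0 r) ∧ EqOn φ (phiZeta φ₀ ζ) (disc r) := by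
  have hq : ∀ p ∈ disc r, HasPd ((1 / 2, Complex.I / 2) : ℂ × ℂ) (fun q => φ q * (φ₀ q)⁻¹) 0 p := by
    intro p hp
    have hne := h₀.2 p hp
    have h := (DifferentiableAt.hasPd (c := ((1 / 2, Complex.I / 2) : ℂ × ℂ)) (hd p hp)).mul
      ((hasPd_of_contDiffOn (c := ((1 / 2, Complex.I / 2) : ℂ × ℂ)) (isOpen_disc r)
        h₀.1.1 hp).inv hne)
    refine ⟨h.1, h.2.trans ?_⟩
    rw [pd_dzbar, pd_dzbar, hφ p hp, h₀.1.2 p hp]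
    field_simp
    ring
  refine ⟨fun z => φ (z.re, z.im) * (φ₀ (z.re, z.im))⁻¹,
    differentiableOn_of_dzbar_eq_zero (f := fun q => φ q * (φ₀ q)⁻¹) (fun p hp => (hq p hp).1)
      (fun p hp => by rw [← pd_dzbar]; exact (hq p hp).2), fun p hp => ?_⟩
  change φ p = φ p * (φ₀ p)⁻¹ * φ₀ p
  rw [mul_assoc, inv_mul_cancel₀ (h₀.2 p hp), mul_one]

theorem IsNormalization.isSolution_phiZeta {φ₀ : ℝ × ℝ → ℂ} (h₀ : IsNormalization s (disc r) φ₀)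
    {ζ : ℂ → ℂ} (hζ : DifferentiableOn ℂ ζ (Metric.ball 0 r)) :
    IsSolution s (disc r) (phiZeta φ₀ ζ) := by
  refine ⟨(contDiffOn_comp_toC hζ).mul h₀.1.1, fun p hp => ?_⟩
  obtain ⟨d1, d2⟩ := dzbar_comp_toC (hζ.differentiableAt (Metric.isOpen_ball.mem_nhds hp))
  have h := (DifferentiableAt.hasPd (c := ((1 / 2, Complex.I / 2) : ℂ × ℂ)) d1).mul
    (hasPd_of_contDiffOn (c := ((1 / 2, Complex.I / 2) : ℂ × ℂ)) (isOpen_disc r) h₀.1.1 hp)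
  have h2 := h.2
  rw [pd_dzbar, pd_dzbar, pd_dzbar, d2, h₀.1.2 p hp] at h2
  refine Eq.trans h2 ?_
  simp only [phiZeta]
  ring

theorem IsSolution.congr {φ φ' : ℝ × ℝ → ℂ} (hW : IsOpen W) (h : IsSolution s W φ)
    (he : EqOn φ' φ W) : IsSolution s W φ' := by
  refine ⟨h.1.congr he, fun p hp => ?_⟩
  have h1 := (hasPd_of_contDiffOn (c := ((1 / 2, Complex.I / 2) : ℂ × ℂ)) hW h.1 hp).congr_on hW hp
    he
  rw [← pd_dzbar, h1.2, pd_dzbar, h.2 p hp, he hp]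

end solution

/-! ### Polarization -/

section polarization

variable {r : ℝ}

theorem eq_zero_of_eq_zero_on_real {f : ℂ → ℂ} {R : ℝ} (hf : DifferentiableOn ℂ f (Metric.ball 0 R))
    (h : ∀ x : ℝ, (x : ℂ) ∈ Metric.ball (0 : ℂ) R → f x = 0) {z : ℂ} (hz : z ∈ Metric.ball (0 : ℂ) R) :
    f z = 0 := by
  have hR : 0 < R := (norm_nonneg z).trans_lt (mem_ball_zero_iff.1 hz)
  have ht : Tendsto (fun x : ℝ => (x : ℂ)) (𝓝[≠] 0) (𝓝[≠] 0) :=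
    tendsto_nhdsWithin_iff.2 ⟨(Complex.continuous_ofReal.tendsto' 0 0 rfl).mono_left
      nhdsWithin_le_nhds, eventually_mem_nhdsWithin.mono fun x hx => by simpa using hx⟩
  have h0 : ∀ᶠ x : ℝ in 𝓝[≠] 0, f x = 0 := by
    filter_upwards [nhdsWithin_le_nhds (Metric.ball_mem_nhds (0 : ℝ) hR)] with x hx
    exact h x (by simpa using hx)
  exact (hf.analyticOnNhd Metric.isOpen_ball).eqOn_zero_of_preconnected_of_frequently_eq_zero
    (convex_ball 0 R).isPreconnected (Metric.mem_ball_self hR) (ht.frequently h0.frequently) hz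

/-- With `z = a + ib`, `w = a - ib`, the set `w = z̄` becomes the real plane. The one-variable
identity theorem removes the reality of `a` first, then that of `b`. -/
theorem eq_zero_of_polarization_eq_zero {Ψ : ℂ × ℂ → ℂ}
    (hΨ : DifferentiableOn ℂ Ψ (Metric.ball 0 r ×ˢ Metric.ball 0 r))
    (h : ∀ p ∈ disc r, Ψ (toC p, (starRingEnd ℂ) (toC p)) = 0) {z : ℂ}
    (hz : z ∈ Metric.ball (0 : ℂ) r) : Ψ (z, 0) = 0 := by
  have hmem : ∀ a b : ℂ, a ∈ Metric.ball (0 : ℂ) (r / 2) → b ∈ Metric.ball (0 : ℂ) (r / 2) →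
      (a + Complex.I * b, a - Complex.I * b) ∈
        Metric.ball (0 : ℂ) r ×ˢ Metric.ball (0 : ℂ) r := by
    intro a b ha hb
    simp only [mem_prod, mem_ball_zero_iff] at ha hb ⊢
    have e : ‖Complex.I * b‖ = ‖b‖ := by simp
    constructor
    · linarith [norm_add_le a (Complex.I * b)]
    · linarith [norm_sub_le a (Complex.I * b)]
  have h1 : ∀ (b : ℝ), (b : ℂ) ∈ Metric.ball (0 : ℂ) (r / 2) → ∀ a ∈ Metric.ball (0 : ℂ) (r / 2),
      Ψ (a + Complex.I * b, a - Complex.I * b) = 0 := by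
    intro b hb a ha
    refine eq_zero_of_eq_zero_on_real (f := fun a : ℂ => Ψ (a + Complex.I * b, a - Complex.I * b))
      (hΨ.comp (by fun_prop) fun a ha => hmem a b ha hb) (fun x hx => ?_) ha
    have e1 : toC (x, b) = x + Complex.I * b := by apply Complex.ext <;> simp [toC]
    have e2 : (starRingEnd ℂ) (toC (x, b)) = x - Complex.I * b := by
      apply Complex.ext <;> simp [toC]
    have := h (x, b) (by
      change toC (x, b) ∈ Metric.ball 0 r
      rw [e1]; exact (hmem x b hx hb).1)
    rwa [e2, e1] at this
  have h2 : ∀ a ∈ Metric.ball (0 : ℂ) (r / 2), ∀ b ∈ Metric.ball (0 : ℂ) (r / 2),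
      Ψ (a + Complex.I * b, a - Complex.I * b) = 0 := by
    intro a ha b hb
    exact eq_zero_of_eq_zero_on_real (f := fun b : ℂ => Ψ (a + Complex.I * b, a - Complex.I * b))
      (hΨ.comp (by fun_prop) fun b hb => hmem a b ha hb) (fun x hx => h1 x hx a ha) hb
  have hz' := mem_ball_zero_iff.1 hz
  -- The point `(z, 0)` has `a = z/2`, `b = -iz/2`, both of norm less than `r/2`, so the smaller
  -- discs suffice.
  have h3 := h2 (z / 2) (by rw [mem_ball_zero_iff, norm_div]; simpa using by linarith)
    (-(Complex.I * z / 2)) (by rw [mem_ball_zero_iff, norm_neg, norm_div, norm_mul]; simpa using by linarith)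
  have e : Complex.I * -(Complex.I * z / 2) = z / 2 := by
    linear_combination (-z / 2) * Complex.I_mul_I
  rwa [e, add_halves, sub_self] at h3

theorem dzbar_polarization {Φ : ℂ × ℂ → ℂ} {p : ℝ × ℝ}
    (h : DifferentiableAt ℂ Φ (toC p, (starRingEnd ℂ) (toC p))) :
    DifferentiableAt ℝ (fun q => Φ (toC q, (starRingEnd ℂ) (toC q))) p ∧
      dzbar (fun q => Φ (toC q, (starRingEnd ℂ) (toC q))) p =
        fderiv ℂ Φ (toC p, (starRingEnd ℂ) (toC p)) (0, 1) := by
  set L := fderiv ℂ Φ (toC p, (starRingEnd ℂ) (toC p)) with hL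
  have hc : HasFDerivAt (fun q => (starRingEnd ℂ) (toC q))
      ((Complex.conjCLE : ℂ →L[ℝ] ℂ).comp (toCL : (ℝ × ℝ) →L[ℝ] ℂ)) p :=
    Complex.conjCLE.hasFDerivAt.comp p (hasFDerivAt_toC p)
  have h1 : HasFDerivAt (fun q => Φ (toC q, (starRingEnd ℂ) (toC q)))
      ((L.restrictScalars ℝ).comp ((toCL : (ℝ × ℝ) →L[ℝ] ℂ).prod
        ((Complex.conjCLE : ℂ →L[ℝ] ℂ).comp (toCL : (ℝ × ℝ) →L[ℝ] ℂ)))) p :=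
    (h.hasFDerivAt.restrictScalars ℝ).comp p ((hasFDerivAt_toC p).prodMk hc)
  refine ⟨h1.differentiableAt, ?_⟩
  have e1 : toCL eu = 1 := by rw [coe_toCL, toC_eu]
  have e2 : toCL ev = Complex.I := by rw [coe_toCL, toC_ev]
  have e3 : ∀ a b : ℂ, L (a, b) = a * L (1, 0) + b * L (0, 1) := by
    intro a b
    rw [← smul_eq_mul, ← smul_eq_mul, ← map_smul, ← map_smul, ← map_add]
    simp
  simp only [dzbar, pu, pv, h1.fderiv, ContinuousLinearMap.comp_apply,
    ContinuousLinearMap.prod_apply, ContinuousLinearEquiv.coe_coe, e1, e2,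
    ContinuousLinearMap.coe_restrictScalars', Complex.conjCLE_apply, map_one, Complex.conj_I]
  rw [e3 1 1, e3 Complex.I (-Complex.I)]
  linear_combination (L (1, 0) / 2 - L (0, 1) / 2) * Complex.I_mul_I

/-- The primitive with respect to the second variable. -/
noncomputable def sndPrimitive (G : ℂ × ℂ → ℂ) (x : ℂ × ℂ) : ℂ :=
  x.2 * ∫ t in (0 : ℝ)..1, G (x.1, t * x.2)

theorem smul_mem_bidisc {ρ t : ℝ} (ht : t ∈ Icc (0 : ℝ) 1) {x : ℂ × ℂ} (h1 : ‖x.1‖ < ρ)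
    (h2 : ‖x.2‖ < ρ) : (x.1, (t : ℂ) * x.2) ∈ Metric.ball (0 : ℂ) ρ ×ˢ Metric.ball (0 : ℂ) ρ := by
  simp only [mem_prod, mem_ball_zero_iff, norm_mul, Complex.norm_real, Real.norm_of_nonneg ht.1]
  exact ⟨h1, (mul_le_of_le_one_left (norm_nonneg _) ht.2).trans_lt h2⟩

/-- Differentiation under the integral. The dominating constant is a Cauchy estimate: `|G| ≤ M` on a
slightly smaller closed bidisc, so on balls of radius `ε` the integrand varies by at most `2M` and
its derivative is at most `2M/ε`. -/
theorem differentiableOn_sndPrimitive {G : ℂ × ℂ → ℂ}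
    (hG : DifferentiableOn ℂ G (Metric.ball 0 r ×ˢ Metric.ball 0 r)) :
    DifferentiableOn ℂ (sndPrimitive G) (Metric.ball 0 r ×ˢ Metric.ball 0 r) := by
  intro x hx
  apply DifferentiableAt.differentiableWithinAt
  refine differentiableAt_snd.mul ?_
  have hx1 := mem_ball_zero_iff.1 hx.1
  have hx2 := mem_ball_zero_iff.1 hx.2
  obtain ⟨ρ, hρ1, hρ2⟩ := exists_between (max_lt hx1 hx2)
  -- Half of the gap: a ball of radius `ε` about any point within `ε` of `x` remains in the bidisc
  -- of radius `ρ`.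
  set ε := (ρ - max ‖x.1‖ ‖x.2‖) / 2 with hε
  have hε0 : 0 < ε := half_pos (sub_pos.2 hρ1)
  have hsub : Metric.closedBall (0 : ℂ) ρ ×ˢ Metric.closedBall (0 : ℂ) ρ ⊆
      Metric.ball (0 : ℂ) r ×ˢ Metric.ball (0 : ℂ) r :=
    prod_mono (Metric.closedBall_subset_ball hρ2) (Metric.closedBall_subset_ball hρ2)
  obtain ⟨M, hM⟩ := ((isCompact_closedBall (0 : ℂ) ρ).prod
    (isCompact_closedBall (0 : ℂ) ρ)).exists_bound_of_continuousOn (hG.continuousOn.mono hsub)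
  have hop : IsOpen (Metric.ball (0 : ℂ) r ×ˢ Metric.ball (0 : ℂ) r) :=
    Metric.isOpen_ball.prod Metric.isOpen_ball
  have hball : ∀ y ∈ Metric.ball x (2 * ε), ‖y.1‖ < ρ ∧ ‖y.2‖ < ρ := by
    intro y hy
    rw [mem_ball_iff_norm, Prod.norm_def, max_lt_iff] at hy
    have a1 := norm_le_norm_add_norm_sub' y.1 x.1
    have a2 := norm_le_norm_add_norm_sub' y.2 x.2
    have b1 := le_max_left ‖x.1‖ ‖x.2‖
    have b2 := le_max_right ‖x.1‖ ‖x.2‖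
    have c1 := hy.1
    have c2 := hy.2
    simp only [Prod.fst_sub, Prod.snd_sub] at c1 c2
    constructor <;> linarith
  have hm : ∀ t ∈ Icc (0 : ℝ) 1, ∀ y ∈ Metric.ball x (2 * ε), (y.1, (t : ℂ) * y.2) ∈
      Metric.ball (0 : ℂ) ρ ×ˢ Metric.ball (0 : ℂ) ρ := fun t ht y hy =>
    smul_mem_bidisc ht (hball y hy).1 (hball y hy).2
  have hsub' : Metric.ball (0 : ℂ) ρ ×ˢ Metric.ball (0 : ℂ) ρ ⊆
      Metric.closedBall (0 : ℂ) ρ ×ˢ Metric.closedBall (0 : ℂ) ρ :=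
    prod_mono Metric.ball_subset_closedBall Metric.ball_subset_closedBall
  have hd : ∀ t ∈ Icc (0 : ℝ) 1, ∀ y ∈ Metric.ball x (2 * ε),
      DifferentiableAt ℂ (fun y : ℂ × ℂ => G (y.1, (t : ℂ) * y.2)) y := fun t ht y hy =>
    (hG.differentiableAt (hop.mem_nhds (hsub (hsub' (hm t ht y hy))))).comp y (by fun_prop)
  have hcont : ∀ y ∈ Metric.ball x (2 * ε),
      ContinuousOn (fun t : ℝ => G (y.1, (t : ℂ) * y.2)) (Icc 0 1) := fun y hy =>
    hG.continuousOn.comp (by fun_prop) fun t ht => hsub (hsub' (hm t ht y hy))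
  have hxb : x ∈ Metric.ball x (2 * ε) := Metric.mem_ball_self (by linarith)
  have hIoc : uIoc (0 : ℝ) 1 ⊆ Icc 0 1 := by
    rw [uIoc_of_le zero_le_one]; exact Ioc_subset_Icc_self
  refine (intervalIntegral.hasFDerivAt_integral_of_dominated_of_fderiv_le (𝕜 := ℂ) (μ := volume)
    (F := fun (y : ℂ × ℂ) (t : ℝ) => G (y.1, (t : ℂ) * y.2))
    (F' := fun y t => fderiv ℂ (fun y : ℂ × ℂ => G (y.1, (t : ℂ) * y.2)) y)
    (bound := fun _ => 2 * M / ε) (Metric.ball_mem_nhds x hε0) ?_ ?_ ?_ ?_ ?_ ?_).differentiableAt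
  · filter_upwards [Metric.ball_mem_nhds x (by linarith : 0 < 2 * ε)] with y hy
    exact ((hcont y hy).mono hIoc).aestronglyMeasurable measurableSet_uIoc
  · exact ((hcont x hxb).mono (by rw [uIcc_of_le zero_le_one])).intervalIntegrable
  -- Derivatives are measurable without further hypotheses, so the chain rule gives measurability in
  -- `t`; continuity of the derivative is not used.
  · have hm : Measurable fun t : ℝ => (fderiv ℂ G (x.1, (t : ℂ) * x.2)).comp
        ((ContinuousLinearMap.fst ℂ ℂ ℂ).prod ((t : ℂ) • ContinuousLinearMap.snd ℂ ℂ ℂ)) := by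
      have h1 : Measurable fun t : ℝ => fderiv ℂ G (x.1, (t : ℂ) * x.2) :=
        (measurable_fderiv ℂ G).comp (by fun_prop : Continuous fun t : ℝ =>
          (x.1, (t : ℂ) * x.2)).measurable
      have h2 : Continuous fun t : ℝ =>
          (ContinuousLinearMap.fst ℂ ℂ ℂ).prod ((t : ℂ) • ContinuousLinearMap.snd ℂ ℂ ℂ) := by
        have e : ∀ t : ℝ,
            (ContinuousLinearMap.fst ℂ ℂ ℂ).prod ((t : ℂ) • ContinuousLinearMap.snd ℂ ℂ ℂ) =
              (ContinuousLinearMap.inl ℂ ℂ ℂ).comp (ContinuousLinearMap.fst ℂ ℂ ℂ) +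
              (t : ℂ) • (ContinuousLinearMap.inr ℂ ℂ ℂ).comp (ContinuousLinearMap.snd ℂ ℂ ℂ) := by
          intro t
          ext <;> simp
        simp only [e]
        fun_prop
      exact (isBoundedBilinearMap_comp.continuous.measurable).comp (h1.prodMk h2.measurable)
    refine AEStronglyMeasurable.congr (hm.aestronglyMeasurable) ?_
    refine (ae_restrict_iff' measurableSet_uIoc).2 (ae_of_all _ fun t ht => ?_)
    have hl : HasFDerivAt (fun y : ℂ × ℂ => (y.1, (t : ℂ) * y.2))
        ((ContinuousLinearMap.fst ℂ ℂ ℂ).prod ((t : ℂ) • ContinuousLinearMap.snd ℂ ℂ ℂ)) x :=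
      hasFDerivAt_fst.prodMk (hasFDerivAt_snd.const_mul (t : ℂ))
    exact ((hG.differentiableAt (hop.mem_nhds (hsub (hsub' (smul_mem_bidisc (hIoc ht)
      (hball x hxb).1 (hball x hxb).2))))).hasFDerivAt.comp x hl).fderiv.symm
  · refine ae_of_all _ fun t ht y hy => ?_
    have hyb : Metric.ball y ε ⊆ Metric.ball x (2 * ε) := Metric.ball_subset_ball' (by
      have := Metric.mem_ball.1 hy
      linarith)
    refine Complex.norm_fderiv_le_div_of_mapsTo_ball (fun w hw =>
      (hd t (hIoc ht) w (hyb hw)).differentiableWithinAt) (fun w hw => ?_) hε0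
    rw [mem_closedBall_iff_norm]
    have n1 := hM _ (hsub' (hm t (hIoc ht) w (hyb hw)))
    have n2 := hM _ (hsub' (hm t (hIoc ht) y (hyb (Metric.mem_ball_self hε0))))
    linarith [norm_sub_le (G (w.1, (t : ℂ) * w.2)) (G (y.1, (t : ℂ) * y.2))]
  · exact intervalIntegrable_const
  · exact ae_of_all _ fun t ht y hy => (hd t (hIoc ht) y
      (Metric.ball_subset_ball (by linarith) hy)).hasFDerivAt

/-- For fixed `z`, the holomorphic function `G(z, ·)` has a primitive on the disc vanishing at 0.
Integration along the segment from 0 identifies it with `sndPrimitive G (z, ·)`. -/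
theorem hasDerivAt_sndPrimitive {G : ℂ × ℂ → ℂ}
    (hG : DifferentiableOn ℂ G (Metric.ball 0 r ×ˢ Metric.ball 0 r)) {z w : ℂ}
    (hz : z ∈ Metric.ball (0 : ℂ) r) (hw : w ∈ Metric.ball (0 : ℂ) r) :
    HasDerivAt (fun w => sndPrimitive G (z, w)) (G (z, w)) w := by
  have hg : DifferentiableOn ℂ (fun w => G (z, w)) (Metric.ball 0 r) :=
    hG.comp (by fun_prop) fun w hw => ⟨hz, hw⟩
  obtain ⟨P, hP0, hP⟩ := hg.isExactOn_ball.with_val_at 0 0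
  refine (hP w hw).congr_of_eventuallyEq ?_
  filter_upwards [Metric.isOpen_ball.mem_nhds hw] with v hv
  have hmem : ∀ t ∈ Icc (0 : ℝ) 1, (t : ℂ) * v ∈ Metric.ball (0 : ℂ) r := fun t ht =>
    (smul_mem_bidisc (x := (z, v)) ht (mem_ball_zero_iff.1 hz) (mem_ball_zero_iff.1 hv)).2
  have h1 : ∀ t ∈ uIcc (0 : ℝ) 1, HasDerivAt (fun t : ℝ => P (t * v)) (v * G (z, t * v)) t := by
    intro t ht
    rw [uIcc_of_le zero_le_one] at ht
    have hl : HasDerivAt (fun t : ℝ => (t : ℂ) * v) v t := by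
      simpa using (Complex.ofRealCLM.hasDerivAt (x := t)).mul_const v
    exact ((hP _ (hmem t ht)).comp t hl).congr_deriv (mul_comm _ _)
  have h2 := intervalIntegral.integral_eq_sub_of_hasDerivAt h1 (by
    apply ContinuousOn.intervalIntegrable
    rw [uIcc_of_le zero_le_one]
    exact continuousOn_const.mul (hg.continuousOn.comp (by fun_prop) hmem))
  rw [intervalIntegral.integral_const_mul] at h2
  simpa [sndPrimitive, hP0] using h2

theorem sndPrimitive_zero (G : ℂ × ℂ → ℂ) (z : ℂ) : sndPrimitive G (z, 0) = 0 := by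
  simp [sndPrimitive]

end polarization

/-! ### The normalization with initial value 1, and uniqueness for given initial values. -/

section solution

variable {n : ℕ} {s : ℝ × ℝ → Fin (n + 3) → ℝ} {r : ℝ}

theorem conj_mem_ball {z : ℂ} (h : z ∈ Metric.ball (0 : ℂ) r) :
    (starRingEnd ℂ) z ∈ Metric.ball (0 : ℂ) r := by
  simpa using h

/-- If `Γ` extends to independent variables, then there is a normalization of the solutions
for which `φ^ζ(z, 0) = ζ(z)`. -/
theorem IsSurface.exists_isNormalization_hasInitialValue (hr : 0 < r) (hs : IsSurface s (disc r))
    {G : ℂ × ℂ → ℂ} (hG : IsPolarization r (Γc s) G) :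
    ∃ φ₀, IsNormalization s (disc r) φ₀ ∧
      ∀ ζ : ℂ → ℂ, DifferentiableOn ℂ ζ (Metric.ball 0 r) → ∀ φ : ℝ × ℝ → ℂ,
        (IsSolution s (disc r) φ ∧ HasInitialValue r φ ζ) ↔
          EqOn φ (phiZeta φ₀ ζ) (disc r) := by
  have hop : IsOpen (Metric.ball (0 : ℂ) r ×ˢ Metric.ball (0 : ℂ) r) :=
    Metric.isOpen_ball.prod Metric.isOpen_ball
  -- The solution of `H_w = 2GH` with `H(z, 0) = 1`.
  set H : ℂ × ℂ → ℂ := fun x => Complex.exp (2 * sndPrimitive G x) with hH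
  have dH : DifferentiableOn ℂ H (Metric.ball 0 r ×ˢ Metric.ball 0 r) :=
    ((differentiableOn_sndPrimitive hG.1).const_mul 2).cexp
  have H0 : ∀ z, H (z, 0) = 1 := fun z => by simp [hH, sndPrimitive_zero]
  set φ₀ : ℝ × ℝ → ℂ := fun p => H (toC p, (starRingEnd ℂ) (toC p)) with hφ₀
  have hmem : ∀ p ∈ disc r, (toC p, (starRingEnd ℂ) (toC p)) ∈
      Metric.ball (0 : ℂ) r ×ˢ Metric.ball (0 : ℂ) r := fun p hp => ⟨hp, conj_mem_ball hp⟩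
  have hφ : ∀ p ∈ disc r, DifferentiableAt ℝ φ₀ p ∧ dzbar φ₀ p = 2 * Γc s p * φ₀ p := by
    intro p hp
    have hdp := dH.differentiableAt (hop.mem_nhds (hmem p hp))
    obtain ⟨d1, d2⟩ := dzbar_polarization hdp
    refine ⟨d1, d2.trans ?_⟩
    have h1 : HasDerivAt (fun w => H (toC p, w)) (fderiv ℂ H (toC p, (starRingEnd ℂ) (toC p)) (0, 1))
        ((starRingEnd ℂ) (toC p)) :=
      hdp.hasFDerivAt.comp_hasDerivAt _ ((hasDerivAt_const _ _).prodMk (hasDerivAt_id _))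
    have h2 := ((hasDerivAt_sndPrimitive hG.1 hp (conj_mem_ball hp)).const_mul 2).cexp
    rw [h1.unique h2, hG.2 p hp]
    simp only [hφ₀, hH]
    ring
  -- Real smoothness of `φ₀` is obtained by comparison with another normalization: the two differ by
  -- a holomorphic factor.
  have hN : IsNormalization s (disc r) φ₀ := by
    obtain ⟨φ₁, h₁⟩ := hs.exists_isNormalization hr
    obtain ⟨ζ, hζ, he⟩ := h₁.exists_eq_phiZeta (fun p hp => (hφ p hp).1) fun p hp => (hφ p hp).2
    exact ⟨(h₁.isSolution_phiZeta hζ).congr (isOpen_disc r) he, fun p _ => Complex.exp_ne_zero _⟩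
  have hpol : ∀ ζ : ℂ → ℂ, DifferentiableOn ℂ ζ (Metric.ball 0 r) →
      DifferentiableOn ℂ (fun x : ℂ × ℂ => ζ x.1 * H x) (Metric.ball 0 r ×ˢ Metric.ball 0 r) :=
    fun ζ hζ => (hζ.comp differentiableOn_fst fun x hx => hx.1).mul dH
  refine ⟨φ₀, hN, fun ζ hζ φ => ⟨?_, fun he => ⟨(hN.isSolution_phiZeta hζ).congr (isOpen_disc r) he,
    fun x => ζ x.1 * H x, ⟨hpol ζ hζ, he⟩, fun z _ => by simp [H0]⟩⟩⟩
  rintro ⟨hsol, Φ, hΦ, hΦ0⟩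
  obtain ⟨ξ, hξ, he⟩ := hN.exists_eq_phiZeta
    (fun p hp => differentiableAt_of_contDiffOn (isOpen_disc r) hsol.1 hp) hsol.2
  -- Both `Φ` and `ξ(z)H(z, w)` extend `φ`, so they agree at `w = 0`, where `H = 1`.
  have hz : ∀ z ∈ Metric.ball (0 : ℂ) r, ζ z = ξ z := by
    intro z hz
    have := eq_zero_of_polarization_eq_zero (hΦ.1.sub (hpol ξ hξ)) (fun p hp => by
      rw [Pi.sub_apply, ← hΦ.2 p hp, he hp]
      exact sub_self _) hz
    rw [Pi.sub_apply, hΦ0 z hz, H0, mul_one, sub_eq_zero] at this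
    exact this
  intro p hp
  rw [he hp, phiZeta, phiZeta, hz _ hp]

end solution

/-! ### Tensors acting by complex multiplication -/

theorem toC_injective : Function.Injective toC := coe_toCL ▸ toCL.injective

theorem toC_add (x y : ℝ × ℝ) : toC (x + y) = toC x + toC y := by rw [← coe_toCL, map_add]

theorem toC_sub (x y : ℝ × ℝ) : toC (x - y) = toC x - toC y := by rw [← coe_toCL, map_sub]

theorem toC_smul (a : ℝ) (x : ℝ × ℝ) : toC (a • x) = a * toC x := by
  rw [← coe_toCL, map_smul, Complex.real_smul]

/-- The endomorphism `D` of the plane is the multiplication by the complex number `a`, which is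
then the eigenvalue on `∂_z` of its complex-linear extension. -/
def ActsAs (D : ℝ × ℝ →L[ℝ] ℝ × ℝ) (a : ℂ) : Prop := ∀ x, toC (D x) = a * toC x

namespace ActsAs

variable {D D' : ℝ × ℝ →L[ℝ] ℝ × ℝ} {a a' : ℂ}

theorem of_frame (h : toC (D eu) = a) (h' : toC (D ev) = a * Complex.I) : ActsAs D a := by
  intro x
  rw [apply_frame D x, toC_add, toC_smul, toC_smul, h, h']
  conv_rhs => rw [eq_frame x, toC_add, toC_smul, toC_smul, toC_eu, toC_ev]
  ring

theorem apply_eu (h : ActsAs D a) : toC (D eu) = a := by rw [h, toC_eu, mul_one]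

theorem apply_eu_eq (h : ActsAs D a) : D eu = a.re • eu + a.im • ev := by
  apply toC_injective
  rw [h.apply_eu, toC_add, toC_smul, toC_smul, toC_eu, toC_ev, mul_one, Complex.re_add_im]

theorem apply_ev_eq (h : ActsAs D a) : D ev = (-a.im) • eu + a.re • ev := by
  apply toC_injective
  rw [h, toC_add, toC_smul, toC_smul, toC_eu, toC_ev]
  apply Complex.ext <;> simp

theorem add (h : ActsAs D a) (h' : ActsAs D' a') : ActsAs (D + D') (a + a') := fun x => by
  rw [_root_.add_apply, toC_add, h, h', add_mul]

theorem sub (h : ActsAs D a) (h' : ActsAs D' a') : ActsAs (D - D') (a - a') := fun x => by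
  rw [_root_.sub_apply, toC_sub, h, h', sub_mul]

theorem neg (h : ActsAs D a) : ActsAs (-D) (-a) := fun x => by
  rw [_root_.neg_apply, ← neg_one_smul ℝ, toC_smul, h]
  push_cast
  ring

theorem one : ActsAs 1 1 := fun x => by rw [one_apply_eq_self, one_mul]

theorem smul (t : ℝ) (h : ActsAs D a) : ActsAs (t • D) (t * a) := fun x => by
  rw [_root_.smul_apply, toC_smul, h, mul_assoc]

theorem sq (h : ActsAs D a) : ActsAs (D ^ 2) (a * a) := fun x => by
  have e : (D ^ 2) x = D (D x) := by rw [pow_two]; rfl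
  rw [e, h, h, mul_assoc]

theorem eq_iff (h : ActsAs D a) (h' : ActsAs D' a') : D = D' ↔ a = a' := by
  refine ⟨fun e => ?_, fun e => ?_⟩
  · rw [← h.apply_eu, ← h'.apply_eu, e]
  · ext1 <;> ext1 <;> exact toC_injective (by
      simp only [ContinuousLinearMap.comp_apply]
      rw [h, h', e])

theorem det (h : ActsAs D a) : (D.det : ℂ) = a * (starRingEnd ℂ) a := by
  rw [det_eq, h.apply_eu_eq, h.apply_ev_eq, Complex.mul_conj, Complex.normSq_apply]
  simp [eu, ev]

theorem det_ne_zero_iff (h : ActsAs D a) : D.det ≠ 0 ↔ a ≠ 0 := by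
  rw [not_iff_not, ← Complex.ofReal_eq_zero, h.det]
  simp

end ActsAs

theorem actsAs_of_mem_span {J D : ℝ × ℝ →L[ℝ] ℝ × ℝ} (hJ : J eu = ev ∧ J ev = -eu)
    (hD : D ∈ Submodule.span ℝ {1, J}) : ActsAs D (toC (D eu)) := by
  have aJ : ActsAs J Complex.I := .of_frame (by rw [hJ.1, toC_ev]) (by
    rw [hJ.2, ← neg_one_smul ℝ, toC_smul, toC_eu, Complex.I_mul_I]; simp)
  obtain ⟨α, β, rfl⟩ := Submodule.mem_span_pair.1 hD
  have h := (ActsAs.one.smul α).add (aJ.smul β)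
  rw [h.apply_eu]
  exact h

theorem mem_span_of_actsAs {J D : ℝ × ℝ →L[ℝ] ℝ × ℝ} (hJ : J eu = ev ∧ J ev = -eu) {a : ℂ}
    (h : ActsAs D a) : a.re • 1 + a.im • J = D := by
  refine clm_ext_frame ?_ ?_
  · simp only [_root_.add_apply, _root_.smul_apply, one_apply_eq_self, hJ.1, h.apply_eu_eq]
  · simp only [_root_.add_apply, _root_.smul_apply, one_apply_eq_self, hJ.2, h.apply_ev_eq]
    module

/-! ### Elliptic surfaces: the Codazzi and Ricci equations in complex form. -/

section elliptic

variable {n : ℕ} {s : ℝ × ℝ → Fin (n + 3) → ℝ} {J : ℝ × ℝ → ℝ × ℝ →L[ℝ] ℝ × ℝ}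
  {W : Set (ℝ × ℝ)} {p : ℝ × ℝ}

theorem contDiffOn_conj {f : ℝ × ℝ → ℂ} (hf : ContDiffOn ℝ ∞ f W) :
    ContDiffOn ℝ ∞ (fun p => (starRingEnd ℂ) (f p)) W :=
  Complex.conjCLE.contDiff.comp_contDiffOn hf

theorem contDiffOn_ofReal {f : ℝ × ℝ → ℝ} (hf : ContDiffOn ℝ ∞ f W) :
    ContDiffOn ℝ ∞ (fun p => (f p : ℂ)) W :=
  Complex.ofRealCLM.contDiff.comp_contDiffOn hf

theorem fderiv_clm_comp {E F : Type} [NormedAddCommGroup E] [NormedSpace ℝ E]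
    [NormedAddCommGroup F] [NormedSpace ℝ F] (L : E →L[ℝ] F) {f : ℝ × ℝ → E}
    (hf : DifferentiableAt ℝ f p) (x : ℝ × ℝ) :
    fderiv ℝ (fun q => L (f q)) p x = L (fderiv ℝ f p x) := by
  have h : HasFDerivAt (fun q => L (f q)) (L.comp (fderiv ℝ f p)) p :=
    L.hasFDerivAt.comp p hf.hasFDerivAt
  rw [h.fderiv]
  rfl

theorem pd_conj {c : ℂ × ℂ} {f : ℝ × ℝ → ℂ} (hf : DifferentiableAt ℝ f p) :
    pd ((starRingEnd ℂ) c.1, (starRingEnd ℂ) c.2) (fun q => (starRingEnd ℂ) (f q)) p =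
      (starRingEnd ℂ) (pd c f p) := by
  have h := fderiv_clm_comp (Complex.conjCLE : ℂ →L[ℝ] ℂ) hf
  simp only [ContinuousLinearEquiv.coe_coe, Complex.conjCLE_apply] at h
  simp only [pd, pu, pv, h, map_add, map_mul]

theorem fderiv_ofReal {f : ℝ × ℝ → ℝ} (hf : DifferentiableAt ℝ f p) (x : ℝ × ℝ) :
    fderiv ℝ (fun q => (f q : ℂ)) p x = (fderiv ℝ f p x : ℝ) :=
  fderiv_clm_comp Complex.ofRealCLM hf x

/-- The mixed terms in `∇_{∂_z} ∂_{z̄}` cancel because the connection is symmetric. -/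
theorem IsSurface.Γc_eq (hs : IsSurface s W) (hW : IsOpen W) (hp : p ∈ W) :
    Γc s p = (toC (christoffel s p eu eu) + toC (christoffel s p ev ev)) / 4 := by
  rw [Γc, onDzDzbar, onDzDzbar, hs.christoffel_comm hW hp ev eu]
  apply Complex.ext <;> simp [toC]

theorem onDzDzbar_metric (s : ℝ × ℝ → Fin (n + 3) → ℝ) (p : ℝ × ℝ) :
    onDzDzbar (metric s p) = ((metric s p eu eu + metric s p ev ev : ℝ) : ℂ) / 4 := by
  rw [onDzDzbar, metric_comm s p ev eu]
  push_cast
  ring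

/-- The coordinate vector `∂_z`. -/
noncomputable def ez : ℂ × ℂ := (1 / 2, -(Complex.I / 2))

/-- The coordinate vector `∂_{z̄}`. -/
noncomputable def ezbar : ℂ × ℂ := (1 / 2, Complex.I / 2)

/-- The value of a real one-form on `∂_z`. -/
noncomputable def onDz (ψ : ℝ × ℝ →L[ℝ] ℝ) : ℂ := (ψ eu - Complex.I * ψ ev) / 2

/-- The value of a real one-form on `∂_{z̄}`. -/
noncomputable def onDzbar (ψ : ℝ × ℝ →L[ℝ] ℝ) : ℂ := (ψ eu + Complex.I * ψ ev) / 2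

theorem conj_two : (starRingEnd ℂ) 2 = 2 := map_ofNat _ 2

theorem conj_onDzbar (ψ : ℝ × ℝ →L[ℝ] ℝ) : (starRingEnd ℂ) (onDzbar ψ) = onDz ψ := by
  simp [onDz, onDzbar, sub_eq_add_neg, conj_two]

theorem onDzbar_neg (ψ : ℝ × ℝ →L[ℝ] ℝ) : onDzbar (-ψ) = -onDzbar ψ := by
  simp only [onDzbar, _root_.neg_apply]
  push_cast
  ring

theorem contDiffOn_onDzbar_iff {ψ : ℝ × ℝ → ℝ × ℝ →L[ℝ] ℝ} :
    ContDiffOn ℝ ∞ ψ W ↔ ContDiffOn ℝ ∞ (fun p => onDzbar (ψ p)) W := by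
  rw [contDiffOn_clm_iff]
  constructor
  · rintro ⟨h1, h2⟩
    exact ((contDiffOn_ofReal h1).add (contDiffOn_const.mul (contDiffOn_ofReal h2))).div_const 2
  · intro h
    have hr := (contDiffOn_const (c := (2 : ℝ))).mul (Complex.reCLM.contDiff.comp_contDiffOn h)
    have hi := (contDiffOn_const (c := (2 : ℝ))).mul (Complex.imCLM.contDiff.comp_contDiffOn h)
    exact ⟨hr.congr fun p _ => by simp [onDzbar]; ring, hi.congr fun p _ => by simp [onDzbar]; ring⟩

theorem contDiffOn_actsAs_iff {D : ℝ × ℝ → ℝ × ℝ →L[ℝ] ℝ × ℝ} {a : ℝ × ℝ → ℂ}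
    (h : ∀ p ∈ W, ActsAs (D p) (a p)) : ContDiffOn ℝ ∞ D W ↔ ContDiffOn ℝ ∞ a W := by
  rw [contDiffOn_clm_iff]
  constructor
  · rintro ⟨hu, -⟩
    exact (contDiff_toC.comp_contDiffOn hu).congr fun p hp => (h p hp).apply_eu.symm
  · intro ha
    have hr : ContDiffOn ℝ ∞ (fun p => (a p).re) W := Complex.reCLM.contDiff.comp_contDiffOn ha
    have hi : ContDiffOn ℝ ∞ (fun p => (a p).im) W := Complex.imCLM.contDiff.comp_contDiffOn ha
    exact ⟨((hr.smul contDiffOn_const).add (hi.smul contDiffOn_const)).congr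
        fun p hp => (h p hp).apply_eu_eq,
      ((hi.neg.smul contDiffOn_const).add (hr.smul contDiffOn_const)).congr
        fun p hp => (h p hp).apply_ev_eq⟩

/-- On the frame `∂_u, ∂_v` the Codazzi equation is one vector equation, hence one complex equation
through `toC`. In it `∇_{∂_u} ∂_v` cancels and the other Christoffel terms combine to `Im a` times
`4Γ`, that is, to a multiple of `(conj a - a)Γ`. -/
theorem IsSurface.ell_codazzi_iff (hs : IsSurface s W) (hW : IsOpen W)
    {D D' : ℝ × ℝ → ℝ × ℝ →L[ℝ] ℝ × ℝ} {a a' : ℝ × ℝ → ℂ} (h : ∀ p ∈ W, ActsAs (D p) (a p))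
    (h' : ∀ p ∈ W, ActsAs (D' p) (a' p)) (hD : ContDiffOn ℝ ∞ D W) (hp : p ∈ W)
    (ψ : ℝ × ℝ →L[ℝ] ℝ) :
    (∀ x y, covDerivEnd s (D) p x y - covDerivEnd s D p y x = ψ x • D' p y - ψ y • D' p x) ↔
      pd ezbar a p = ((starRingEnd ℂ) (a p) - a p) * Γc s p + onDzbar ψ * a' p := by
  have ha := (contDiffOn_actsAs_iff h).1 hD
  have da := differentiableAt_of_contDiffOn hW ha hp
  obtain ⟨du, dv⟩ := contDiffOn_clm_iff.1 hD
  have hc := hs.isBilin_christoffel hW hp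
  have ddu : DifferentiableAt ℝ (fun q => D q eu) p :=
    (du.contDiffAt (hW.mem_nhds hp)).differentiableAt (by simp)
  have ddv : DifferentiableAt ℝ (fun q => D q ev) p :=
    (dv.contDiffAt (hW.mem_nhds hp)).differentiableAt (by simp)
  have hv : toC (pv (fun q => D q eu) p) = pv a p := by
    have e := fderiv_clm_comp (toCL : (ℝ × ℝ) →L[ℝ] ℂ) ddu ev
    rw [ContinuousLinearEquiv.coe_coe, coe_toCL] at e
    rw [pv, ← e, pv]
    rw [fderiv_congr_on hW hp fun q hq => (h q hq).apply_eu]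
  have hu : toC (pu (fun q => D q ev) p) = Complex.I * pu a p := by
    have e := fderiv_clm_comp (toCL : (ℝ × ℝ) →L[ℝ] ℂ) ddv eu
    rw [ContinuousLinearEquiv.coe_coe, coe_toCL] at e
    rw [pu, ← e, fderiv_congr_on hW hp (g := fun q => Complex.I * a q) fun q hq => by
      rw [h q hq, toC_ev, mul_comm], (da.hasFDerivAt.const_mul Complex.I).fderiv]
    rfl
  rw [hs.codazzi_iff hW hD hp, ← toC_injective.eq_iff, toC_sub, toC_add, toC_add, toC_sub,
    toC_smul, toC_smul, hu, hv, h' p hp, h' p hp, (h p hp).apply_eu_eq, (h p hp).apply_ev_eq,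
    hc.add_right, hc.add_right, hc.smul_right, hc.smul_right, hc.smul_right, hc.smul_right,
    hs.christoffel_comm hW hp ev eu, toC_add, toC_add, toC_smul, toC_smul, toC_smul,
    toC_eu, toC_ev, hs.Γc_eq hW hp, onDzbar]
  have e1 : (starRingEnd ℂ) (a p) - a p = -2 * (a p).im * Complex.I := by
    apply Complex.ext <;> simp
    ring
  rw [e1]
  simp only [pd, ezbar]
  push_cast
  generalize toC (christoffel s p eu eu) = c₁
  generalize toC (christoffel s p ev ev) = c₂
  generalize toC (christoffel s p eu ev) = c₃
  have hI := Complex.I_mul_I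
  constructor
  · intro e
    linear_combination (-Complex.I / 2) * e + (1 / 2 * pu a p - 1 / 2 * a' p * ψ eu) * hI
  · intro e
    linear_combination (2 * Complex.I) * e + (-pv a p - (a p).im * (c₁ + c₂) + a' p * ψ ev) * hI

/-- Both sides of the complex equation are imaginary: it is `i/2` times the real Ricci equation on
`∂_u, ∂_v`. -/
theorem IsSurface.ell_ricci_iff (hW : IsOpen W) {T : Triple} {a₁ a₂ : ℝ × ℝ → ℂ}
    (h1 : ∀ p ∈ W, ActsAs (T.D₁ p) (a₁ p)) (h2 : ∀ p ∈ W, ActsAs (T.D₂ p) (a₂ p))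
    (hψ : ContDiffOn ℝ ∞ T.ψ W) (hp : p ∈ W) : (∀ x y, extD T.ψ p x y =
      metric s p (T.D₂ p x) (T.D₁ p y) - metric s p (T.D₁ p x) (T.D₂ p y)) ↔
      pd ez (fun p => onDzbar (T.ψ p)) p - pd ezbar (fun p => onDz (T.ψ p)) p =
        onDzDzbar (metric s p) *
          (a₂ p * (starRingEnd ℂ) (a₁ p) - a₁ p * (starRingEnd ℂ) (a₂ p)) := by
  obtain ⟨hu, hv⟩ := contDiffOn_clm_iff.1 hψ
  have du := differentiableAt_of_contDiffOn hW hu hp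
  have dv := differentiableAt_of_contDiffOn hW hv hp
  have du' := differentiableAt_of_contDiffOn hW (contDiffOn_ofReal hu) hp
  have dv' := differentiableAt_of_contDiffOn hW (contDiffOn_ofReal hv) hp
  have e1 : ∀ c : ℂ × ℂ, pd c (fun p => onDzbar (T.ψ p)) p =
      (pd c (fun p => (T.ψ p eu : ℂ)) p + Complex.I * pd c (fun p => (T.ψ p ev : ℂ)) p) * (1 / 2) :=
    fun c => by
      have := (((DifferentiableAt.hasPd (c := c) du').add
        ((DifferentiableAt.hasPd (c := c) dv').const_mul Complex.I)).mul (hasPd_const (1 / 2))).2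
      simp only [mul_zero, add_zero] at this
      rw [← this]
      congr 1
      ext q
      simp only [onDzbar]
      ring
  have e2 : ∀ c : ℂ × ℂ, pd c (fun p => onDz (T.ψ p)) p =
      (pd c (fun p => (T.ψ p eu : ℂ)) p - Complex.I * pd c (fun p => (T.ψ p ev : ℂ)) p) * (1 / 2) :=
    fun c => by
      have := (((DifferentiableAt.hasPd (c := c) du').sub
        ((DifferentiableAt.hasPd (c := c) dv').const_mul Complex.I)).mul (hasPd_const (1 / 2))).2
      simp only [mul_zero, add_zero] at this
      rw [← this]
      congr 1
      ext q
      simp only [onDz]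
      ring
  rw [IsSurface.ricci_iff hW hψ hp, e1, e2, onDzDzbar_metric, (h1 p hp).apply_eu_eq,
    (h1 p hp).apply_ev_eq, (h2 p hp).apply_eu_eq, (h2 p hp).apply_ev_eq]
  have hm := isBilin_metric s p
  simp only [hm.add_left, hm.add_right, hm.smul_left, hm.smul_right, smul_eq_mul,
    metric_comm s p ev eu]
  have e3 : ∀ x, fderiv ℝ (fun p => (T.ψ p eu : ℂ)) p x = (fderiv ℝ (fun p => T.ψ p eu) p x : ℝ) :=
    fderiv_ofReal du
  have e4 : ∀ x, fderiv ℝ (fun p => (T.ψ p ev : ℂ)) p x = (fderiv ℝ (fun p => T.ψ p ev) p x : ℝ) :=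
    fderiv_ofReal dv
  have e5 : a₂ p * (starRingEnd ℂ) (a₁ p) - a₁ p * (starRingEnd ℂ) (a₂ p) =
      2 * Complex.I * (((a₂ p).im * (a₁ p).re - (a₂ p).re * (a₁ p).im : ℝ) : ℂ) := by
    apply Complex.ext <;> simp <;> ring
  rw [e5]
  simp only [pd, pu, pv, e3, e4, ez, ezbar]
  generalize fderiv ℝ (fun p => T.ψ p ev) p eu = k₁
  generalize fderiv ℝ (fun p => T.ψ p eu) p ev = k₂
  generalize fderiv ℝ (fun p => T.ψ p eu) p eu = k₃
  generalize fderiv ℝ (fun p => T.ψ p ev) p ev = k₄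
  rw [← Complex.ofReal_inj]
  push_cast
  have hI : Complex.I ≠ 0 := Complex.I_ne_zero
  constructor
  · intro e
    linear_combination (Complex.I / 2) * e
  · intro e
    apply mul_left_cancel₀ (mul_ne_zero hI (one_div_ne_zero two_ne_zero))
    linear_combination e

/-- Admissibility of a triple in terms of the complex eigenvalues of the tensors. -/
theorem IsSurface.ell_admissible_iff (hs : IsSurface s W) (hW : IsOpen W)
    (hJ : ∀ p ∈ W, J p eu = ev ∧ J p ev = -eu) {T : Triple} {a₁ a₂ : ℝ × ℝ → ℂ}
    (h1 : ∀ p ∈ W, ActsAs (T.D₁ p) (a₁ p)) (h2 : ∀ p ∈ W, ActsAs (T.D₂ p) (a₂ p)) :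
    IsAdmissible s J W T ↔
      IsFrame W ez ezbar (Γc s) (fun p => (starRingEnd ℂ) (Γc s p)) a₁ a₂
        (fun p => (starRingEnd ℂ) (a₁ p)) (fun p => (starRingEnd ℂ) (a₂ p))
        (fun p => onDz (T.ψ p)) (fun p => onDzbar (T.ψ p)) ∧
      ∀ p ∈ W, pd ez (fun p => onDzbar (T.ψ p)) p - pd ezbar (fun p => onDz (T.ψ p)) p =
          onDzDzbar (metric s p) *
            (a₂ p * (starRingEnd ℂ) (a₁ p) - a₁ p * (starRingEnd ℂ) (a₂ p)) ∧
        a₂ p * (starRingEnd ℂ) (a₁ p) - a₁ p * (starRingEnd ℂ) (a₂ p) ≠ 0 ∧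
        a₁ p * a₁ p + a₂ p * a₂ p ≠ 0 ∧ a₁ p * a₁ p + a₂ p * a₂ p ≠ 1 := by
  have half : ∀ {D : ℝ × ℝ →L[ℝ] ℝ × ℝ} {a : ℂ}, ActsAs D a →
      (D.det = 1 / 2 ↔ a * (starRingEnd ℂ) a = 1 / 2) := by
    intro D a h
    rw [← h.det, ← Complex.ofReal_inj]
    push_cast
    rfl
  have rank : ∀ p ∈ W, (Module.finrank ℝ (LinearMap.range
      ((T.D₁ p ^ 2 + T.D₂ p ^ 2 - 1 : ℝ × ℝ →L[ℝ] ℝ × ℝ) : ℝ × ℝ →ₗ[ℝ] ℝ × ℝ)) = 2 ↔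
      a₁ p * a₁ p + a₂ p * a₂ p ≠ 1) := by
    intro p hp
    rw [finrank_range_eq_two_iff,
      (((h1 p hp).sq.add (h2 p hp).sq).sub ActsAs.one).det_ne_zero_iff, sub_ne_zero]
  have neg : ∀ p ∈ W, (T.D₂ p ^ 2 ≠ -T.D₁ p ^ 2 ↔ a₁ p * a₁ p + a₂ p * a₂ p ≠ 0) := by
    intro p hp
    rw [not_iff_not, (h2 p hp).sq.eq_iff (h1 p hp).sq.neg, add_comm, add_eq_zero_iff_eq_neg]
  have ne : ∀ p ∈ W, a₁ p * (starRingEnd ℂ) (a₁ p) = 1 / 2 →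
      a₂ p * (starRingEnd ℂ) (a₂ p) = 1 / 2 → (T.D₂ p ^ 2 ≠ T.D₁ p ^ 2 ↔
        a₂ p * (starRingEnd ℂ) (a₁ p) - a₁ p * (starRingEnd ℂ) (a₂ p) ≠ 0) := by
    intro p hp e1 e2
    rw [not_iff_not, (h2 p hp).sq.eq_iff (h1 p hp).sq]
    have n1 : a₁ p ≠ 0 := fun h => by simp [h] at e1
    have n2 : a₂ p ≠ 0 := fun h => by simp [h] at e2
    constructor
    · intro e
      apply mul_left_cancel₀ (mul_ne_zero n1 n2)
      linear_combination a₂ p * a₂ p * e1 - a₁ p * a₁ p * e2 + e / 2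
    · intro e
      linear_combination 2 * a₁ p * a₂ p * e - 2 * a₂ p * a₂ p * e1 + 2 * a₁ p * a₁ p * e2
  -- The frame equations along `∂_z` are the conjugates of those along `∂_{z̄}`.
  have conj_d : ∀ {a : ℝ × ℝ → ℂ} {q : ℝ × ℝ} {e : ℂ}, DifferentiableAt ℝ a q → pd ezbar a q = e →
      pd ez (fun p => (starRingEnd ℂ) (a p)) q = (starRingEnd ℂ) e := by
    intro a q e ha he
    rw [← he, ← pd_conj ha]
    congr 1
    simp [ez, ezbar, conj_two, neg_div]
  have cod2 : ∀ p ∈ W, ((∀ x y, covDerivEnd s T.D₂ p x y - covDerivEnd s T.D₂ p y x =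
      -(T.ψ p x • T.D₁ p y - T.ψ p y • T.D₁ p x)) ↔ ∀ x y,
      covDerivEnd s T.D₂ p x y - covDerivEnd s T.D₂ p y x =
        (-T.ψ p) x • T.D₁ p y - (-T.ψ p) y • T.D₁ p x) := by
    intro p hp
    refine forall_congr' fun x => forall_congr' fun y => ?_
    rw [_root_.neg_apply, _root_.neg_apply, neg_smul, neg_smul, neg_sub_neg, neg_sub]
  constructor
  · intro h
    have d1 : ∀ p ∈ W, a₁ p * (starRingEnd ℂ) (a₁ p) = 1 / 2 := fun p hp =>
      (half (h1 p hp)).1 (h.det₁ p hp)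
    have d2 : ∀ p ∈ W, a₂ p * (starRingEnd ℂ) (a₂ p) = 1 / 2 := fun p hp =>
      (half (h2 p hp)).1 (h.det₂ p hp)
    have c1 := fun p hp => (hs.ell_codazzi_iff hW h1 h2 h.smooth₁ hp (T.ψ p)).1 (h.codazzi₁ p hp)
    have c2 := fun p hp => (hs.ell_codazzi_iff hW h2 h1 h.smooth₂ hp (-T.ψ p)).1
      ((cod2 p hp).1 (h.codazzi₂ p hp))
    have s1 := (contDiffOn_actsAs_iff h1).1 h.smooth₁
    have s2 := (contDiffOn_actsAs_iff h2).1 h.smooth₂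
    have sψ := contDiffOn_onDzbar_iff.1 h.smoothψ
    refine ⟨⟨s1, s2, contDiffOn_conj s1, contDiffOn_conj s2,
      (contDiffOn_conj sψ).congr fun p _ => (conj_onDzbar _).symm, sψ, d1, d2, c1, ?_, ?_, ?_⟩,
      fun p hp => ⟨(IsSurface.ell_ricci_iff hW h1 h2 h.smoothψ hp).1 (h.ricci p hp),
        (ne p hp (d1 p hp) (d2 p hp)).1 (h.sq_ne p hp), (neg p hp).1 (h.sq_ne_neg p hp),
        (rank p hp).1 (h.rank_eq p hp)⟩⟩ <;> intro p hp
    · rw [c2 p hp, onDzbar_neg]; ring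
    · rw [conj_d (differentiableAt_of_contDiffOn hW s1 hp) (c1 p hp)]
      simp only [map_add, map_sub, map_mul, Complex.conj_conj, conj_onDzbar]
    · rw [conj_d (differentiableAt_of_contDiffOn hW s2 hp) (c2 p hp), onDzbar_neg]
      simp only [map_add, map_sub, map_mul, map_neg, Complex.conj_conj, conj_onDzbar]
      ring
  · rintro ⟨h, h'⟩
    have sm1 := (contDiffOn_actsAs_iff h1).2 h.smooth_a₁
    have sm2 := (contDiffOn_actsAs_iff h2).2 h.smooth_a₂
    have smψ := contDiffOn_onDzbar_iff.2 h.smooth_ψ₂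
    have span : ∀ {D : ℝ × ℝ → ℝ × ℝ →L[ℝ] ℝ × ℝ} {a : ℝ × ℝ → ℂ}, (∀ p ∈ W, ActsAs (D p) (a p)) →
        ∀ p ∈ W, D p ∈ Submodule.span ℝ {1, J p} := fun h p hp =>
      Submodule.mem_span_pair.2 ⟨_, _, mem_span_of_actsAs (hJ p hp) (h p hp)⟩
    exact ⟨sm1, sm2, smψ, span h1, span h2, fun p hp => (half (h1 p hp)).2 (h.half₁ p hp),
      fun p hp => (half (h2 p hp)).2 (h.half₂ p hp),
      fun p hp => (hs.ell_codazzi_iff hW h1 h2 sm1 hp _).2 (h.cod_a₁ p hp),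
      fun p hp => (cod2 p hp).2 ((hs.ell_codazzi_iff hW h2 h1 sm2 hp _).2 (by
        rw [h.cod_a₂ p hp, onDzbar_neg]; ring)),
      fun p hp => (IsSurface.ell_ricci_iff hW h1 h2 smψ hp).2 (h' p hp).1,
      fun p hp => (ne p hp (h.half₁ p hp) (h.half₂ p hp)).2 (h' p hp).2.1,
      fun p hp => (neg p hp).2 (h' p hp).2.2.1, fun p hp => (rank p hp).2 (h' p hp).2.2.2⟩

end elliptic

/-! ### Smooth square roots -/

theorem contDiffAt_cexp_half_log {f : ℝ × ℝ → ℂ} {p : ℝ × ℝ} (hf : ContDiffAt ℝ ∞ f p)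
    (h : f p ∈ Complex.slitPlane) : ContDiffAt ℝ ∞ (fun q => Complex.exp (Complex.log (f q) / 2)) p :=
  ((((Complex.contDiffAt_log h).restrict_scalars ℝ).comp p hf).div_const 2).cexp

theorem cexp_half_log_mul_self {z : ℂ} (h : z ≠ 0) :
    Complex.exp (Complex.log z / 2) * Complex.exp (Complex.log z / 2) = z := by
  rw [← Complex.exp_add, add_halves, Complex.exp_log h]

/-- Near `p` the function `k = g(p) exp (½ log (A/A(p)))` is a smooth root of `A` with `k(p) = g(p)
≠ 0`. Then `(g - k)(g + k) = 0` with `g + k ≠ 0` nearby, so `g = k`. -/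
theorem contDiffOn_of_mul_self_eq {W : Set (ℝ × ℝ)} (hW : IsOpen W) {g A : ℝ × ℝ → ℂ}
    (hA : ContDiffOn ℝ ∞ A W) (hA0 : ∀ p ∈ W, A p ≠ 0) (hg : ContinuousOn g W)
    (h : ∀ p ∈ W, g p * g p = A p) : ContDiffOn ℝ ∞ g W := by
  intro p hp
  have hgp : g p ≠ 0 := fun h0 => hA0 p hp (by rw [← h p hp, h0, mul_zero])
  set k : ℝ × ℝ → ℂ := fun q => g p * Complex.exp (Complex.log (A q / A p) / 2) with hk
  have hAp : ContDiffAt ℝ ∞ (fun q => A q / A p) p :=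
    (hA.contDiffAt (hW.mem_nhds hp)).div_const _
  have h1 : A p / A p = 1 := div_self (hA0 p hp)
  have sk : ContDiffAt ℝ ∞ k p := contDiffAt_const.mul (contDiffAt_cexp_half_log hAp (by
    rw [h1]; exact Complex.one_mem_slitPlane))
  have hkp : k p = g p := by simp only [hk, h1, Complex.log_one, zero_div, Complex.exp_zero, mul_one]
  have hgc : ContinuousAt g p := hg.continuousAt (hW.mem_nhds hp)
  have hne : ∀ᶠ q in 𝓝 p, g q + k q ≠ 0 :=
    (hgc.add sk.continuousAt).eventually_ne (by
      change g p + k p ≠ 0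
      rw [hkp, ← two_mul]; exact mul_ne_zero two_ne_zero hgp)
  refine (sk.congr_of_eventuallyEq ?_).contDiffWithinAt
  filter_upwards [hne, hW.mem_nhds hp] with q hq hqW
  have e : k q * k q = A q := by
    have := cexp_half_log_mul_self (div_ne_zero (hA0 q hqW) (hA0 p hp))
    simp only [hk]
    rw [mul_mul_mul_comm, this, h p hp, mul_div_cancel₀ _ (hA0 p hp)]
  have e2 : (g q - k q) * (g q + k q) = 0 := by linear_combination h q hqW - e
  exact sub_eq_zero.1 ((mul_eq_zero.1 e2).resolve_right hq)

theorem isSimplyConnected_disc {r : ℝ} (hr : 0 < r) : IsSimplyConnected (disc r) := by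
  have hc : Convex ℝ (disc r) := by
    have : disc r = toCL ⁻¹' Metric.ball 0 r := by rw [coe_toCL]; rfl
    rw [this]
    exact (convex_ball (0 : ℂ) r).linear_preimage
      ((toCL : (ℝ × ℝ) →L[ℝ] ℂ) : (ℝ × ℝ) →ₗ[ℝ] ℂ)
  have := hc.contractibleSpace ⟨(0, 0), mem_disc_iff.2 (by
    rw [show toC (0, 0) = 0 from rfl, norm_zero]; exact hr)⟩
  exact SimplyConnectedSpace.ofContractible _

theorem exists_smooth_sqrt {r : ℝ} (hr : 0 < r) {A : ℝ × ℝ → ℂ} (hA : ContDiffOn ℝ ∞ A (disc r))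
    (hA0 : ∀ p ∈ disc r, A p ≠ 0) :
    ∃ g : ℝ × ℝ → ℂ, ContDiffOn ℝ ∞ g (disc r) ∧ ∀ p, g p * g p = A p := by
  obtain ⟨g, hg, h⟩ := Complex.exists_continuousOn_pow_eq (isSimplyConnected_disc hr)
    (isOpen_disc r) hA.continuousOn (by rintro ⟨p, hp, h⟩; exact hA0 p hp h) two_ne_zero
  have h' : ∀ p, g p * g p = A p := fun p => by rw [← h p, pow_two]
  exact ⟨g, contDiffOn_of_mul_self_eq (isOpen_disc r) hA hA0 hg fun p _ => h' p, h'⟩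

/-- Take `a₁ = gh`, `a₂ = g h̄` with `g² = A` and `h² = k = (1 + iτ)/2`. Then `a₁² + a₂² = A(k + k̄)
= A` for every real `τ`. The choice `τ = √(1/|A|² - 1)` makes `|k| = 1/(2|A|)`, hence `|a_i|² =
1/2`. It is smooth because `|A| < 1`, and `k` lies in the right half-plane, where the principal
logarithm is smooth. -/
theorem exists_complex_frame_of_sq_add_sq {r : ℝ} (hr : 0 < r) {A : ℝ × ℝ → ℂ}
    (hA : ContDiffOn ℝ ∞ A (disc r)) (hA0 : ∀ p ∈ disc r, A p ≠ 0)
    (hA1 : ∀ p ∈ disc r, Complex.normSq (A p) < 1) :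
    ∃ a₁ a₂ : ℝ × ℝ → ℂ, ContDiffOn ℝ ∞ a₁ (disc r) ∧ ContDiffOn ℝ ∞ a₂ (disc r) ∧
      ∀ p ∈ disc r, a₁ p * (starRingEnd ℂ) (a₁ p) = 1 / 2 ∧
        a₂ p * (starRingEnd ℂ) (a₂ p) = 1 / 2 ∧ a₁ p * a₁ p + a₂ p * a₂ p = A p := by
  obtain ⟨g, sg, hg⟩ := exists_smooth_sqrt hr hA hA0
  have hN0 : ∀ p ∈ disc r, 0 < Complex.normSq (A p) := fun p hp =>
    Complex.normSq_pos.2 (hA0 p hp)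
  have sN : ContDiffOn ℝ ∞ (fun p => Complex.normSq (A p)) (disc r) := by
    simp only [Complex.normSq_apply]
    have h1 : ContDiffOn ℝ ∞ (fun p => (A p).re) (disc r) := Complex.reCLM.contDiff.comp_contDiffOn hA
    have h2 : ContDiffOn ℝ ∞ (fun p => (A p).im) (disc r) := Complex.imCLM.contDiff.comp_contDiffOn hA
    exact (h1.mul h1).add (h2.mul h2)
  set τ : ℝ × ℝ → ℝ := fun p => Real.sqrt ((Complex.normSq (A p))⁻¹ - 1) with hτ
  have hτ0 : ∀ p ∈ disc r, 0 < (Complex.normSq (A p))⁻¹ - 1 := fun p hp =>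
    sub_pos.2 ((one_lt_inv₀ (hN0 p hp)).2 (hA1 p hp))
  have sτ : ContDiffOn ℝ ∞ τ (disc r) :=
    ((sN.inv fun p hp => (hN0 p hp).ne').sub contDiffOn_const).sqrt fun p hp => (hτ0 p hp).ne'
  set k : ℝ × ℝ → ℂ := fun p => (1 + Complex.I * τ p) / 2 with hk
  have hkre : ∀ p, (k p).re = 1 / 2 := fun p => by simp [hk]
  have hkim : ∀ p, (k p).im = τ p / 2 := fun p => by simp [hk]
  have sk : ContDiffOn ℝ ∞ k (disc r) :=
    (contDiffOn_const.add (contDiffOn_const.mul (contDiffOn_ofReal sτ))).div_const 2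
  have hk0 : ∀ p, k p ≠ 0 := fun p h => by
    have := hkre p
    rw [h] at this
    norm_num at this
  set h : ℝ × ℝ → ℂ := fun p => Complex.exp (Complex.log (k p) / 2) with hh
  have hhh : ∀ p, h p * h p = k p := fun p => cexp_half_log_mul_self (hk0 p)
  have sh : ContDiffOn ℝ ∞ h (disc r) := fun p hp =>
    (contDiffAt_cexp_half_log (sk.contDiffAt ((isOpen_disc r).mem_nhds hp)) (Or.inl (by
      rw [hkre]; norm_num))).contDiffWithinAt
  have hnorm : ∀ p ∈ disc r, Complex.normSq (g p) * Complex.normSq (h p) = 1 / 2 := by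
    intro p hp
    have e1 : Complex.normSq (g p) * Complex.normSq (g p) = Complex.normSq (A p) := by
      rw [← map_mul, hg]
    have e2 : Complex.normSq (h p) * Complex.normSq (h p) = (Complex.normSq (A p))⁻¹ / 4 := by
      rw [← map_mul, hhh, Complex.normSq_apply, hkre, hkim]
      have := Real.mul_self_sqrt (hτ0 p hp).le
      linear_combination this / 4
    have e3 : (Complex.normSq (g p) * Complex.normSq (h p)) ^ 2 = (1 / 2) ^ 2 := by
      have := mul_inv_cancel₀ (hN0 p hp).ne'
      linear_combination (Complex.normSq (h p) * Complex.normSq (h p)) * e1 +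
        Complex.normSq (A p) * e2 + this / 4
    exact (sq_eq_sq₀ (mul_nonneg (Complex.normSq_nonneg _) (Complex.normSq_nonneg _))
      (by norm_num)).1 e3
  have hnorm' : ∀ p ∈ disc r, g p * (starRingEnd ℂ) (g p) * (h p * (starRingEnd ℂ) (h p)) = 1 / 2 :=
    fun p hp => by
      rw [Complex.mul_conj, Complex.mul_conj, ← Complex.ofReal_mul, hnorm p hp]
      norm_num
  refine ⟨fun p => g p * h p, fun p => g p * (starRingEnd ℂ) (h p), sg.mul sh,
    sg.mul (contDiffOn_conj sh), fun p hp => ⟨?_, ?_, ?_⟩⟩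
  · rw [map_mul, ← hnorm' p hp]
    ring
  · rw [map_mul, Complex.conj_conj, ← hnorm' p hp]
    ring
  · have e : (starRingEnd ℂ) (h p) * (starRingEnd ℂ) (h p) = (starRingEnd ℂ) (k p) := by
      rw [← map_mul, hhh]
    have e' : k p + (starRingEnd ℂ) (k p) = 1 := by
      apply Complex.ext
      · rw [Complex.add_re, Complex.conj_re, hkre]; norm_num
      · rw [Complex.add_im, Complex.conj_im]; simp
    linear_combination (h p * h p + (starRingEnd ℂ) (h p) * (starRingEnd ℂ) (h p)) * hg p +
      A p * (hhh p + e + e')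

/-! ### Triples and the set `C_s` of an elliptic surface -/

section elliptic

variable {n : ℕ} {s : ℝ × ℝ → Fin (n + 3) → ℝ} {J : ℝ × ℝ → ℝ × ℝ →L[ℝ] ℝ × ℝ}
  {W : Set (ℝ × ℝ)} {r : ℝ} {φ₀ : ℝ × ℝ → ℂ}

theorem pd_ezbar (f : ℝ × ℝ → ℂ) : pd ezbar f = dzbar f := pd_dzbar f

theorem pd_ez (f : ℝ × ℝ → ℂ) : pd ez f = dz f := pd_dz f

theorem pd_ez_conj {f : ℝ × ℝ → ℂ} {p : ℝ × ℝ} (hf : DifferentiableAt ℝ f p) :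
    pd ez (fun q => (starRingEnd ℂ) (f q)) p = (starRingEnd ℂ) (pd ezbar f p) := by
  rw [← pd_conj hf]
  congr 1
  simp [ez, ezbar, conj_two, neg_div]

theorem conj_mul_sub_one_eq_one {x A A' : ℂ} (h : x * (A - 1) = 1) (hA : (starRingEnd ℂ) A = A') :
    (starRingEnd ℂ) x * (A' - 1) = 1 := by
  rw [← hA, ← map_one (starRingEnd ℂ), ← map_sub, ← map_mul, h, map_one]

/-- The Ricci equation of a frame is equivalent to `Q(ρ) = 0`. -/
theorem IsFrame.ricci_iff_ellQ (hs : IsSurface s W) (hW : IsOpen W) {a₁ a₂ ψ₁ ψ₂ : ℝ × ℝ → ℂ}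
    (h : IsFrame W ez ezbar (Γc s) (fun p => (starRingEnd ℂ) (Γc s p)) a₁ a₂
      (fun p => (starRingEnd ℂ) (a₁ p)) (fun p => (starRingEnd ℂ) (a₂ p)) ψ₁ ψ₂) {ζ : ℂ → ℂ}
    (hφ : ContDiffOn ℝ ∞ (phiZeta φ₀ ζ) W)
    (hx : ∀ p ∈ W, 2 * phiZeta φ₀ ζ p * (a₁ p * a₁ p + a₂ p * a₂ p - 1) = 1)
    (hneg : ∀ p ∈ W, 4 * (phiZeta φ₀ ζ p).re + 1 < 0)
    (hA : ∀ p ∈ W, a₁ p * a₁ p + a₂ p * a₂ p ≠ 0)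
    (hδ : ∀ p ∈ W, a₂ p * (starRingEnd ℂ) (a₁ p) - a₁ p * (starRingEnd ℂ) (a₂ p) ≠ 0)
    {p : ℝ × ℝ} (hp : p ∈ W) :
    pd ez ψ₂ p - pd ezbar ψ₁ p = onDzDzbar (metric s p) *
        (a₂ p * (starRingEnd ℂ) (a₁ p) - a₁ p * (starRingEnd ℂ) (a₂ p)) ↔
      ellQ s (rhoZeta φ₀ ζ) p = 0 := by
  set x : ℝ × ℝ → ℂ := fun p => 2 * phiZeta φ₀ ζ p
  -- Here `y = conj x`, so `S = 4 Re φ^ζ + 1` is real and negative, and `S = -ρ²`.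
  set S : ℝ × ℝ → ℂ := fun p => x p + (starRingEnd ℂ) (x p) + 1 with hS
  have sx : ContDiffOn ℝ ∞ x W := contDiffOn_const.mul hφ
  have hSre : ∀ p, S p = ((4 * (phiZeta φ₀ ζ p).re + 1 : ℝ) : ℂ) := fun p => by
    apply Complex.ext <;> simp [hS, x]
    ring
  have hρS : ∀ p ∈ W, S p = (-1) * (rhoZeta φ₀ ζ p * rhoZeta φ₀ ζ p) := fun p hp => by
    rw [rhoZeta, ← Complex.ofReal_mul, Real.mul_self_sqrt (by linarith [hneg p hp]), hSre]
    push_cast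
    ring
  have sρ : ContDiffOn ℝ ∞ (rhoZeta φ₀ ζ) W := by
    have sre : ContDiffOn ℝ ∞ (fun p => (phiZeta φ₀ ζ p).re) W :=
      Complex.reCLM.contDiff.comp_contDiffOn hφ
    exact contDiffOn_ofReal ((((contDiffOn_const.mul sre).add contDiffOn_const).neg).sqrt
      fun q hq => by linarith [hneg q hq])
  have hρ0 : rhoZeta φ₀ ζ p ≠ 0 := by
    rw [rhoZeta, Complex.ofReal_ne_zero]
    exact (Real.sqrt_pos.2 (by linarith [hneg p hp])).ne'
  have hconj : ∀ p, (starRingEnd ℂ) (a₁ p * a₁ p + a₂ p * a₂ p) =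
      (starRingEnd ℂ) (a₁ p) * (starRingEnd ℂ) (a₁ p) +
        (starRingEnd ℂ) (a₂ p) * (starRingEnd ℂ) (a₂ p) := fun p => by
    rw [map_add, map_mul, map_mul]
  have sΓ := hs.contDiffOn_Γc hW
  have hm := mul_hess_sqrt (Γ := Γc s) (Γ' := fun p => (starRingEnd ℂ) (Γc s p))
    (F := onDzDzbar (metric s p)) (c := ez) (d := ezbar) hW (by norm_num) sρ hρS hp
  beta_reduce at hm
  have h4 : (4 : ℂ) ≠ 0 := by norm_num
  rw [h.ricci_iff hW sΓ (contDiffOn_conj sΓ) sx (contDiffOn_conj sx) hx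
    (fun q hq => conj_mul_sub_one_eq_one (hx q hq) (hconj q)) (S := S) (fun _ => rfl) hA
    (fun q hq => by rw [← hconj]; exact (map_ne_zero _).2 (hA q hq)) hδ hp,
    hm, mul_eq_zero,
    or_iff_right (mul_ne_zero h4 (pow_ne_zero 3 hρ0)), ellQ]
  simp only [pd_ez, pd_ezbar]

theorem ellCorr_iff (hJ : ∀ p ∈ W, J p eu = ev ∧ J p ev = -eu) {T : Triple} {a₁ a₂ : ℝ × ℝ → ℂ}
    (h1 : ∀ p ∈ W, ActsAs (T.D₁ p) (a₁ p)) (h2 : ∀ p ∈ W, ActsAs (T.D₂ p) (a₂ p)) {ζ : ℂ → ℂ} :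
    ellCorr J W φ₀ T ζ ↔
      ∀ p ∈ W, 2 * (a₁ p * a₁ p + a₂ p * a₂ p) = 2 + 1 / phiZeta φ₀ ζ p := by
  refine forall₂_congr fun p hp => ?_
  have aJ : ActsAs (J p) Complex.I := .of_frame (by rw [(hJ p hp).1, toC_ev]) (by
    rw [(hJ p hp).2, ← neg_one_smul ℝ, toC_smul, toC_eu, Complex.I_mul_I]; simp)
  rw [(((h1 p hp).sq.add (h2 p hp).sq).smul 2).eq_iff
    ((ActsAs.one.smul _).add (aJ.smul _)), mul_one, Complex.re_add_im]
  norm_num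

/-- The hypothesis says that `x` is nearer to `-1` than to `0`. -/
theorem normSq_one_add_inv_lt_one {x : ℂ} (hx : x ≠ 0) (h : 2 * x.re + 1 < 0) :
    Complex.normSq (1 + x⁻¹) < 1 := by
  have hx' := Complex.normSq_pos.2 hx
  rw [show 1 + x⁻¹ = (x + 1) / x by field_simp, Complex.normSq_div, div_lt_one hx',
    Complex.normSq_apply, Complex.normSq_apply]
  simp only [Complex.add_re, Complex.one_re, Complex.add_im, Complex.one_im]
  nlinarith

/-- Here `δ = 2ik` with `k` real and nonzero, and `x = 2φ`. The relation `S = δ²|x|²` becomes `4 Re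
φ + 1 = -16k²|φ|²`. -/
theorem four_mul_re_add_one_neg {φ a₁ a₂ A : ℂ} (hφ : 2 * φ * (A - 1) = 1)
    (hsq : (a₂ * (starRingEnd ℂ) a₁ - a₁ * (starRingEnd ℂ) a₂) ^ 2 = A * (starRingEnd ℂ) A - 1)
    (hδ : a₂ * (starRingEnd ℂ) a₁ - a₁ * (starRingEnd ℂ) a₂ ≠ 0) : 4 * φ.re + 1 < 0 := by
  have hφ0 : φ ≠ 0 := fun h0 => by simp [h0] at hφ
  have e : a₂ * (starRingEnd ℂ) a₁ - a₁ * (starRingEnd ℂ) a₂ =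
      2 * Complex.I * ((a₂.im * a₁.re - a₂.re * a₁.im : ℝ) : ℂ) := by
    apply Complex.ext <;> simp <;> ring
  set k : ℝ := a₂.im * a₁.re - a₂.re * a₁.im
  have hk : k ≠ 0 := fun h0 => hδ (by rw [e, h0]; simp)
  have hφ' : 2 * (starRingEnd ℂ) φ * ((starRingEnd ℂ) A - 1) = 1 := by
    have := conj_mul_sub_one_eq_one hφ rfl
    rwa [map_mul, conj_two] at this
  have h1 : ((4 * φ.re + 1 : ℝ) : ℂ) = ((-(16 * k ^ 2 * Complex.normSq φ) : ℝ) : ℂ) := by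
    have e1 : ((4 * φ.re + 1 : ℝ) : ℂ) = 2 * φ + 2 * (starRingEnd ℂ) φ + 1 := by
      apply Complex.ext <;> simp
      ring
    rw [e1]
    push_cast
    rw [← Complex.mul_conj]
    rw [e] at hsq
    linear_combination (-2 * (starRingEnd ℂ) φ * ((starRingEnd ℂ) A)) * hφ - (2 * φ + 1) * hφ' -
      (4 * φ * (starRingEnd ℂ) φ) * hsq + (16 * k ^ 2 * φ * (starRingEnd ℂ) φ) * Complex.I_sq
  rw [Complex.ofReal_inj] at h1
  rw [h1, neg_lt_zero]
  have := Complex.normSq_pos.2 hφ0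
  positivity

/-- Every admissible triple has an associated element of `C_s`. -/
theorem IsSurface.exists_ellCorr (hs : IsSurface s (disc r))
    (hJ : ∀ p ∈ disc r, J p eu = ev ∧ J p ev = -eu) (h₀ : IsNormalization s (disc r) φ₀)
    {T : Triple} (hT : IsAdmissible s J (disc r) T) :
    ∃ ζ ∈ ellC s r φ₀, ellCorr J (disc r) φ₀ T ζ := by
  have hW := isOpen_disc r
  have h1 : ∀ p ∈ disc r, ActsAs (T.D₁ p) (toC (T.D₁ p eu)) := fun p hp =>
    actsAs_of_mem_span (hJ p hp) (hT.span₁ p hp)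
  have h2 : ∀ p ∈ disc r, ActsAs (T.D₂ p) (toC (T.D₂ p eu)) := fun p hp =>
    actsAs_of_mem_span (hJ p hp) (hT.span₂ p hp)
  obtain ⟨hf, hr⟩ := (hs.ell_admissible_iff hW hJ h1 h2).1 hT
  set a₁ : ℝ × ℝ → ℂ := fun p => toC (T.D₁ p eu)
  set a₂ : ℝ × ℝ → ℂ := fun p => toC (T.D₂ p eu)
  set x : ℝ × ℝ → ℂ := fun p => (a₁ p * a₁ p + a₂ p * a₂ p - 1)⁻¹
  have hA1 : ∀ p ∈ disc r, a₁ p * a₁ p + a₂ p * a₂ p - 1 ≠ 0 := fun p hp =>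
    sub_ne_zero.2 (hr p hp).2.2.2
  have hxa : ∀ p ∈ disc r, x p * (a₁ p * a₁ p + a₂ p * a₂ p - 1) = 1 := fun p hp =>
    inv_mul_cancel₀ (hA1 p hp)
  have sx : ContDiffOn ℝ ∞ x (disc r) := (((hf.smooth_a₁.mul hf.smooth_a₁).add
    (hf.smooth_a₂.mul hf.smooth_a₂)).sub contDiffOn_const).inv hA1
  have hφ : ∀ p ∈ disc r, HasPd ezbar (fun q => 1 / 2 * x q) (2 * Γc s p * (1 / 2 * x p)) p :=
    fun p hp => by
      have := (hasPd_of_contDiffOn (c := ezbar) hW sx hp).const_mul (1 / 2)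
      rw [hf.pd_inv hW sx hxa hp] at this
      refine ⟨this.1, this.2.trans (by ring)⟩
  obtain ⟨ζ, hζ, he⟩ := h₀.exists_eq_phiZeta (fun p hp => (hφ p hp).1) fun p hp => by
    rw [← pd_ezbar]; exact (hφ p hp).2
  have hx : ∀ p ∈ disc r, 2 * phiZeta φ₀ ζ p * (a₁ p * a₁ p + a₂ p * a₂ p - 1) = 1 := fun p hp => by
    rw [← he hp]
    linear_combination hxa p hp
  have hneg : ∀ p ∈ disc r, 4 * (phiZeta φ₀ ζ p).re + 1 < 0 := fun p hp =>
    four_mul_re_add_one_neg (hx p hp) (by rw [hf.delta_sq hp, map_add, map_mul, map_mul])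
      (hr p hp).2.1
  refine ⟨ζ, ⟨hζ, fun p hp => ⟨fun h0 => (hr p hp).2.2.1 ?_, hneg p hp⟩, fun p hp => ?_⟩,
    (ellCorr_iff hJ h1 h2).2 fun p hp => ?_⟩
  -- The value `φ = -1/2` corresponds to `A = 0`, that is, to `D₂² = -D₁²`.
  · have := hx p hp
    rw [h0] at this
    linear_combination -this
  · exact (hf.ricci_iff_ellQ hs hW (h₀.isSolution_phiZeta hζ).1 hx hneg
      (fun q hq => (hr q hq).2.2.1) (fun q hq => (hr q hq).2.1) hp).1 (hr p hp).1
  · have e := hx p hp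
    have hne : phiZeta φ₀ ζ p ≠ 0 := fun h0 => by simp [h0] at e
    field_simp
    linear_combination e

/-- The endomorphism of the plane given by a complex multiplication. -/
noncomputable def mulC (a : ℂ) : ℝ × ℝ →L[ℝ] ℝ × ℝ :=
  (ContinuousLinearMap.fst ℝ ℝ ℝ).smulRight (a.re, a.im) +
    (ContinuousLinearMap.snd ℝ ℝ ℝ).smulRight (-a.im, a.re)

theorem actsAs_mulC (a : ℂ) : ActsAs (mulC a) a := by
  refine .of_frame ?_ ?_ <;> apply Complex.ext <;> simp [mulC, toC, eu, ev]

/-- The real one-form whose value on `∂_{z̄}` is `a`. -/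
noncomputable def realForm (a : ℂ) : ℝ × ℝ →L[ℝ] ℝ :=
  (ContinuousLinearMap.fst ℝ ℝ ℝ).smulRight (2 * a.re) +
    (ContinuousLinearMap.snd ℝ ℝ ℝ).smulRight (2 * a.im)

theorem onDzbar_realForm (a : ℂ) : onDzbar (realForm a) = a := by
  apply Complex.ext <;> simp [onDzbar, realForm, eu, ev]

theorem IsFrame.congr_ψ₁ {c d : ℂ × ℂ} {Γ Γ' a₁ a₂ b₁ b₂ ψ₁ ψ₁' ψ₂ : ℝ × ℝ → ℂ}
    (h : IsFrame W c d Γ Γ' a₁ a₂ b₁ b₂ ψ₁ ψ₂) (he : ∀ p ∈ W, ψ₁' p = ψ₁ p) :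
    IsFrame W c d Γ Γ' a₁ a₂ b₁ b₂ ψ₁' ψ₂ :=
  { h with
    smooth_ψ₁ := h.smooth_ψ₁.congr he
    cod_b₁ := fun p hp => by rw [he p hp, h.cod_b₁ p hp]
    cod_b₂ := fun p hp => by rw [he p hp, h.cod_b₂ p hp] }

/-- Every element of `C_s` comes from an admissible triple. -/
theorem IsSurface.exists_ellCorr_symm (hr : 0 < r) (hs : IsSurface s (disc r))
    (hJ : ∀ p ∈ disc r, J p eu = ev ∧ J p ev = -eu) (h₀ : IsNormalization s (disc r) φ₀)
    {ζ : ℂ → ℂ} (hζ : ζ ∈ ellC s r φ₀) :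
    ∃ T, IsAdmissible s J (disc r) T ∧ ellCorr J (disc r) φ₀ T ζ := by
  have hW := isOpen_disc r
  obtain ⟨hol, hφ, hQ⟩ := hζ
  obtain ⟨sφ, hdφ⟩ := h₀.isSolution_phiZeta hol
  set x : ℝ × ℝ → ℂ := fun p => 2 * phiZeta φ₀ ζ p with hxdef
  have sx : ContDiffOn ℝ ∞ x (disc r) := contDiffOn_const.mul sφ
  have hxre : ∀ p ∈ disc r, 2 * (x p).re + 1 < 0 := fun p hp => by
    have := (hφ p hp).2
    simp only [hxdef, Complex.mul_re, Complex.re_ofNat, Complex.im_ofNat, zero_mul, sub_zero]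
    linarith
  have hx0 : ∀ p ∈ disc r, x p ≠ 0 := fun p hp h0 => by
    have := hxre p hp
    rw [h0] at this
    norm_num at this
  have hA0 : ∀ p ∈ disc r, 1 + (x p)⁻¹ ≠ 0 := fun p hp h0 => (hφ p hp).1 (by
    have := hx0 p hp
    field_simp at h0
    simp only [hxdef] at h0
    linear_combination h0 / 2)
  obtain ⟨a₁, a₂, sa₁, sa₂, hab⟩ := exists_complex_frame_of_sq_add_sq hr
    (contDiffOn_const.add (sx.inv hx0)) hA0
    (fun p hp => normSq_one_add_inv_lt_one (hx0 p hp) (hxre p hp))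
  have hA : ∀ p ∈ disc r, a₁ p * a₁ p + a₂ p * a₂ p = 1 + (x p)⁻¹ := fun p hp => (hab p hp).2.2
  have hB : ∀ p ∈ disc r, (starRingEnd ℂ) (a₁ p) * (starRingEnd ℂ) (a₁ p) +
      (starRingEnd ℂ) (a₂ p) * (starRingEnd ℂ) (a₂ p) = 1 + ((starRingEnd ℂ) (x p))⁻¹ := fun p hp => by
    rw [← map_mul, ← map_mul, ← map_add, hA p hp, map_add, map_inv₀, map_one]
  have hAne : ∀ p ∈ disc r, a₁ p * a₁ p + a₂ p * a₂ p ≠ 0 := fun p hp => by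
    rw [hA p hp]; exact hA0 p hp
  have hBne : ∀ p ∈ disc r, (starRingEnd ℂ) (a₁ p) * (starRingEnd ℂ) (a₁ p) +
      (starRingEnd ℂ) (a₂ p) * (starRingEnd ℂ) (a₂ p) ≠ 0 := fun p hp => by
    rw [← map_mul, ← map_mul, ← map_add]; exact (map_ne_zero _).2 (hAne p hp)
  have hdx : ∀ p ∈ disc r, pd ezbar x p = 2 * Γc s p * x p := fun p hp => by
    rw [hxdef, ((hasPd_of_contDiffOn hW sφ hp).const_mul 2).2, pd_ezbar, hdφ p hp]
    ring
  have sΓ := hs.contDiffOn_Γc hW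
  have hf := exists_isFrame (c := ez) (d := ezbar) hW sΓ (contDiffOn_conj sΓ) sa₁ sa₂
    (contDiffOn_conj sa₁) (contDiffOn_conj sa₂) (fun p hp => (hab p hp).1)
    (fun p hp => (hab p hp).2.1) hAne hBne
    (fun p hp => pd_one_add_inv hW sx hx0 hp (hdx p hp) hA)
    (fun p hp => pd_one_add_inv hW (contDiffOn_conj sx)
      (fun q hq => (map_ne_zero _).2 (hx0 q hq)) hp (by
        rw [pd_ez_conj (differentiableAt_of_contDiffOn hW sx hp), hdx p hp]
        simp only [map_mul, conj_two]) hB)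
  -- The two components supplied by `exists_isFrame` are conjugate, so they come from a real
  -- one-form.
  have hψ : ∀ p ∈ disc r, (starRingEnd ℂ) ((a₂ p * pd ezbar a₁ p - a₁ p * pd ezbar a₂ p -
      (a₂ p * (starRingEnd ℂ) (a₁ p) - a₁ p * (starRingEnd ℂ) (a₂ p)) * Γc s p) *
        (a₁ p * a₁ p + a₂ p * a₂ p)⁻¹) =
      ((starRingEnd ℂ) (a₂ p) * pd ez (fun p => (starRingEnd ℂ) (a₁ p)) p -
        (starRingEnd ℂ) (a₁ p) * pd ez (fun p => (starRingEnd ℂ) (a₂ p)) p -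
        ((starRingEnd ℂ) (a₂ p) * a₁ p - (starRingEnd ℂ) (a₁ p) * a₂ p) * (starRingEnd ℂ) (Γc s p)) *
        ((starRingEnd ℂ) (a₁ p) * (starRingEnd ℂ) (a₁ p) +
          (starRingEnd ℂ) (a₂ p) * (starRingEnd ℂ) (a₂ p))⁻¹ := fun p hp => by
    rw [pd_ez_conj (differentiableAt_of_contDiffOn hW sa₁ hp),
      pd_ez_conj (differentiableAt_of_contDiffOn hW sa₂ hp)]
    simp only [map_mul, map_sub, map_add, map_inv₀, Complex.conj_conj]
  obtain ⟨ψ₂, hf⟩ : ∃ ψ₂ : ℝ × ℝ → ℂ, IsFrame (disc r) ez ezbar (Γc s)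
      (fun p => (starRingEnd ℂ) (Γc s p)) a₁ a₂ (fun p => (starRingEnd ℂ) (a₁ p))
      (fun p => (starRingEnd ℂ) (a₂ p)) (fun p => (starRingEnd ℂ) (ψ₂ p)) ψ₂ :=
    ⟨_, hf.congr_ψ₁ hψ⟩
  set T : Triple := ⟨fun p => mulC (a₁ p), fun p => mulC (a₂ p), fun p => realForm (ψ₂ p)⟩
  have h1 : ∀ p ∈ disc r, ActsAs (T.D₁ p) (a₁ p) := fun p _ => actsAs_mulC _
  have h2 : ∀ p ∈ disc r, ActsAs (T.D₂ p) (a₂ p) := fun p _ => actsAs_mulC _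
  have hψ₂ : (fun p => onDzbar (T.ψ p)) = ψ₂ := funext fun p => onDzbar_realForm _
  have hψ₁ : (fun p => onDz (T.ψ p)) = fun p => (starRingEnd ℂ) (ψ₂ p) := funext fun p => by
    rw [← conj_onDzbar]
    exact congrArg _ (onDzbar_realForm _)
  have hxA : ∀ p ∈ disc r, x p * (a₁ p * a₁ p + a₂ p * a₂ p - 1) = 1 := fun p hp => by
    rw [hA p hp, add_sub_cancel_left, mul_inv_cancel₀ (hx0 p hp)]
  -- By `delta_sq`, `δ = 0` would mean `|A| = 1`.
  have hδ : ∀ p ∈ disc r, a₂ p * (starRingEnd ℂ) (a₁ p) - a₁ p * (starRingEnd ℂ) (a₂ p) ≠ 0 := by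
    intro p hp h0
    have e := hf.delta_sq hp
    rw [h0, ← map_mul, ← map_mul, ← map_add, Complex.mul_conj, hA p hp, eq_comm,
      zero_pow two_ne_zero, sub_eq_zero, Complex.ofReal_eq_one] at e
    exact (normSq_one_add_inv_lt_one (hx0 p hp) (hxre p hp)).ne e
  refine ⟨T, (hs.ell_admissible_iff hW hJ h1 h2).2 ⟨by rw [hψ₁, hψ₂]; exact hf, fun p hp =>
    ⟨?_, hδ p hp, hAne p hp, sub_ne_zero.1 (right_ne_zero_of_mul_eq_one (hxA p hp))⟩⟩,
    (ellCorr_iff hJ h1 h2).2 fun p hp => ?_⟩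
  · rw [hψ₁, hψ₂]
    exact (hf.ricci_iff_ellQ hs hW sφ hxA (fun q hq => (hφ q hq).2) hAne hδ hp).2 (hQ p hp)
  · rw [hA p hp, hxdef]
    ring

/-- Real and imaginary parts of the value on `∂_{z̄}` are, up to the factor `1/2`, the values on
`∂_u` and `∂_v`. -/
theorem eq_of_onDzbar_eq {ψ ψ' : ℝ × ℝ →L[ℝ] ℝ} {t : ℝ} (h : onDzbar ψ' = t * onDzbar ψ) :
    ψ' = t • ψ := by
  refine clm_ext_frame ?_ ?_
  · have := congrArg Complex.re h
    simp [onDzbar] at this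
    rw [_root_.smul_apply, smul_eq_mul]
    linarith
  · have := congrArg Complex.im h
    simp [onDzbar] at this
    rw [_root_.smul_apply, smul_eq_mul]
    linarith

/-- Triples are equivalent if and only if they have the same element of `C_s`. -/
theorem IsSurface.ell_equivalent_iff (hs : IsSurface s (disc r))
    (hJ : ∀ p ∈ disc r, J p eu = ev ∧ J p ev = -eu) (h₀ : IsNormalization s (disc r) φ₀)
    {T T' : Triple} (hT : IsAdmissible s J (disc r) T) (hT' : IsAdmissible s J (disc r) T')
    {ζ ζ' : ℂ → ℂ} (h : ellCorr J (disc r) φ₀ T ζ) (h' : ellCorr J (disc r) φ₀ T' ζ') :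
    T.Equivalent (disc r) T' ↔ EqOn ζ ζ' (Metric.ball 0 r) := by
  have hW := isOpen_disc r
  have h1 : ∀ p ∈ disc r, ActsAs (T.D₁ p) (toC (T.D₁ p eu)) := fun p hp =>
    actsAs_of_mem_span (hJ p hp) (hT.span₁ p hp)
  have h2 : ∀ p ∈ disc r, ActsAs (T.D₂ p) (toC (T.D₂ p eu)) := fun p hp =>
    actsAs_of_mem_span (hJ p hp) (hT.span₂ p hp)
  have h1' : ∀ p ∈ disc r, ActsAs (T'.D₁ p) (toC (T'.D₁ p eu)) := fun p hp =>
    actsAs_of_mem_span (hJ p hp) (hT'.span₁ p hp)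
  have h2' : ∀ p ∈ disc r, ActsAs (T'.D₂ p) (toC (T'.D₂ p eu)) := fun p hp =>
    actsAs_of_mem_span (hJ p hp) (hT'.span₂ p hp)
  have c := (ellCorr_iff hJ h1 h2).1 h
  have c' := (ellCorr_iff hJ h1' h2').1 h'
  constructor
  · intro he z hz
    have hp : (z.re, z.im) ∈ disc r := hz
    have e := ((h1' _ hp).sq.add (h2' _ hp).sq).eq_iff ((h1 _ hp).sq.add (h2 _ hp).sq) |>.1
      (he.sq_add_sq hp)
    have e1 := c _ hp
    rw [← e, c' _ hp, add_right_inj, one_div, one_div, inv_inj] at e1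
    exact (mul_right_cancel₀ (h₀.2 _ hp) e1).symm
  · intro he
    obtain ⟨hf, hr⟩ := (hs.ell_admissible_iff hW hJ h1 h2).1 hT
    obtain ⟨hf', -⟩ := (hs.ell_admissible_iff hW hJ h1' h2').1 hT'
    have hAA : ∀ p ∈ disc r, toC (T'.D₁ p eu) * toC (T'.D₁ p eu) +
        toC (T'.D₂ p eu) * toC (T'.D₂ p eu) = toC (T.D₁ p eu) * toC (T.D₁ p eu) +
        toC (T.D₂ p eu) * toC (T.D₂ p eu) := fun p hp => by
      apply mul_left_cancel₀ (two_ne_zero (α := ℂ))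
      rw [c p hp, c' p hp, phiZeta, phiZeta, he hp]
    obtain ⟨ε₁, ε₂, s1, s2, hε⟩ := hf.eq_up_to_sign hW (isPreconnected_disc r) hf' hAA
      (fun p hp => by simp only [← map_mul, ← map_add, hAA p hp])
      (fun p hp => (hr p hp).2.2.1)
      (fun p hp => by
        simp only [← map_mul, ← map_add]; exact (map_ne_zero _).2 (hr p hp).2.2.1)
      (fun p hp => (hr p hp).2.1)
    refine ⟨ε₁, ε₂, s1, s2, hε.imp (fun H p hp => ?_) fun H p hp => ?_⟩ <;>
      obtain ⟨e1, e2, -, -, -, e6⟩ := H p hp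
    · exact ⟨((h1' p hp).eq_iff ((h1 p hp).smul ε₁)).2 e1, ((h2' p hp).eq_iff
        ((h2 p hp).smul ε₂)).2 e2, eq_of_onDzbar_eq (by push_cast; exact e6)⟩
    · exact ⟨((h1' p hp).eq_iff ((h2 p hp).smul ε₁)).2 e1, ((h2' p hp).eq_iff
        ((h1 p hp).smul ε₂)).2 e2, eq_of_onDzbar_eq (by push_cast; exact e6)⟩

/-- The classes of admissible triples correspond to the elements of `C_s`. -/
theorem IsSurface.ell_inducesBijection (hr : 0 < r) (hs : IsSurface s (disc r))
    (hJ : ∀ p ∈ disc r, J p eu = ev ∧ J p ev = -eu) (h₀ : IsNormalization s (disc r) φ₀) :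
    InducesBijection {T | IsAdmissible s J (disc r) T} (Triple.Equivalent (disc r))
      (ellC s r φ₀) (fun ζ ζ' => EqOn ζ ζ' (Metric.ball 0 r)) (ellCorr J (disc r) φ₀) :=
  ⟨fun _ hT => hs.exists_ellCorr hJ h₀ hT, fun _ hζ => hs.exists_ellCorr_symm hr hJ h₀ hζ,
    fun _ hT _ hT' _ _ _ _ h h' => hs.ell_equivalent_iff hJ h₀ hT hT' h h'⟩

end elliptic

end ConjugateSurface

theorem proposition5p3 (n : ℕ) (s : ℝ × ℝ → Fin (n + 3) → ℝ)
    (J : ℝ × ℝ → (ℝ × ℝ →L[ℝ] ℝ × ℝ)) :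
    -- hyperbolic surfaces, in real-conjugate coordinates
    (∀ I K : Set ℝ, IsOpen I → I.OrdConnected → 0 ∈ I → IsOpen K → K.OrdConnected → 0 ∈ K →
      IsSurface s (I ×ˢ K) → IsHyperbolic s J (I ×ˢ K) →
      (∀ p ∈ I ×ˢ K, J p eu = eu ∧ J p ev = -ev) →
      ((∃ T, IsAdmissible s J (I ×ˢ K) T) ↔ (hypC s I K).Nonempty) ∧
      InducesBijection {T | IsAdmissible s J (I ×ˢ K) T} (Triple.Equivalent (I ×ˢ K))
        (hypC s I K) (fun UV UV' => Set.EqOn UV.1 UV'.1 I ∧ Set.EqOn UV.2 UV'.2 K)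
        (hypCorr s (I ×ˢ K))) ∧
    -- elliptic surfaces, in complex-conjugate coordinates
    (∀ r : ℝ, 0 < r → IsSurface s (disc r) → IsElliptic s J (disc r) →
      (∀ p ∈ disc r, J p eu = ev ∧ J p ev = -eu) →
      (∃ φ₀, IsNormalization s (disc r) φ₀) ∧
      (∀ φ₀, IsNormalization s (disc r) φ₀ →
        ((∃ T, IsAdmissible s J (disc r) T) ↔ (ellC s r φ₀).Nonempty) ∧
        InducesBijection {T | IsAdmissible s J (disc r) T} (Triple.Equivalent (disc r))
          (ellC s r φ₀) (fun ζ ζ' => Set.EqOn ζ ζ' (Metric.ball 0 r))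
          (ellCorr J (disc r) φ₀)) ∧
      -- if `Γ(z, z̄)` extends to independent variables, then there is a normalization for which
      -- `φ^ζ` is the unique solution with `φ^ζ(z, 0) = ζ(z)`
      ((∃ G, IsPolarization r (Γc s) G) →
        ∃ φ₀, IsNormalization s (disc r) φ₀ ∧
          ∀ ζ : ℂ → ℂ, DifferentiableOn ℂ ζ (Metric.ball 0 r) → ∀ φ : ℝ × ℝ → ℂ,
            (IsSolution s (disc r) φ ∧ HasInitialValue r φ ζ) ↔
              Set.EqOn φ (phiZeta φ₀ ζ) (disc r))) := by
  refine ⟨fun I K hI hIc hI0 hK hKc hK0 hs _ hJ => ?_, fun r hr hs _ hJ =>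
    ⟨hs.exists_isNormalization hr, fun φ₀ h₀ => ?_, fun ⟨_, hG⟩ =>
      hs.exists_isNormalization_hasInitialValue hr hG⟩⟩
  · have h := hs.hyp_inducesBijection hI hIc hI0 hK hKc hK0 hJ
    exact ⟨h.exists_iff, h⟩
  · have h := hs.ell_inducesBijection hr hJ h₀
    exact ⟨h.exists_iff, h⟩
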